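/- Fix individual names, concept names, role names and variables, and sets of rigid concept and role names. Let $\mathcal O$ be a DL-Lite$^{\mathcal H}_{horn}$ ontology (finitely many concept inclusions $B_1\sqcap\dots\sqcap B_m\sqsubseteq B$ or $B_1\sqcap\dots\sqcap B_m\sqsubseteq\bot$ between basic concepts $A$, $\exists R$, $\exists R^-$, and role inclusions). Let $\Phi$ be a Boolean temporal conjunctive query over the concept and role names of $\mathcal O$ whose CQs $\varphi_1,\dots,\varphi_m$ have pairwise disjoint sets of variables. Let $\mathcal W=\{W_1,\dots,W_k\}$ be a family of worlds, a world $W$ being a set of CQs of $\Phi$, and let $d\in\mathbb N$. Interpretations satisfy the unique name assumption, and $\models$ is entailment over all such interpretations. ABoxes are finite sets of assertions $B(a),\neg B(a),R(a,b),\neg R(a,b)$ over the concept and role names of $\mathcal O$. For a sequence $\mathfrak A=(\mathcal A_i)_{0\le i\le n}$ of ABoxes, $\mathsf N_I(\mathfrak A)$ is the set of its individual names; only sequences with $\mathsf N_I(\Phi)\subseteq\mathsf N_I(\mathfrak A)$ are considered. Put $\mathcal A_{-1}:=\emptyset$ and, for $1\le j\le k$, $\mathcal A_{n+j}:=\emptyset$.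 *Auxiliary ABoxes.* There are fresh, pairwise different individual names $a_x$ for variables $x$, and $a_{b\varrho}$ for non-empty words $\varrho$ of roles, where $b$ is an original individual name or some $a_x$; we write $a_b:=b$. For a CQ $\varphi$, $\mathcal A_\varphi$ is the set of its atoms with each variable $x$ replaced by $a_x$, and $\mathcal A_Q:=\bigcup_{\varphi\in Q}\mathcal A_\varphi$. $\mathrm{rigcons}(Q)$ is the union, over $\varphi\in Q$, of the sets of positive rigid assertions $\alpha$ over the individual names of $\mathcal A_\varphi$ and the names of $\mathcal O$ with $\langle\mathcal O,\mathcal A_\varphi\rangle\models\alpha$. For a flexible role $S$ of $\mathcal O$, the ABox $\mathcal A_{\exists S(b)}$ consists of all assertions $B(a_{b\varrho R})$ with $B$ a rigid basic concept of $\mathcal O$ and $\mathcal O\models\exists R^-\sqsubseteq B$, and all $R'(a_{b\varrho},a_{b\varrho R})$ with $R'$ a rigid role of $\mathcal O$ and $\mathcal O\models R\sqsubseteq R'$, where $\varrho R=R_1\dots R_l$ ranges over the words of roles of $\mathcal O$ with $R_1=S$, $1\le l\le d$ and $\mathcal O\models\exists R_i^-\sqsubseteq\exists R_{i+1}$ for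 $1\le i<l$. For a set $F$ of assertions $\exists S(b)$, $\mathcal A_F:=\bigcup_{\exists S(b)\in F}\mathcal A_{\exists S(b)}$. *r-complete tuples.* Let $\iota:[0,n]\to[1,k]$, extended by $\iota(n+j):=j$ for $1\le j\le k$. A rigid ABox type for $\mathfrak A$ is a set of rigid assertions over $\mathsf N_I(\mathfrak A)$ and the names of $\mathcal O$ that contains exactly one of $\alpha,\neg\alpha$ for each positive such assertion $\alpha$. A rigid witness query of a CQ $\varphi$ is a CQ $\psi$ over the terms of $\varphi$ and the rigid names of $\mathcal O$ such that every model of $\mathcal O$ and $\psi$ is a model of $\varphi$. A tuple $(\mathcal A_R,Q_R,Q_R^\neg,R_F)$, with $\mathcal A_R$ a rigid ABox type for $\mathfrak A$, $Q_R,Q_R^\neg\subseteq\{\varphi_1,\dots,\varphi_m\}$, and $R_F$ a set of assertions $\exists S(b)$ with $S$ a flexible role of $\mathcal O$ and $b\in\mathsf N_I(\mathfrak A)\cup\{a_x\mid x\text{ a variable of }\Phi\}$, is *r-complete* w.r.t. $\mathcal W,\iota$ if for all $i\in[0,n+k]$, with $\mathcal K_i:=\langle\mathcal O,\ \mathcal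 A_R\cup\mathrm{rigcons}(Q_R)\cup\mathcal A_{W_{\iota(i)}}\cup\mathcal A_{R_F}\cup\mathcal A_i\rangle$: $\mathcal K_i$ is consistent; $\mathcal K_i\not\models\varphi_j$ for all $\varphi_j\notin W_{\iota(i)}$; $W_{\iota(i)}\subseteq Q_R$; $\varphi_j\in Q_R^\neg$ for all $\varphi_j\notin W_{\iota(i)}$; $\mathcal K_i\not\models\psi$ for all rigid witness queries $\psi$ of CQs in $Q_R^\neg$; and moreover, for all flexible roles $S$ of $\mathcal O$ and all $b\in\mathsf N_I(\mathfrak A)\cup\{a_x\mid x\text{ a variable of }\Phi\}$, $\exists S(b)\in R_F$ iff $\langle\mathcal O,\mathcal A_R\cup\mathrm{rigcons}(Q_R)\cup\mathcal A_{W_{\iota(i)}}\cup\mathcal A_i\rangle\models\exists S(b)$ for some $i\in[0,n+k]$. *The minimized tuple.* Let $\mathcal B_\Phi$ be a set of assertions $B(a)$ with $B$ a basic concept of $\mathcal O$ and $a\in\mathsf N_I(\Phi)$. Let $Q_R^s$ be the set of CQs $\varphi_j$ that belong to some $W\in\mathcal W$, and $Q_R^{\neg s}$ the set of those that do not belong to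 some $W\in\mathcal W$. Let $\mathcal A^s_0$ be the set of positive rigid assertions over $\mathsf N_I(\mathfrak A)$ and the names of $\mathcal O$ that are in $\mathcal B_\Phi\cup\mathrm{rigcons}(Q_R^s)$; let $\mathcal A^s_{j+1}$ be the set of those $\alpha$ with $\langle\mathcal O,\mathcal A^s_j\cup\mathcal A_p\rangle\models\alpha$ for some $p\in[0,n]$; and let $\mathcal A_R^s$ be the rigid ABox type with positive part $\bigcup_j\mathcal A^s_j$. Let $R_F^s$ be the set of all $\exists S(b)$, $S$ a flexible role of $\mathcal O$, such that (i) $b=a_x$ for a variable $x$ of $\Phi$ and $\langle\mathcal O,\mathcal A_W\rangle\models\exists S(b)$ for some $W\in\mathcal W$; or (ii) $b\in\mathsf N_I(\Phi)$ and $\exists S(b)\in\mathcal B_\Phi$; or (iii) $b\in\mathsf N_I(\mathfrak A)\setminus\mathsf N_I(\Phi)$ and $\langle\mathcal O,\mathcal A_R^s\cup\mathcal A_i\rangle\models\exists S(b)$ for some $i\in[0,n]$. For $W\in\mathcal W$ put $\mathcal A^s_{W}:=\mathcal A_R^s\cup\mathrm{rigcons}(Q_R^s)\cup\mathcal A_W\cup\mathcal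 A_{R_F^s}$. *The temporal database.* $\mathrm{TDB}(\mathfrak A)$ is the finite first-order structure with domain $\mathsf N_I(\mathfrak A)\cup\{-1,0,\dots,n\}$ (disjoint union), a constant for each $a\in\mathsf N_I(\Phi)$, and, for all basic concepts $B$ and roles $R$, relations that hold exactly for the $(a,p)$ with $B(a)\in\mathcal A_p$, the $(a,p)$ with $\neg B(a)\in\mathcal A_p$, the $(a,b,p)$ with $R(a,b)\in\mathcal A_p$, and the $(a,b,p)$ with $\neg R(a,b)\in\mathcal A_p$. Names $a_x$ and $a_{b\varrho}$ are not in its domain. **Claim.** (1) For all $\mathfrak A$ and $\iota$ there is an r-complete tuple w.r.t. $\mathcal W$ and $\iota$ iff there is a set $\mathcal B_\Phi$ as above such that the minimized tuple $(\mathcal A_R^s,Q_R^s,Q_R^{\neg s},R_F^s)$ is r-complete w.r.t. $\mathcal W$ and $\iota$. (2) For all $\mathcal B_\Phi$ as above and all $W\in\mathcal W$ there is a first-order formula $\mathrm{unsat}(i)$, and for every Boolean CQ $\varphi$ with $\mathsf N_I(\varphi)\subseteq\mathsf N_I(\Phi)$ there is a first-order formula $\mathrm{rew}_\varphi(i)$,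 both in the language of temporal databases and independent of $\mathfrak A$, such that for all $\mathfrak A=(\mathcal A_i)_{0\le i\le n}$ and all $i\in[-1,n]$: $\langle\mathcal O,\mathcal A^s_W\cup\mathcal A_i\rangle$ is inconsistent iff $\mathrm{TDB}(\mathfrak A)\models\mathrm{unsat}(i)$, and $\langle\mathcal O,\mathcal A^s_W\cup\mathcal A_i\rangle\models\varphi$ iff $\mathrm{TDB}(\mathfrak A)\models\mathrm{rew}_\varphi(i)$. -/

import Mathlib

/-! ## DL-Lite: roles, basic concepts, inclusions, assertions

`NI`, `NC`, `NR`, `NV` are the individual names, concept names, role names and variables. -/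

namespace TDL

/-- Roles `P` and `P⁻`. -/
inductive Role (NR : Type) : Type
  | name (P : NR)
  | inv (P : NR)

/-- The inverse `R⁻` of a role, with `(P⁻)⁻ = P`. -/
def Role.flip {NR : Type} : Role NR → Role NR
  | .name P => .inv P
  | .inv P => .name P

/-- The role name underlying a role. -/
def Role.base {NR : Type} : Role NR → NR
  | .name P => P
  | .inv P => P

/-- Basic concepts `A` and `∃R`. -/
inductive Basic (NC NR : Type) : Type
  | atom (A : NC)
  | ex (R : Role NR)

/-- The basic concept uses only concept names from `C` and role names from `P`. -/
def Basic.Over {NC NR : Type} (C : Set NC) (P : Set NR) : Basic NC NR → Prop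
  | .atom A => A ∈ C
  | .ex R => R.base ∈ P

/-- Concept inclusion `B₁ ⊓ ... ⊓ Bₘ ⊑ Bₘ₊₁ ⊔ ... ⊔ Bₘ₊ₙ`; the empty conjunction is `⊤`, the empty
disjunction is `⊥`. -/
structure CI (NC NR : Type) where
  lhs : List (Basic NC NR)
  rhs : List (Basic NC NR)

/-- Role inclusion `sub ⊑ sup`. -/
structure RI (NR : Type) where
  sub : Role NR
  sup : Role NR

structure Ontology (NC NR : Type) where
  cis : Finset (CI NC NR)
  ris : Finset (RI NR)

/-- DL-Lite^H_horn: at most one disjunct on the right-hand side; role inclusions are allowed. -/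
def Ontology.IsHorn {NC NR : Type} (O : Ontology NC NR) : Prop :=
  ∀ c ∈ O.cis, c.rhs.length ≤ 1

/-- Concept names occurring in the ontology. -/
def Ontology.concNames {NC NR : Type} (O : Ontology NC NR) : Set NC :=
  {A | ∃ c ∈ O.cis, Basic.atom A ∈ c.lhs ∨ Basic.atom A ∈ c.rhs}

/-- Role names occurring in the ontology. -/
def Ontology.roleNames {NC NR : Type} (O : Ontology NC NR) : Set NR :=
  {P | (∃ c ∈ O.cis, ∃ R : Role NR, R.base = P ∧ (Basic.ex R ∈ c.lhs ∨ Basic.ex R ∈ c.rhs)) ∨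
    ∃ r ∈ O.ris, r.sub.base = P ∨ r.sup.base = P}

/-- Assertions `B(a)`, `¬B(a)`, `R(a,b)`, `¬R(a,b)` over individual names from `N`. -/
inductive Assertion (N NC NR : Type) : Type
  | conc (B : Basic NC NR) (a : N)
  | nconc (B : Basic NC NR) (a : N)
  | role (R : Role NR) (a b : N)
  | nrole (R : Role NR) (a b : N)

/-- Individual names occurring in an assertion. -/
def Assertion.inds {N NC NR : Type} : Assertion N NC NR → Set N
  | .conc _ a => {a}
  | .nconc _ a => {a}
  | .role _ a b => {a, b}
  | .nrole _ a b => {a, b}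

/-- The assertion uses only concept names from `C` and role names from `P`. -/
def Assertion.Over {N NC NR : Type} (C : Set NC) (P : Set NR) : Assertion N NC NR → Prop
  | .conc B _ => B.Over C P
  | .nconc B _ => B.Over C P
  | .role R _ _ => R.base ∈ P
  | .nrole R _ _ => R.base ∈ P

/-- Positive assertions `B(a)`, `R(a,b)`. -/
def Assertion.IsPos {N NC NR : Type} : Assertion N NC NR → Prop
  | .conc _ _ => True
  | .role _ _ _ => True
  | .nconc _ _ => False
  | .nrole _ _ _ => False

/-- `α ↦ ¬α` (double negations are removed). -/
def Assertion.neg {N NC NR : Type} : Assertion N NC NR → Assertion N NC NR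
  | .conc B a => .nconc B a
  | .nconc B a => .conc B a
  | .role R a b => .nrole R a b
  | .nrole R a b => .role R a b

/-- Renaming of individuals. -/
def Assertion.map {N N' NC NR : Type} (f : N → N') : Assertion N NC NR → Assertion N' NC NR
  | .conc B a => .conc B (f a)
  | .nconc B a => .nconc B (f a)
  | .role R a b => .role R (f a) (f b)
  | .nrole R a b => .nrole R (f a) (f b)

/-! ## Semantics -/

/-- Interpretations: a non-empty domain; individual names are interpreted injectively (UNA). -/
structure Interp (N NC NR : Type) where
  Dom : Type
  nonempty : Nonempty Dom
  ind : N → Dom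
  una : Function.Injective ind
  conc : NC → Set Dom
  role : NR → Set (Dom × Dom)

namespace Interp

variable {N NC NR : Type} (I : Interp N NC NR)

/-- `R^I`. -/
def roleExt : Role NR → Set (I.Dom × I.Dom)
  | .name P => I.role P
  | .inv P => {p | (p.2, p.1) ∈ I.role P}

/-- `B^I`. -/
def basicExt : Basic NC NR → Set I.Dom
  | .atom A => I.conc A
  | .ex R => {x | ∃ y, (x, y) ∈ I.roleExt R}

def SatCI (c : CI NC NR) : Prop :=
  ∀ x : I.Dom, (∀ B ∈ c.lhs, x ∈ I.basicExt B) → ∃ B ∈ c.rhs, x ∈ I.basicExt B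

def SatRI (r : RI NR) : Prop := I.roleExt r.sub ⊆ I.roleExt r.sup

def SatA : Assertion N NC NR → Prop
  | .conc B a => I.ind a ∈ I.basicExt B
  | .nconc B a => I.ind a ∉ I.basicExt B
  | .role R a b => (I.ind a, I.ind b) ∈ I.roleExt R
  | .nrole R a b => (I.ind a, I.ind b) ∉ I.roleExt R

def ModelsOnt (O : Ontology NC NR) : Prop := (∀ c ∈ O.cis, I.SatCI c) ∧ ∀ r ∈ O.ris, I.SatRI r

/-- `I` is a model of the knowledge base `⟨O, A⟩`. -/
def ModelsKB (O : Ontology NC NR) (A : Set (Assertion N NC NR)) : Prop :=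
  I.ModelsOnt O ∧ ∀ α ∈ A, I.SatA α

end Interp

/-- `⟨O, A⟩` is consistent. -/
def Consistent {N NC NR : Type} (O : Ontology NC NR) (A : Set (Assertion N NC NR)) : Prop :=
  ∃ I : Interp N NC NR, I.ModelsKB O A

/-- `⟨O, A⟩ ⊨ α`. -/
def Entails {N NC NR : Type} (O : Ontology NC NR) (A : Set (Assertion N NC NR))
    (α : Assertion N NC NR) : Prop :=
  ∀ I : Interp N NC NR, I.ModelsKB O A → I.SatA α

/-! ## Conjunctive queries and temporal conjunctive queries -/

inductive Term (NI NV : Type) : Type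
  | ind (a : NI)
  | var (x : NV)

/-- Atoms of CQs. Basic concept atoms and inverse role atoms are allowed. -/
inductive Atom (NI NC NR NV : Type) : Type
  | conc (B : Basic NC NR) (t : Term NI NV)
  | role (R : Role NR) (s t : Term NI NV)

def Atom.terms {NI NC NR NV : Type} : Atom NI NC NR NV → Set (Term NI NV)
  | .conc _ t => {t}
  | .role _ s t => {s, t}

def Atom.Over {NI NC NR NV : Type} (C : Set NC) (P : Set NR) : Atom NI NC NR NV → Prop
  | .conc B _ => B.Over C P
  | .role R _ _ => R.base ∈ P

/-- A Boolean CQ (all variables are existentially quantified), given as the set of its atoms. -/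
abbrev CQ (NI NC NR NV : Type) : Type := Finset (Atom NI NC NR NV)

namespace CQ

variable {NI NC NR NV : Type} (q : CQ NI NC NR NV)

def terms : Set (Term NI NV) := {t | ∃ α ∈ q, t ∈ α.terms}
def inds : Set NI := {a | Term.ind a ∈ terms q}
def vars : Set NV := {x | Term.var x ∈ terms q}

end CQ

/-- Temporal conjunctive queries. -/
inductive TCQ (NI NC NR NV : Type) : Type
  | cq (q : CQ NI NC NR NV)
  | not (Φ : TCQ NI NC NR NV)
  | and (Φ Ψ : TCQ NI NC NR NV)
  | nextF (Φ : TCQ NI NC NR NV)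
  | nextP (Φ : TCQ NI NC NR NV)
  | until (Φ Ψ : TCQ NI NC NR NV)
  | since (Φ Ψ : TCQ NI NC NR NV)

namespace TCQ

variable {NI NC NR NV : Type}

/-- The CQs occurring in a TCQ. -/
def cqs : TCQ NI NC NR NV → Set (CQ NI NC NR NV)
  | .cq q => {q}
  | .not Φ => Φ.cqs
  | .and Φ Ψ => Φ.cqs ∪ Ψ.cqs
  | .nextF Φ => Φ.cqs
  | .nextP Φ => Φ.cqs
  | .until Φ Ψ => Φ.cqs ∪ Ψ.cqs
  | .since Φ Ψ => Φ.cqs ∪ Ψ.cqs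

def inds (Φ : TCQ NI NC NR NV) : Set NI := {a | ∃ q ∈ Φ.cqs, a ∈ CQ.inds q}
def vars (Φ : TCQ NI NC NR NV) : Set NV := {x | ∃ q ∈ Φ.cqs, x ∈ CQ.vars q}

end TCQ

/-! ## Auxiliary individual names -/

/-- Individual names of the extended knowledge bases: the original names, a name `a_x` for each
variable `x`, and names `a_{bR₁...Rₗ}` for paths that start in an original name or in some `a_x`. -/
inductive XName (NI NR NV : Type) : Type
  | ind (a : NI)
  | aux (x : NV)
  | tree (b : NI ⊕ NV) (ρ : List (Role NR))

/-- The individual name denoted by an element of `NI ⊕ NV`. -/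
def XName.root {NI NR NV : Type} : NI ⊕ NV → XName NI NR NV
  | .inl a => .ind a
  | .inr x => .aux x

/-- `a_{bρ}`, which is `b` itself for the empty path. -/
def XName.node {NI NR NV : Type} (b : NI ⊕ NV) : List (Role NR) → XName NI NR NV
  | [] => .root b
  | R :: ρ => .tree b (R :: ρ)

abbrev XInterp (NI NC NR NV : Type) : Type 1 := Interp (XName NI NR NV) NC NR

abbrev XAssertion (NI NC NR NV : Type) : Type := Assertion (XName NI NR NV) NC NR

section CQSemantics

variable {NI NC NR NV : Type}

def XInterp.termVal (I : XInterp NI NC NR NV) (π : NV → I.Dom) : Term NI NV → I.Dom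
  | .ind a => I.ind (.ind a)
  | .var x => π x

def XInterp.SatAtom (I : XInterp NI NC NR NV) (π : NV → I.Dom) : Atom NI NC NR NV → Prop
  | .conc B t => XInterp.termVal I π t ∈ I.basicExt B
  | .role R s t => (XInterp.termVal I π s, XInterp.termVal I π t) ∈ I.roleExt R

/-- There is a homomorphism of `q` into `I`. -/
def XInterp.SatCQ (I : XInterp NI NC NR NV) (q : CQ NI NC NR NV) : Prop :=
  ∃ π : NV → I.Dom, ∀ α ∈ q, XInterp.SatAtom I π α

/-- `⟨O, A⟩ ⊨ q`. -/
def EntailsCQ (O : Ontology NC NR) (A : Set (XAssertion NI NC NR NV)) (q : CQ NI NC NR NV) :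
    Prop :=
  ∀ I : XInterp NI NC NR NV, I.ModelsKB O A → XInterp.SatCQ I q

/-- Individuals `a` stay, variables `x` become `a_x`. -/
def Term.inst : Term NI NV → XName NI NR NV
  | .ind a => .ind a
  | .var x => .aux x

def Atom.inst : Atom NI NC NR NV → XAssertion NI NC NR NV
  | .conc B t => .conc B t.inst
  | .role R s t => .role R s.inst t.inst

/-- The instantiation `A_q` of a CQ. -/
def CQ.abox (q : CQ NI NC NR NV) : Set (XAssertion NI NC NR NV) := {α | ∃ β ∈ q, α = β.inst}

/-- `A_Q`, the union of the instantiations of the CQs in `Q`. -/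
def cqsABox (Q : Set (CQ NI NC NR NV)) : Set (XAssertion NI NC NR NV) :=
  {α | ∃ q ∈ Q, α ∈ CQ.abox q}

end CQSemantics

/-! ## The parameters that do not depend on the data -/

/-- An ontology, the rigid concept and role names, a TCQ `Φ`, a family of worlds `W₁, ..., W_k`
(a propositional variable `p_j` is identified with the CQ `φ_j` of `Φ` that it abstracts),
and a bound on the length of the paths in the names `a_{bρ}`. -/
structure Spec (NI NC NR NV : Type) where
  O : Ontology NC NR
  rigC : Set NC
  rigR : Set NR
  Φ : TCQ NI NC NR NV
  k : ℕ
  world : Fin k → Set (CQ NI NC NR NV)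
  depth : ℕ

/-- A non-empty finite sequence `A₀, ..., Aₙ` of ABoxes. -/
structure ABoxSeq (NI NC NR : Type) where
  n : ℕ
  abox : Fin (n + 1) → Finset (Assertion NI NC NR)

namespace ABoxSeq

variable {NI NC NR : Type} (D : ABoxSeq NI NC NR)

/-- The individual names occurring in the ABoxes. -/
def inds : Set NI := {a | ∃ i, ∃ α ∈ D.abox i, a ∈ α.inds}

/-- The ABoxes use only concept and role names that occur in the ontology. -/
def InSig (O : Ontology NC NR) : Prop :=
  ∀ i, ∀ α ∈ D.abox i, α.Over O.concNames O.roleNames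

/-- `Aᵢ` over the extended names. -/
def ext {NV : Type} (i : Fin (D.n + 1)) : Set (XAssertion NI NC NR NV) :=
  {α | ∃ β ∈ D.abox i, α = β.map .ind}

/-- `Aᵢ` for `i ∈ [-1, n]`, where `A₋₁ = ∅`. The time point `-1` is `⊥`. -/
def extBot {NV : Type} (i : WithBot (Fin (D.n + 1))) : Set (XAssertion NI NC NR NV) :=
  {α | ∃ p : Fin (D.n + 1), i = p ∧ α ∈ D.ext p}

end ABoxSeq

namespace Spec

variable {NI NC NR NV : Type} (P : Spec NI NC NR NV)

/-- The standing assumptions: `O` is a DL-Lite^H_horn ontology, different CQs of `Φ` have disjoint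
variables, `Φ` uses only names of `O`, and the worlds are sets of CQs of `Φ`. -/
structure WellFormed : Prop where
  horn : P.O.IsHorn
  disjointVars : ∀ q ∈ P.Φ.cqs, ∀ q' ∈ P.Φ.cqs, q ≠ q' → Disjoint (CQ.vars q) (CQ.vars q')
  sig : ∀ q ∈ P.Φ.cqs, ∀ α ∈ q, α.Over P.O.concNames P.O.roleNames
  worlds : ∀ j, P.world j ⊆ P.Φ.cqs

/-- Rigid roles of the ontology. -/
def rigRoles : Set (Role NR) := {R | R.base ∈ P.O.roleNames ∧ R.base ∈ P.rigR}

/-- Flexible roles of the ontology. -/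
def flexRoles : Set (Role NR) := {R | R.base ∈ P.O.roleNames ∧ R.base ∉ P.rigR}

/-- Rigid basic concepts of the ontology. -/
def rigBasics : Set (Basic NC NR) :=
  {B | B.Over (P.O.concNames ∩ P.rigC) (P.O.roleNames ∩ P.rigR)}

/-- Positive rigid assertions over the individuals in `X` and the symbols of the ontology. -/
def rigPos {N : Type} (X : Set N) : Set (Assertion N NC NR) :=
  {α | α.IsPos ∧ α.inds ⊆ X ∧ α.Over (P.O.concNames ∩ P.rigC) (P.O.roleNames ∩ P.rigR)}

/-- The rigid consequences of a set of CQs, computed for each CQ separately. -/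
def rigCons (Q : Set (CQ NI NC NR NV)) : Set (XAssertion NI NC NR NV) :=
  {α | ∃ q ∈ Q, α ∈ P.rigPos {e | ∃ t ∈ CQ.terms q, e = t.inst} ∧ Entails P.O (CQ.abox q) α}

/-- `O ⊨ R ⊑ S`. -/
def SubRole (R S : Role NR) : Prop :=
  ∀ I : XInterp NI NC NR NV, I.ModelsOnt P.O → I.roleExt R ⊆ I.roleExt S

/-- `O ⊨ B ⊑ C`. -/
def SubBasic (B C : Basic NC NR) : Prop :=
  ∀ I : XInterp NI NC NR NV, I.ModelsOnt P.O → I.basicExt B ⊆ I.basicExt C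

/-- Paths `S R₂ ... Rₗ` with `l ≤ depth` and `O ⊨ ∃Rᵢ⁻ ⊑ ∃Rᵢ₊₁`. -/
def paths (S : Role NR) : Set (List (Role NR)) :=
  {ρ | ρ.head? = some S ∧ ρ.length ≤ P.depth ∧ (∀ R ∈ ρ, R.base ∈ P.O.roleNames) ∧
    ρ.IsChain (fun R R' => P.SubBasic (.ex R.flip) (.ex R'))}

/-- The tree ABox `A_{∃S(b)}`: the rigid assertions about the successors of `b`, down to the given
depth, that are generated by `∃S(b)`. -/
def treeABox (S : Role NR) (b : NI ⊕ NV) : Set (XAssertion NI NC NR NV) :=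
  {α | ∃ (ρ : List (Role NR)) (R : Role NR), ρ ++ [R] ∈ P.paths S ∧
    ((∃ B ∈ P.rigBasics, P.SubBasic (.ex R.flip) B ∧ α = .conc B (.node b (ρ ++ [R]))) ∨
     (∃ R' ∈ P.rigRoles, P.SubRole R R' ∧ α = .role R' (.node b ρ) (.node b (ρ ++ [R]))))}

/-- `A_{R_F}`; the assertion `∃S(b)` is represented by the pair `(S, b)`. -/
def flexABox (F : Set (Role NR × (NI ⊕ NV))) : Set (XAssertion NI NC NR NV) :=
  {α | ∃ f ∈ F, α ∈ P.treeABox f.1 f.2}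

/-- `ψ` is a rigid witness query of `q`: it is over the terms of `q` and the rigid names of the
ontology, and together with the ontology it implies `q`. -/
def IsRigidWitness (ψ q : CQ NI NC NR NV) : Prop :=
  CQ.terms ψ ⊆ CQ.terms q ∧
  (∀ α ∈ ψ, α.Over (P.O.concNames ∩ P.rigC) (P.O.roleNames ∩ P.rigR)) ∧
  ∀ I : XInterp NI NC NR NV, I.ModelsOnt P.O → XInterp.SatCQ I ψ → XInterp.SatCQ I q

end Spec

/-- A tuple `(A_R, Q_R, Q_R^¬, R_F)`. -/
structure RTuple (NI NC NR NV : Type) where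
  rigid : Set (XAssertion NI NC NR NV)
  pos : Set (CQ NI NC NR NV)
  neg : Set (CQ NI NC NR NV)
  flex : Set (Role NR × (NI ⊕ NV))

namespace Spec

variable {NI NC NR NV : Type} (P : Spec NI NC NR NV) (D : ABoxSeq NI NC NR)

/-- The individual names of the knowledge base, as extended names. -/
def kbInds : Set (XName NI NR NV) := XName.ind '' D.inds

/-- A rigid ABox type: a set of rigid assertions over the names of the knowledge base that contains
exactly one of `α`, `¬α` for each positive one. -/
def IsRigidType (A : Set (XAssertion NI NC NR NV)) : Prop :=
  (∀ α ∈ A, α ∈ P.rigPos (kbInds D) ∨ α.neg ∈ P.rigPos (kbInds D)) ∧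
  ∀ α ∈ P.rigPos (kbInds (NV := NV) D), α.neg ∈ A ↔ α ∉ A

/-- Original names of the knowledge base and names `a_x` for the variables `x` of `Φ`. -/
def flexInds : Set (NI ⊕ NV) := Sum.inl '' D.inds ∪ Sum.inr '' P.Φ.vars

/-- The time points `0, ..., n` followed by `n+1, ..., n+k`. -/
abbrev Time : Type := Fin (D.n + 1) ⊕ Fin P.k

/-- `W_{ι(i)}`, where `ι(n+j) = j`. -/
def worldAt (ι : Fin (D.n + 1) → Fin P.k) : P.Time D → Set (CQ NI NC NR NV)
  | .inl i => P.world (ι i)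
  | .inr j => P.world j

/-- `Aᵢ`, where `A_{n+j} = ∅`. -/
def aboxAt : P.Time D → Set (XAssertion NI NC NR NV)
  | .inl i => D.ext i
  | .inr _ => ∅

/-- `A_R ∪ rigcons(Q_R) ∪ A_W`. -/
def coreABox (T : RTuple NI NC NR NV) (W : Set (CQ NI NC NR NV)) : Set (XAssertion NI NC NR NV) :=
  T.rigid ∪ P.rigCons T.pos ∪ cqsABox W

/-- `A_R ∪ rigcons(Q_R) ∪ A_W ∪ A_{R_F}`. -/
def fullABox (T : RTuple NI NC NR NV) (W : Set (CQ NI NC NR NV)) : Set (XAssertion NI NC NR NV) :=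
  P.coreABox T W ∪ P.flexABox T.flex

/-- The tuple is r-complete w.r.t. the worlds and the mapping `ι`. -/
structure RComplete (ι : Fin (D.n + 1) → Fin P.k) (T : RTuple NI NC NR NV) : Prop where
  rigidType : P.IsRigidType D T.rigid
  pos_sub : T.pos ⊆ P.Φ.cqs
  neg_sub : T.neg ⊆ P.Φ.cqs
  flex_sub : T.flex ⊆ P.flexRoles ×ˢ P.flexInds D
  consistent : ∀ t : P.Time D, Consistent P.O (P.fullABox T (P.worldAt D ι t) ∪ P.aboxAt D t)
  negCQs : ∀ t : P.Time D, ∀ q ∈ P.Φ.cqs, q ∉ P.worldAt D ι t →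
    ¬ EntailsCQ P.O (P.fullABox T (P.worldAt D ι t) ∪ P.aboxAt D t) q
  posComplete : ∀ t : P.Time D, P.worldAt D ι t ⊆ T.pos
  negComplete : ∀ t : P.Time D, ∀ q ∈ P.Φ.cqs, q ∉ P.worldAt D ι t → q ∈ T.neg
  witnesses : ∀ t : P.Time D, ∀ q ∈ T.neg, ∀ ψ, P.IsRigidWitness ψ q →
    ¬ EntailsCQ P.O (P.fullABox T (P.worldAt D ι t) ∪ P.aboxAt D t) ψ
  flexComplete : ∀ S ∈ P.flexRoles, ∀ b ∈ P.flexInds D, (S, b) ∈ T.flex ↔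
    ∃ t : P.Time D,
      Entails P.O (P.coreABox T (P.worldAt D ι t) ∪ P.aboxAt D t) (.conc (.ex S) (.root b))

/-! ## The minimized tuple -/

/-- The assertions `B(a)` with `B` a basic concept of the ontology and `a` an individual of `Φ`,
from which the parameter `B_Φ` is chosen. -/
def guessSpace : Set (Assertion NI NC NR) :=
  {α | ∃ B : Basic NC NR, B.Over P.O.concNames P.O.roleNames ∧ ∃ a ∈ P.Φ.inds, α = .conc B a}

/-- The CQs that are satisfied in some world. -/
def minPos : Set (CQ NI NC NR NV) := {q ∈ P.Φ.cqs | ∃ j, q ∈ P.world j}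

/-- The CQs that are not satisfied in some world. -/
def minNeg : Set (CQ NI NC NR NV) := {q ∈ P.Φ.cqs | ∃ j, q ∉ P.world j}

/-- Start with the rigid assertions over the names of the knowledge base in
`B_Φ ∪ rigcons(Q_R)` and repeatedly add the rigid assertions that follow
together with some `A_p`, `p ∈ [0, n]`. -/
def rigidStage (BΦ : Set (Assertion NI NC NR)) : ℕ → Set (XAssertion NI NC NR NV)
  | 0 => P.rigPos (kbInds D) ∩ (Assertion.map .ind '' BΦ ∪ P.rigCons P.minPos)
  | j + 1 => {α ∈ P.rigPos (kbInds D) | ∃ p, Entails P.O (rigidStage BΦ j ∪ D.ext p) α}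

/-- The rigid ABox type whose positive part is the limit of the stages. -/
def minRigid (BΦ : Set (Assertion NI NC NR)) : Set (XAssertion NI NC NR NV) :=
  {α ∈ P.rigPos (kbInds D) | ∃ j, α ∈ P.rigidStage D BΦ j} ∪
  Assertion.neg '' {α ∈ P.rigPos (kbInds D) | ∀ j, α ∉ P.rigidStage D BΦ j}

/-- Flexible successors of the names `a_x`. -/
def minFlexAux : Set (Role NR × (NI ⊕ NV)) :=
  {f | f.1 ∈ P.flexRoles ∧ ∃ x ∈ P.Φ.vars, f.2 = .inr x ∧
    ∃ j, Entails P.O (cqsABox (P.world j)) (.conc (.ex f.1) (.aux x))}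

/-- Flexible successors of the individuals of `Φ`. -/
def minFlexQuery (BΦ : Set (Assertion NI NC NR)) : Set (Role NR × (NI ⊕ NV)) :=
  {f | f.1 ∈ P.flexRoles ∧ ∃ a ∈ P.Φ.inds, f.2 = .inl a ∧ Assertion.conc (.ex f.1) a ∈ BΦ}

/-- Flexible successors of the other individuals of the knowledge base. -/
def minFlexOther (BΦ : Set (Assertion NI NC NR)) : Set (Role NR × (NI ⊕ NV)) :=
  {f | f.1 ∈ P.flexRoles ∧ ∃ b ∈ D.inds \ P.Φ.inds, f.2 = .inl b ∧
    ∃ i, Entails P.O (P.minRigid D BΦ ∪ D.ext i) (.conc (.ex f.1) (.ind b))}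

/-- The minimized tuple determined by `B_Φ`. -/
def minTuple (BΦ : Set (Assertion NI NC NR)) : RTuple NI NC NR NV where
  rigid := P.minRigid D BΦ
  pos := P.minPos
  neg := P.minNeg
  flex := P.minFlexAux ∪ P.minFlexQuery BΦ ∪ P.minFlexOther D BΦ

end Spec

/-! ## The temporal database -/

/-- Relation symbols: for each basic concept `B` and each role `R`, the symbols for
`B(x, i)`, `¬B(x, i)`, `R(x, y, i)` and `¬R(x, y, i)`, where `i` is a time point. -/
inductive TDBRel (NC NR : Type) : ℕ → Type
  | conc (B : Basic NC NR) : TDBRel NC NR 2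
  | nconc (B : Basic NC NR) : TDBRel NC NR 2
  | role (R : Role NR) : TDBRel NC NR 3
  | nrole (R : Role NR) : TDBRel NC NR 3

/-- The only function symbols are constants for the individuals in `C`. -/
def TDBFun {NI : Type} (C : Set NI) : ℕ → Type
  | 0 => C
  | _ + 1 => Empty

/-- The first-order language of temporal databases with constants `C`. -/
@[reducible] def tdbLang {NI : Type} (NC NR : Type) (C : Set NI) : FirstOrder.Language where
  Functions := TDBFun C
  Relations := TDBRel NC NR

/-- The domain: the individuals occurring in the ABoxes and the time points `-1, 0, ..., n`. -/
abbrev TDBDom {NI NC NR : Type} (D : ABoxSeq NI NC NR) : Type :=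
  D.inds ⊕ WithBot (Fin (D.n + 1))

/-- Some ABox `A_p` contains the assertion built from the elements `x`, where `p` is the time
point given by `t`. -/
def TDBDom.Holds {NI NC NR : Type} {D : ABoxSeq NI NC NR} (t : TDBDom D)
    (φ : Finset (Assertion NI NC NR) → Prop) : Prop :=
  ∃ p : Fin (D.n + 1), t = .inr (p : WithBot (Fin (D.n + 1))) ∧ φ (D.abox p)

/-- The temporal database of a sequence of ABoxes. -/
@[reducible] def tdb {NI NC NR : Type} (D : ABoxSeq NI NC NR) {C : Set NI} (h : C ⊆ D.inds) :
    (tdbLang NC NR C).Structure (TDBDom D) where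
  funMap := fun {m} (f : TDBFun C m) _ =>
    match m, f with
    | 0, c => .inl ⟨_, h c.2⟩
    | _ + 1, e => e.elim
  RelMap := fun {m} (r : TDBRel NC NR m) =>
    match m, r with
    | _, .conc B => fun v => (v 1).Holds fun A =>
        ∃ a : D.inds, v 0 = .inl a ∧ Assertion.conc B a.1 ∈ A
    | _, .nconc B => fun v => (v 1).Holds fun A =>
        ∃ a : D.inds, v 0 = .inl a ∧ Assertion.nconc B a.1 ∈ A
    | _, .role R => fun v => (v 2).Holds fun A =>
        ∃ a b : D.inds, v 0 = .inl a ∧ v 1 = .inl b ∧ Assertion.role R a.1 b.1 ∈ A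
    | _, .nrole R => fun v => (v 2).Holds fun A =>
        ∃ a b : D.inds, v 0 = .inl a ∧ v 1 = .inl b ∧ Assertion.nrole R a.1 b.1 ∈ A

/-- The temporal database satisfies `φ(i)`, where `φ` has one free variable and `i ∈ [-1, n]`. -/
def TDBSat {NI NC NR : Type} (D : ABoxSeq NI NC NR) {C : Set NI} (h : C ⊆ D.inds)
    (φ : (tdbLang NC NR C).Formula Unit) (i : WithBot (Fin (D.n + 1))) : Prop :=
  letI := tdb D h
  φ.Realize (fun _ : Unit => (Sum.inr i : TDBDom D))

end TDL

/-! A Horn knowledge base has a canonical model `Can` of a very local shape. The type of an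
individual is the closure `Der` of the basic concepts stated about it; every derived `∃R` creates a
successor whose type depends on `R` alone; roles between individuals are the stated ones up to role
inclusions. Hence consistency (`consistent_iff`) and entailment of assertions become conditions on
single individuals and pairs. Since `Can` maps homomorphically into every model of the positive
assertions, a CQ that holds in `Can` survives in every knowledge base with at least the same
positive assertions.

(1) Let `T` be r-complete, and let `guess` consist of the basic assertions about individuals of `Φ`
that some core knowledge base of `T` entails. By induction on the stages, the positive part of the
minimized type lies in `T.rigid`; likewise its flexible successors lie in `T.flex`. So at each time
point the minimized knowledge base has no positive assertions beyond those of `T`, and CQs not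
entailed for `T` are not entailed for the minimized tuple, provided that the latter is consistent.
The danger is a negative assertion `¬α` present because no stage reached `α`. Suppose `α` were
derivable. If `α` is a concept assertion about an individual of `Φ`, then `α` is in the guess. At
any other individual only the minimized type, one `A_p` and a tree ABox say anything, and what the
tree ABox says is already derivable; so a later stage contains `α`. Rigid role assertions between
original names come from the type, from some `A_p`, or from CQs, whose rigid consequences are in
stage zero. The same locality gives completeness of the flexible successors; for a name `a_x` one
world suffices, since `x` occurs in only one CQ. The converse of (1) is immediate.

(2) Definability is obtained semantically: a property determined by the truth values of finitely
many definable properties is definable (`Defin.determined`). For a finite tuple of individuals and a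
time point, finitely many definable facts (`Fam.Agree`) fix the part of the canonical model above
the tuple, up to renaming of roots (`Fam.Corr`). Quantifying over individuals then gives formulas
for consistency, for entailed assertions and, by guessing which terms are matched above data
individuals, for CQs (`Fam.fo_entailsCQ`). Each stage of the rigid type is thus definable from the
previous one. The number of stages needed is bounded independently of the data
(`Spec.exists_rigidStage_bound`): role assertions are complete after one step, and concept
assertions grow separately at each individual within a finite set of rigid concepts. So the
minimized type, its flexible successors and finally the whole knowledge base form a definable
family. -/

namespace TDL

/-! ## Canonical models of Horn knowledge bases -/

section Canonical

variable {N NC NR : Type}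

@[simp] theorem Role.flip_flip (R : Role NR) : R.flip.flip = R := by cases R <;> rfl

theorem Interp.mem_roleExt_flip (I : Interp N NC NR) (R : Role NR) (x y : I.Dom) :
    (x, y) ∈ I.roleExt R.flip ↔ (y, x) ∈ I.roleExt R := by
  cases R <;> rfl

/-- Role inclusions derivable from the ontology. -/
inductive SubR (O : Ontology NC NR) : Role NR → Role NR → Prop
  | refl (R) : SubR O R R
  | ri {r} : r ∈ O.ris → SubR O r.sub r.sup
  | riFlip {r} : r ∈ O.ris → SubR O r.sub.flip r.sup.flip
  | trans {R S T} : SubR O R S → SubR O S T → SubR O R T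

theorem SubR.flip {O : Ontology NC NR} {R S : Role NR} (h : SubR O R S) :
    SubR O R.flip S.flip := by
  induction h with
  | refl R => exact .refl _
  | ri h => exact .riFlip h
  | riFlip h => simpa using SubR.ri h
  | trans _ _ h₁ h₂ => exact h₁.trans h₂

theorem SubR.sound {O : Ontology NC NR} {R S : Role NR} (h : SubR O R S)
    {I : Interp N NC NR} (hI : I.ModelsOnt O) {x y : I.Dom} (hxy : (x, y) ∈ I.roleExt R) :
    (x, y) ∈ I.roleExt S := by
  induction h generalizing x y with
  | refl R => exact hxy
  | ri h => exact hI.2 _ h hxy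
  | riFlip h =>
    rw [I.mem_roleExt_flip] at hxy ⊢
    exact hI.2 _ h hxy
  | trans _ _ h₁ h₂ => exact h₂ (h₁ hxy)

/-- Basic concepts derivable from a set of basic concepts. -/
inductive Der (O : Ontology NC NR) (X : Set (Basic NC NR)) : Basic NC NR → Prop
  | base {B} : B ∈ X → Der O X B
  | ci {c B} : c ∈ O.cis → B ∈ c.rhs → (∀ B' ∈ c.lhs, Der O X B') → Der O X B
  | sup {R S} : Der O X (.ex R) → SubR O R S → Der O X (.ex S)

theorem Der.trans {O : Ontology NC NR} {X Y : Set (Basic NC NR)} (h : ∀ B ∈ X, Der O Y B)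
    {B : Basic NC NR} (hB : Der O X B) : Der O Y B := by
  induction hB with
  | base hB => exact h _ hB
  | ci hc hr _ ih => exact .ci hc hr ih
  | sup _ hs ih => exact .sup ih hs

theorem Der.mono {O : Ontology NC NR} {X Y : Set (Basic NC NR)} (h : X ⊆ Y)
    {B : Basic NC NR} (hB : Der O X B) : Der O Y B :=
  hB.trans fun _ hB => .base (h hB)

/-- A derivation from the union of an increasing sequence uses only one member. -/
theorem Der.of_iUnion {O : Ontology NC NR} {X : ℕ → Set (Basic NC NR)} (hX : Monotone X)
    {B : Basic NC NR} (hB : Der O (⋃ j, X j) B) : ∃ j, Der O (X j) B := by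
  induction hB with
  | base hB =>
    obtain ⟨j, hj⟩ := Set.mem_iUnion.1 hB
    exact ⟨j, .base hj⟩
  | @ci c B hc hr _ ih =>
    have : ∀ l : List (Basic NC NR), (∀ B' ∈ l, ∃ j, Der O (X j) B') →
        ∃ j, ∀ B' ∈ l, Der O (X j) B' := by
      intro l
      induction l with
      | nil => exact fun _ => ⟨0, by simp⟩
      | cons B l ihl =>
        intro h
        obtain ⟨j, hj⟩ := h B (by simp)
        obtain ⟨j', hj'⟩ := ihl fun B' hB' => h B' (by simp [hB'])
        refine ⟨max j j', fun B' hB' => ?_⟩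
        rcases List.mem_cons.1 hB' with rfl | hB'
        · exact hj.mono (hX (le_max_left _ _))
        · exact (hj' _ hB').mono (hX (le_max_right _ _))
    obtain ⟨j, hj⟩ := this _ ih
    exact ⟨j, .ci hc hr hj⟩
  | sup _ hs ih =>
    obtain ⟨j, hj⟩ := ih
    exact ⟨j, .sup hj hs⟩

/-- This is where the Horn condition enters: with at most one disjunct on the right, the disjunct
that the model satisfies is the derived one. -/
theorem Der.sound {O : Ontology NC NR} (hO : O.IsHorn) {X : Set (Basic NC NR)}
    {B : Basic NC NR} (h : Der O X B) {I : Interp N NC NR} (hI : I.ModelsOnt O) {x : I.Dom}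
    (hx : ∀ B ∈ X, x ∈ I.basicExt B) : x ∈ I.basicExt B := by
  induction h with
  | base hB => exact hx _ hB
  | @ci c B hc hr _ ih =>
    obtain ⟨B', hB', hx'⟩ := hI.1 c hc x ih
    have hl := hO c hc
    match hrhs : c.rhs with
    | [] => simp [hrhs] at hr
    | [C] =>
      simp only [hrhs, List.mem_singleton] at hr hB'
      rwa [hr, ← hB']
    | _ :: _ :: _ => simp [hrhs] at hl
  | sup _ hs ih =>
    obtain ⟨y, hy⟩ := ih
    exact ⟨y, hs.sound hI hy⟩

/-- The basic concepts stated for an individual by an ABox, directly or by a role assertion. -/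
def asserted (A : Set (Assertion N NC NR)) (a : N) : Set (Basic NC NR) :=
  {B | .conc B a ∈ A ∨ ∃ R b, B = .ex R ∧ (.role R a b ∈ A ∨ .role R.flip b a ∈ A)}

theorem asserted_mono {A A' : Set (Assertion N NC NR)} {a : N}
    (h : ∀ α ∈ A, α.IsPos → α ∈ A') : asserted A a ⊆ asserted A' a := by
  rintro B (hB | ⟨R, b, rfl, hR | hR⟩)
  · exact .inl (h _ hB trivial)
  · exact .inr ⟨R, b, rfl, .inl (h _ hR trivial)⟩
  · exact .inr ⟨R, b, rfl, .inr (h _ hR trivial)⟩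

theorem asserted_union (A A' : Set (Assertion N NC NR)) (a : N) :
    asserted (A ∪ A') a = asserted A a ∪ asserted A' a := by
  refine Set.Subset.antisymm ?_ (Set.union_subset (asserted_mono fun _ h _ => .inl h)
    (asserted_mono fun _ h _ => .inr h))
  rintro B ((hB | hB) | ⟨R, b, rfl, (hR | hR) | (hR | hR)⟩)
  · exact .inl (.inl hB)
  · exact .inr (.inl hB)
  · exact .inl (.inr ⟨R, b, rfl, .inl hR⟩)
  · exact .inr (.inr ⟨R, b, rfl, .inl hR⟩)
  · exact .inl (.inr ⟨R, b, rfl, .inr hR⟩)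
  · exact .inr (.inr ⟨R, b, rfl, .inr hR⟩)

/-- `R(a,b)` follows from an assertion by role inclusions. -/
def RoleDer (O : Ontology NC NR) (A : Set (Assertion N NC NR)) (R : Role NR) (a b : N) : Prop :=
  ∃ S, SubR O S R ∧ (.role S a b ∈ A ∨ .role S.flip b a ∈ A)

theorem RoleDer.mono {O : Ontology NC NR} {A A' : Set (Assertion N NC NR)} {R : Role NR} {a b : N}
    (h : ∀ α ∈ A, α.IsPos → α ∈ A') (hR : RoleDer O A R a b) : RoleDer O A' R a b := by
  obtain ⟨S, hS, hR | hR⟩ := hR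
  · exact ⟨S, hS, .inl (h _ hR trivial)⟩
  · exact ⟨S, hS, .inr (h _ hR trivial)⟩

theorem RoleDer.swap {O : Ontology NC NR} {A : Set (Assertion N NC NR)} {R : Role NR} {a b : N}
    (hR : RoleDer O A R a b) : RoleDer O A R.flip b a := by
  obtain ⟨S, hS, hR⟩ := hR
  exact ⟨S.flip, hS.flip, by simpa using hR.symm⟩

/-- `I` satisfies the positive assertions of `A`. -/
def Interp.SatPos (I : Interp N NC NR) (A : Set (Assertion N NC NR)) : Prop :=
  ∀ α ∈ A, α.IsPos → I.SatA α

theorem Interp.SatPos.asserted {I : Interp N NC NR} {A : Set (Assertion N NC NR)}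
    (h : I.SatPos A) {a : N} {B : Basic NC NR} (hB : B ∈ asserted A a) :
    I.ind a ∈ I.basicExt B := by
  rcases hB with hB | ⟨R, b, rfl, hR | hR⟩
  · exact h _ hB trivial
  · exact ⟨_, h _ hR trivial⟩
  · exact ⟨_, (I.mem_roleExt_flip _ _ _).1 (h _ hR trivial)⟩

theorem Interp.SatPos.roleDer {O : Ontology NC NR} {I : Interp N NC NR}
    {A : Set (Assertion N NC NR)} (h : I.SatPos A) (hI : I.ModelsOnt O) {R : Role NR} {a b : N}
    (hR : RoleDer O A R a b) : (I.ind a, I.ind b) ∈ I.roleExt R := by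
  obtain ⟨S, hS, hR | hR⟩ := hR
  · exact hS.sound hI (h _ hR trivial)
  · exact hS.sound hI ((I.mem_roleExt_flip _ _ _).1 (h _ hR trivial))

/-- Some model of the ontology has an element that belongs to all basic concepts in `X`. -/
def TypeSat (N : Type) (O : Ontology NC NR) (X : Set (Basic NC NR)) : Prop :=
  ∃ I : Interp N NC NR, I.ModelsOnt O ∧ ∃ x : I.Dom, ∀ B ∈ X, x ∈ I.basicExt B

theorem TypeSat.mono {O : Ontology NC NR} {X Y : Set (Basic NC NR)} (h : TypeSat N O Y)
    (hXY : X ⊆ Y) : TypeSat N O X := by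
  obtain ⟨I, hI, x, hx⟩ := h
  exact ⟨I, hI, x, fun B hB => hx B (hXY hB)⟩

/-- The generators of the type of a node of the canonical model. -/
def seed (A : Set (Assertion N NC NR)) (o : Option N) : List (Role NR) → Set (Basic NC NR)
  | [] => o.elim ∅ (asserted A)
  | R :: _ => {.ex R.flip}

/-- The nodes of the canonical model: every derived `∃R` creates an `R`-successor. -/
def IsNode (O : Ontology NC NR) (A : Set (Assertion N NC NR)) (o : Option N) :
    List (Role NR) → Prop
  | [] => True
  | R :: w => IsNode O A o w ∧ Der O (seed A o w) (.ex R)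

/-- The roles of the canonical model. -/
def CanRole (O : Ontology NC NR) (A : Set (Assertion N NC NR)) (R : Role NR)
    (x y : Option N × List (Role NR)) : Prop :=
  (∃ a b, x = (some a, []) ∧ y = (some b, []) ∧ RoleDer O A R a b) ∨
  (∃ S, y = (x.1, S :: x.2) ∧ SubR O S R) ∨ ∃ S, x = (y.1, S :: y.2) ∧ SubR O S R.flip

theorem CanRole.swap {O : Ontology NC NR} {A : Set (Assertion N NC NR)} {R : Role NR}
    {x y : Option N × List (Role NR)} (h : CanRole O A R x y) : CanRole O A R.flip y x := by
  rcases h with ⟨a, b, rfl, rfl, h⟩ | ⟨S, h, hS⟩ | ⟨S, h, hS⟩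
  · exact .inl ⟨b, a, rfl, rfl, h.swap⟩
  · exact .inr (.inr ⟨S, h, by simpa using hS⟩)
  · exact .inr (.inl ⟨S, h, hS⟩)

/-- The canonical model. The root `none` belongs to no assertion. -/
abbrev Can (O : Ontology NC NR) (A : Set (Assertion N NC NR)) : Interp N NC NR where
  Dom := {e : Option N × List (Role NR) // IsNode O A e.1 e.2}
  nonempty := ⟨⟨(none, []), trivial⟩⟩
  ind a := ⟨(some a, []), trivial⟩
  una _ _ h := Option.some.inj (congrArg (fun e => e.1.1) h)
  conc C := {e | Der O (seed A e.1.1 e.1.2) (.atom C)}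
  role P := {p | CanRole O A (.name P) p.1.1 p.2.1}

theorem Can.mem_roleExt {O : Ontology NC NR} {A : Set (Assertion N NC NR)} {R : Role NR}
    {x y : (Can O A).Dom} : (x, y) ∈ (Can O A).roleExt R ↔ CanRole O A R x.1 y.1 := by
  cases R with
  | name P => rfl
  | inv P => exact ⟨fun h => CanRole.swap (R := .name P) h, fun h => CanRole.swap (R := .inv P) h⟩

/-- No edge of the canonical model creates an underivable `∃R`: a stated edge puts an `∃S` into the
seed, an edge to a child exists only because `∃S` was derived, and a child has `∃S⁻` as its seed. -/
theorem CanRole.der {O : Ontology NC NR} {A : Set (Assertion N NC NR)} {R : Role NR}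
    {x y : Option N × List (Role NR)} (h : CanRole O A R x y) (hy : IsNode O A y.1 y.2) :
    Der O (seed A x.1 x.2) (.ex R) := by
  rcases h with ⟨a, b, rfl, rfl, S, hS, h⟩ | ⟨S, rfl, hS⟩ | ⟨S, rfl, hS⟩
  · exact .sup (.base (.inr ⟨S, b, rfl, h⟩)) hS
  · exact .sup hy.2 hS
  · exact .sup (.base (Set.mem_singleton _)) (by simpa using hS.flip)

theorem Can.mem_basicExt {O : Ontology NC NR} {A : Set (Assertion N NC NR)} {B : Basic NC NR}
    {x : (Can O A).Dom} : x ∈ (Can O A).basicExt B ↔ Der O (seed A x.1.1 x.1.2) B := by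
  cases B with
  | atom C => rfl
  | ex R =>
    constructor
    · rintro ⟨y, hy⟩
      exact (Can.mem_roleExt.1 hy).der y.2
    · intro h
      exact ⟨⟨(x.1.1, R :: x.1.2), x.2, h⟩, Can.mem_roleExt.2 (.inr (.inl ⟨R, rfl, .refl _⟩))⟩

/-- Walk down the path: an element realizing the parent's seed satisfies the derived `∃R` by
soundness, and its `R`-successor in the same model realizes the child's seed `∃R⁻`. So it suffices
to test the roots. -/
theorem IsNode.typeSat {O : Ontology NC NR} (hO : O.IsHorn) {A : Set (Assertion N NC NR)}
    (h₀ : TypeSat N O ∅) (h : ∀ a, TypeSat N O (asserted A a)) {o : Option N}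
    {w : List (Role NR)} (hw : IsNode O A o w) : TypeSat N O (seed A o w) := by
  induction w with
  | nil => cases o with
    | none => exact h₀
    | some a => exact h a
  | cons R w ih =>
    obtain ⟨I, hI, x, hx⟩ := ih hw.1
    obtain ⟨y, hy⟩ := hw.2.sound hO hI hx
    refine ⟨I, hI, y, ?_⟩
    rintro B rfl
    exact ⟨x, (I.mem_roleExt_flip _ _ _).2 hy⟩

theorem Can.modelsOnt {O : Ontology NC NR} (hO : O.IsHorn) {A : Set (Assertion N NC NR)}
    (h₀ : TypeSat N O ∅) (h : ∀ a, TypeSat N O (asserted A a)) : (Can O A).ModelsOnt O := by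
  constructor
  · intro c hc x hx
    obtain ⟨I, hI, y, hy⟩ := IsNode.typeSat hO h₀ h x.2
    -- `Der` ignores inclusions into `⊥`. Here the realizing element `y` shows that the right-hand
    -- side of a triggered inclusion is not empty.
    obtain ⟨B, hB, -⟩ := hI.1 c hc y fun B hB => (Can.mem_basicExt.1 (hx B hB)).sound hO hI hy
    exact ⟨B, hB, Can.mem_basicExt.2 (.ci hc hB fun B' hB' => Can.mem_basicExt.1 (hx B' hB'))⟩
  · rintro r hr ⟨x, y⟩ hxy
    refine Can.mem_roleExt.2 ?_
    rcases Can.mem_roleExt.1 hxy with ⟨a, b, hx, hy, S, hS, h⟩ | ⟨S, h, hS⟩ | ⟨S, h, hS⟩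
    · exact .inl ⟨a, b, hx, hy, S, hS.trans (.ri hr), h⟩
    · exact .inr (.inl ⟨S, h, hS.trans (.ri hr)⟩)
    · exact .inr (.inr ⟨S, h, hS.trans (.riFlip hr)⟩)

theorem Can.ind_mem_basicExt {O : Ontology NC NR} {A : Set (Assertion N NC NR)} {B : Basic NC NR}
    {a : N} : (Can O A).ind a ∈ (Can O A).basicExt B ↔ Der O (asserted A a) B :=
  Can.mem_basicExt

theorem Can.ind_mem_roleExt {O : Ontology NC NR} {A : Set (Assertion N NC NR)} {R : Role NR}
    {a b : N} : ((Can O A).ind a, (Can O A).ind b) ∈ (Can O A).roleExt R ↔ RoleDer O A R a b := by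
  refine Can.mem_roleExt.trans ⟨?_, fun h => .inl ⟨a, b, rfl, rfl, h⟩⟩
  rintro (⟨a', b', ha, hb, h⟩ | ⟨S, h, -⟩ | ⟨S, h, -⟩)
  · cases ha; cases hb; exact h
  · simp at h
  · simp at h

/-- No negative assertion contradicts a derivable one. -/
def ClashFree (O : Ontology NC NR) (A : Set (Assertion N NC NR)) : Prop :=
  (∀ B a, .nconc B a ∈ A → ¬ Der O (asserted A a) B) ∧
  ∀ R a b, .nrole R a b ∈ A → ¬ RoleDer O A R a b

theorem Can.modelsKB {O : Ontology NC NR} (hO : O.IsHorn) {A : Set (Assertion N NC NR)}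
    (h₀ : TypeSat N O ∅) (h : ∀ a, TypeSat N O (asserted A a)) (hc : ClashFree O A) :
    (Can O A).ModelsKB O A := by
  refine ⟨Can.modelsOnt hO h₀ h, ?_⟩
  rintro (⟨B, a⟩ | ⟨B, a⟩ | ⟨R, a, b⟩ | ⟨R, a, b⟩) hα
  · exact Can.ind_mem_basicExt.2 (.base (.inl hα))
  · exact fun hB => hc.1 B a hα (Can.ind_mem_basicExt.1 hB)
  · exact Can.ind_mem_roleExt.2 ⟨R, .refl R, .inl hα⟩
  · exact fun hR => hc.2 R a b hα (Can.ind_mem_roleExt.1 hR)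

/-- The right-hand side speaks about one or two individuals at a time. This form makes consistency
transferable between knowledge bases and, later, first-order definable. -/
theorem consistent_iff {O : Ontology NC NR} (hO : O.IsHorn) {A : Set (Assertion N NC NR)} :
    Consistent O A ↔
      TypeSat N O ∅ ∧ (∀ a, TypeSat N O (asserted A a)) ∧ ClashFree O A := by
  constructor
  · rintro ⟨I, hI, hA⟩
    have hp : I.SatPos A := fun α h _ => hA α h
    obtain ⟨x⟩ := I.nonempty
    refine ⟨⟨I, hI, x, by simp⟩, fun a => ⟨I, hI, I.ind a, fun B hB => hp.asserted hB⟩, ?_, ?_⟩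
    · exact fun B a h hB => hA _ h (hB.sound hO hI fun B hB => hp.asserted hB)
    · exact fun R a b h hR => hA _ h (hp.roleDer hI hR)
  · rintro ⟨h₀, h, hc⟩
    exact ⟨_, Can.modelsKB hO h₀ h hc⟩

theorem Consistent.can {O : Ontology NC NR} (hO : O.IsHorn) {A : Set (Assertion N NC NR)}
    (h : Consistent O A) : (Can O A).ModelsKB O A :=
  let ⟨h₀, h₁, h₂⟩ := (consistent_iff hO).1 h
  Can.modelsKB hO h₀ h₁ h₂

theorem Der.entails {O : Ontology NC NR} (hO : O.IsHorn) {A : Set (Assertion N NC NR)}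
    {B : Basic NC NR} {a : N} (h : Der O (asserted A a) B) : Entails O A (.conc B a) :=
  fun I hI => h.sound (I := I) hO hI.1 fun _ hB =>
    Interp.SatPos.asserted (fun α hα _ => hI.2 α hα) hB

theorem RoleDer.entails {O : Ontology NC NR} {A : Set (Assertion N NC NR)}
    {R : Role NR} {a b : N} (h : RoleDer O A R a b) : Entails O A (.role R a b) :=
  fun I hI => Interp.SatPos.roleDer (I := I) (fun α hα _ => hI.2 α hα) hI.1 h

theorem entails_conc_iff {O : Ontology NC NR} (hO : O.IsHorn) {A : Set (Assertion N NC NR)}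
    {B : Basic NC NR} {a : N} :
    Entails O A (.conc B a) ↔ (Consistent O A → Der O (asserted A a) B) :=
  ⟨fun h hc => Can.ind_mem_basicExt.1 (h _ (hc.can hO)),
    fun h I hI => (h ⟨I, hI⟩).entails hO I hI⟩

theorem entails_role_iff {O : Ontology NC NR} (hO : O.IsHorn) {A : Set (Assertion N NC NR)}
    {R : Role NR} {a b : N} :
    Entails O A (.role R a b) ↔ (Consistent O A → RoleDer O A R a b) :=
  ⟨fun h hc => Can.ind_mem_roleExt.1 (h _ (hc.can hO)),
    fun h I hI => (h ⟨I, hI⟩).entails I hI⟩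

theorem Consistent.mono {O : Ontology NC NR} {A A' : Set (Assertion N NC NR)} (h : A ⊆ A')
    (hA : Consistent O A') : Consistent O A :=
  let ⟨I, hI⟩ := hA
  ⟨I, hI.1, fun α hα => hI.2 α (h hα)⟩

theorem Entails.mono {O : Ontology NC NR} {A A' : Set (Assertion N NC NR)} (h : A ⊆ A')
    {α : Assertion N NC NR} (hA : Entails O A α) : Entails O A' α :=
  fun I hI => hA I ⟨hI.1, fun α hα => hI.2 α (h hα)⟩

/-- The homomorphism of the canonical model into a model of the positive assertions. -/
theorem Can.exists_hom {O : Ontology NC NR} (hO : O.IsHorn) {A : Set (Assertion N NC NR)}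
    {I : Interp N NC NR} (hI : I.ModelsOnt O) (hA : I.SatPos A) :
    ∃ f : (Can O A).Dom → I.Dom, (∀ a, f ((Can O A).ind a) = I.ind a) ∧
      (∀ B x, x ∈ (Can O A).basicExt B → f x ∈ I.basicExt B) ∧
      ∀ R x y, (x, y) ∈ (Can O A).roleExt R → (f x, f y) ∈ I.roleExt R := by
  classical
  obtain ⟨x₀⟩ := I.nonempty
  -- The homomorphism follows a path by choosing a successor in `I` at each step. The value `x₀`
  -- serves for the root `none`, and is a junk value where no successor exists, which does not
  -- happen on nodes.
  let g : Option N → List (Role NR) → I.Dom := fun o w =>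
    w.rec (o.elim x₀ I.ind) fun R _ x => if h : ∃ y, (x, y) ∈ I.roleExt R then h.choose else x₀
  have hcons : ∀ o R w, (∃ y, (g o w, y) ∈ I.roleExt R) →
      (g o w, g o (R :: w)) ∈ I.roleExt R := by
    intro o R w h
    change (g o w, if h : ∃ y, (g o w, y) ∈ I.roleExt R then h.choose else x₀) ∈ _
    rw [dif_pos h]
    exact h.choose_spec
  have hseed : ∀ o w, IsNode O A o w → ∀ B ∈ seed A o w, g o w ∈ I.basicExt B := by
    intro o w
    induction w with
    | nil => cases o with
      | none => exact fun _ B hB => absurd hB (Set.notMem_empty B)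
      | some a => exact fun _ B hB => hA.asserted hB
    | cons R w ih =>
      intro hw B hB
      have := hcons o R w (hw.2.sound hO hI (ih hw.1))
      obtain rfl : B = _ := hB
      exact ⟨_, (I.mem_roleExt_flip _ _ _).2 this⟩
  have hstep : ∀ (x : (Can O A).Dom) (y : Option N × List (Role NR)) (S : Role NR),
      x.1 = (y.1, S :: y.2) → (g y.1 y.2, g x.1.1 x.1.2) ∈ I.roleExt S := by
    rintro ⟨x, hx⟩ y S rfl
    exact hcons _ _ _ (hx.2.sound hO hI (hseed _ _ hx.1))
  refine ⟨fun x => g x.1.1 x.1.2, fun a => rfl, fun B x hx => ?_, fun R x y hxy => ?_⟩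
  · exact (Can.mem_basicExt.1 hx).sound hO hI (hseed _ _ x.2)
  · rcases Can.mem_roleExt.1 hxy with ⟨a, b, hx, hy, h⟩ | ⟨S, h, hS⟩ | ⟨S, h, hS⟩
    · simp only [hx, hy]
      exact hA.roleDer hI h
    · exact hS.sound hI (hstep y x.1 S h)
    · exact (I.mem_roleExt_flip _ _ _).1 (hS.sound hI (hstep x y.1 S h))

end Canonical

/-! ### Conjunctive queries over canonical models -/

section CanonicalCQ

variable {NI NC NR NV : Type}

theorem Can.satCQ_imp {O : Ontology NC NR} (hO : O.IsHorn) {A : Set (XAssertion NI NC NR NV)}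
    {I : XInterp NI NC NR NV} (hI : I.ModelsOnt O) (hA : I.SatPos A) {q : CQ NI NC NR NV}
    (hq : XInterp.SatCQ (Can O A) q) : XInterp.SatCQ I q := by
  obtain ⟨f, hf, hB, hR⟩ := Can.exists_hom hO hI hA
  obtain ⟨π, hπ⟩ := hq
  have ht : ∀ t, f (XInterp.termVal (Can O A) π t) = XInterp.termVal I (f ∘ π) t := by
    rintro (a | x)
    · exact hf _
    · rfl
  refine ⟨f ∘ π, fun α hα => ?_⟩
  have := hπ α hα
  rcases α with ⟨B, t⟩ | ⟨R, s, t⟩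
  · have := hB _ _ this
    rwa [ht] at this
  · have := hR _ _ _ this
    rwa [ht, ht] at this

theorem entailsCQ_iff {O : Ontology NC NR} (hO : O.IsHorn) {A : Set (XAssertion NI NC NR NV)}
    {q : CQ NI NC NR NV} :
    EntailsCQ O A q ↔ (Consistent O A → XInterp.SatCQ (Can O A) q) :=
  ⟨fun h hc => h _ (hc.can hO),
    fun h I hI => Can.satCQ_imp hO hI.1 (fun α hα _ => hI.2 α hα) (h ⟨I, hI⟩)⟩

end CanonicalCQ

end TDL

namespace TDL

/-! ## Auxiliary names, positive and negative assertions -/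

section Names

variable {N NI NC NR NV : Type}

@[simp] theorem Assertion.neg_neg (α : Assertion N NC NR) : α.neg.neg = α := by
  cases α <;> rfl

theorem Assertion.IsPos.not_neg {α : Assertion N NC NR} (h : α.IsPos) : ¬ α.neg.IsPos := by
  cases α <;> first | exact id | exact h.elim

theorem Interp.not_satA_of_neg {I : Interp N NC NR} {α : Assertion N NC NR} (h : α.IsPos)
    (hα : I.SatA α.neg) : ¬ I.SatA α := by
  cases α <;> first | exact hα | exact h.elim

theorem Entails.ex {O : Ontology NC NR} {A : Set (Assertion N NC NR)} {R : Role NR} {a b : N}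
    (h : Entails O A (.role R a b)) : Entails O A (.conc (.ex R) a) :=
  fun I hI => ⟨_, h I hI⟩

theorem Entails.ex_right {O : Ontology NC NR} {A : Set (Assertion N NC NR)} {R : Role NR} {a b : N}
    (h : Entails O A (.role R.flip b a)) : Entails O A (.conc (.ex R) a) :=
  fun I hI => ⟨_, (I.mem_roleExt_flip _ _ _).1 (h I hI)⟩

theorem entails_of_mem {O : Ontology NC NR} {A : Set (Assertion N NC NR)} {α : Assertion N NC NR}
    (h : α ∈ A) : Entails O A α := fun _ hI => hI.2 α h

@[simp] theorem Role.base_flip (R : Role NR) : R.flip.base = R.base := by cases R <;> rfl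

/-- The root of the tree of names to which a name belongs. -/
def XName.base : XName NI NR NV → NI ⊕ NV
  | .ind a => .inl a
  | .aux x => .inr x
  | .tree b _ => b

/-- The name at the same position in the tree with root `b`. -/
def XName.rebase (b : NI ⊕ NV) : XName NI NR NV → XName NI NR NV
  | .ind _ => .root b
  | .aux _ => .root b
  | .tree _ ρ => .tree b ρ

@[simp] theorem XName.base_root (b : NI ⊕ NV) : (XName.root b : XName NI NR NV).base = b := by
  cases b <;> rfl

@[simp] theorem XName.base_node (b : NI ⊕ NV) (ρ : List (Role NR)) : (XName.node b ρ).base = b := by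
  cases ρ
  · exact base_root b
  · rfl

@[simp] theorem XName.base_rebase (b : NI ⊕ NV) (e : XName NI NR NV) : (e.rebase b).base = b := by
  cases e
  · exact base_root b
  · exact base_root b
  · rfl

@[simp] theorem XName.rebase_root (b b' : NI ⊕ NV) :
    (XName.root b : XName NI NR NV).rebase b' = .root b' := by
  cases b <;> rfl

@[simp] theorem XName.rebase_node (b b' : NI ⊕ NV) (ρ : List (Role NR)) :
    (XName.node b ρ).rebase b' = .node b' ρ := by
  cases ρ
  · exact rebase_root b b'
  · rfl

/-- Tree names are never roots; hence tree ABoxes touch a root only through role assertions leaving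
it. -/
theorem XName.node_concat_ne_root (b b' : NI ⊕ NV) (ρ : List (Role NR)) (R : Role NR) :
    XName.node b (ρ ++ [R]) ≠ .root b' := by
  cases ρ <;> cases b' <;> simp [node, root]

theorem XName.node_eq_root {b b' : NI ⊕ NV} {ρ : List (Role NR)} (h : XName.node b ρ = .root b') :
    ρ = [] ∧ b = b' := by
  have hb := congrArg XName.base h
  simp only [base_node, base_root] at hb
  refine ⟨?_, hb⟩
  rcases ρ.eq_nil_or_concat with rfl | ⟨ρ, R, rfl⟩
  · rfl
  · exact absurd h (by simpa using XName.node_concat_ne_root b b' ρ R)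

variable {P : Spec NI NC NR NV}

theorem Spec.treeABox_isPos {S : Role NR} {b : NI ⊕ NV} {α : XAssertion NI NC NR NV}
    (h : α ∈ P.treeABox S b) : α.IsPos := by
  obtain ⟨ρ, R, -, ⟨B, -, -, rfl⟩ | ⟨R', -, -, rfl⟩⟩ := h <;> trivial

theorem Spec.treeABox_rebase {S : Role NR} {b : NI ⊕ NV} {α : XAssertion NI NC NR NV}
    (h : α ∈ P.treeABox S b) (b' : NI ⊕ NV) : α.map (.rebase b') ∈ P.treeABox S b' := by
  obtain ⟨ρ, R, hρ, ⟨B, hB, hs, rfl⟩ | ⟨R', hR', hs, rfl⟩⟩ := h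
  · exact ⟨ρ, R, hρ, .inl ⟨B, hB, hs, by simp [Assertion.map]⟩⟩
  · exact ⟨ρ, R, hρ, .inr ⟨R', hR', hs, by simp [Assertion.map]⟩⟩

theorem Spec.base_of_mem_treeABox_conc {S : Role NR} {b : NI ⊕ NV} {B : Basic NC NR}
    {e : XName NI NR NV} (h : .conc B e ∈ P.treeABox S b) : e.base = b := by
  obtain ⟨ρ, R, -, ⟨B, -, -, h⟩ | ⟨R', -, -, h⟩⟩ := h
  · cases h; simp
  · cases h

theorem Spec.base_of_mem_treeABox_role {S R : Role NR} {b : NI ⊕ NV}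
    {e e' : XName NI NR NV} (h : .role R e e' ∈ P.treeABox S b) : e.base = b ∧ e'.base = b := by
  obtain ⟨ρ, R, -, ⟨B, -, -, h⟩ | ⟨R', -, -, h⟩⟩ := h
  · cases h
  · cases h; simp

theorem Spec.treeABox_role_right_ne {S R : Role NR} {b b' : NI ⊕ NV} {e : XName NI NR NV} :
    .role R e (.root b') ∉ P.treeABox S b := by
  rintro ⟨ρ, R, -, ⟨B, -, -, h⟩ | ⟨R', -, -, h⟩⟩
  · cases h
  · exact XName.node_concat_ne_root _ _ _ _ (Assertion.role.inj h).2.2.symm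

/-- The tree ABoxes state only rigid consequences of `∃S` about their roots. -/
theorem Spec.asserted_treeABox_root {S : Role NR} {b b' : NI ⊕ NV} {B : Basic NC NR}
    (h : B ∈ asserted (P.treeABox S b) (.root b')) :
    b = b' ∧ ∃ R ∈ P.rigRoles, P.SubRole S R ∧ B = .ex R := by
  rcases h with ⟨ρ, R, -, ⟨B, -, -, h⟩ | ⟨R', -, -, h⟩⟩ | ⟨R, e, rfl, h | h⟩
  · exact absurd (Assertion.conc.inj h).2.symm (XName.node_concat_ne_root _ _ _ _)
  · cases h
  · obtain ⟨ρ, R₁, hρ, ⟨B, -, -, h⟩ | ⟨R', hR', hs, h⟩⟩ := h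
    · cases h
    · obtain ⟨rfl, h, -⟩ := Assertion.role.inj h
      obtain ⟨rfl, rfl⟩ := XName.node_eq_root h.symm
      have : R₁ = S := by simpa using hρ.1
      exact ⟨rfl, R, hR', by rwa [← this], rfl⟩
  · exact absurd h Spec.treeABox_role_right_ne

theorem mem_asserted_flexABox {F : Set (Role NR × (NI ⊕ NV))} {e : XName NI NR NV}
    {B : Basic NC NR} :
    B ∈ asserted (P.flexABox F) e ↔ ∃ f ∈ F, B ∈ asserted (P.treeABox f.1 f.2) e := by
  constructor
  · rintro (⟨f, hf, h⟩ | ⟨R, b, rfl, ⟨f, hf, h⟩ | ⟨f, hf, h⟩⟩)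
    · exact ⟨f, hf, .inl h⟩
    · exact ⟨f, hf, .inr ⟨R, b, rfl, .inl h⟩⟩
    · exact ⟨f, hf, .inr ⟨R, b, rfl, .inr h⟩⟩
  · rintro ⟨f, hf, h⟩
    exact asserted_mono (A' := P.flexABox F) (fun α hα _ => ⟨f, hf, hα⟩) h

theorem Spec.flexABox_isPos {F : Set (Role NR × (NI ⊕ NV))} {α : XAssertion NI NC NR NV}
    (h : α ∈ P.flexABox F) : α.IsPos :=
  let ⟨_, _, h⟩ := h
  Spec.treeABox_isPos h

theorem Spec.flexABox_mono {F F' : Set (Role NR × (NI ⊕ NV))} (h : F ⊆ F') :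
    P.flexABox F ⊆ P.flexABox F' := fun _ ⟨f, hf, hα⟩ => ⟨f, h hf, hα⟩

theorem Spec.rigCons_mono {Q Q' : Set (CQ NI NC NR NV)} (h : Q ⊆ Q') :
    P.rigCons Q ⊆ P.rigCons Q' := fun _ ⟨q, hq, hα⟩ => ⟨q, h hq, hα⟩

theorem Spec.rigCons_isPos {Q : Set (CQ NI NC NR NV)} {α : XAssertion NI NC NR NV}
    (h : α ∈ P.rigCons Q) : α.IsPos :=
  let ⟨_, _, h, _⟩ := h
  h.1

theorem cqsABox_isPos {Q : Set (CQ NI NC NR NV)} {α : XAssertion NI NC NR NV}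
    (h : α ∈ cqsABox Q) : α.IsPos := by
  obtain ⟨q, -, β, -, rfl⟩ := h
  cases β <;> trivial

theorem CQ.abox_inds {q : CQ NI NC NR NV} {α : XAssertion NI NC NR NV} (h : α ∈ CQ.abox q) :
    α.inds ⊆ {e | ∃ t ∈ CQ.terms q, e = t.inst} := by
  obtain ⟨β, hβ, rfl⟩ := h
  rcases β with ⟨B, t⟩ | ⟨R, s, t⟩
  · rintro e rfl
    exact ⟨t, ⟨_, hβ, rfl⟩, rfl⟩
  · rintro e (rfl | rfl)
    · exact ⟨s, ⟨_, hβ, .inl rfl⟩, rfl⟩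
    · exact ⟨t, ⟨_, hβ, .inr rfl⟩, rfl⟩

theorem Basic.Over.mono {C C' : Set NC} {R R' : Set NR} (hC : C ⊆ C') (hR : R ⊆ R')
    {B : Basic NC NR} (h : B.Over C R) : B.Over C' R' := by
  cases B
  · exact hC h
  · exact hR h

/-- The basic concepts stated by rigid assertions are rigid. -/
theorem Spec.conc_mem_rigPos {X X' : Set N} {α : Assertion N NC NR} {a : N} {B : Basic NC NR}
    (hα : α ∈ P.rigPos X) (hB : B ∈ asserted {α} a) (ha : a ∈ X') : .conc B a ∈ P.rigPos X' := by
  refine ⟨trivial, by rintro _ rfl; exact ha, ?_⟩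
  rcases hB with rfl | ⟨R, b, rfl, rfl | rfl⟩
  · exact hα.2.2
  · exact hα.2.2
  · simpa [Assertion.Over, Basic.Over] using hα.2.2

theorem mem_asserted_singleton {A : Set (Assertion N NC NR)} {a : N} {B : Basic NC NR}
    (h : B ∈ asserted A a) : ∃ α ∈ A, B ∈ asserted {α} a := by
  rcases h with h | ⟨R, b, rfl, h | h⟩
  · exact ⟨_, h, .inl rfl⟩
  · exact ⟨_, h, .inr ⟨R, b, rfl, .inl rfl⟩⟩
  · exact ⟨_, h, .inr ⟨R, b, rfl, .inr rfl⟩⟩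

theorem mem_inds_of_mem_asserted {α : Assertion N NC NR} {a : N} {B : Basic NC NR}
    (h : B ∈ asserted {α} a) : a ∈ α.inds := by
  rcases h with rfl | ⟨R, b, rfl, rfl | rfl⟩
  · exact rfl
  · exact .inl rfl
  · exact .inr rfl

theorem entails_of_mem_asserted_singleton {O : Ontology NC NR} {A : Set (Assertion N NC NR)}
    {α : Assertion N NC NR} {a : N} {B : Basic NC NR} (h : B ∈ asserted {α} a)
    (hA : Entails O A α) : Entails O A (.conc B a) := by
  rcases h with rfl | ⟨R, b, rfl, rfl | rfl⟩
  · exact hA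
  · exact hA.ex
  · exact hA.ex_right

end Names

end TDL

namespace TDL

/-! ## The stages of the minimized rigid ABox type -/

namespace Spec

variable {NI NC NR NV : Type} {P : Spec NI NC NR NV} {D : ABoxSeq NI NC NR}
  {BΦ : Set (Assertion NI NC NR)}

theorem rigidStage_sub_rigPos (j : ℕ) : P.rigidStage D BΦ j ⊆ P.rigPos (kbInds D) := by
  cases j
  · exact fun _ h => h.1
  · exact fun _ h => h.1

theorem rigidStage_mono : Monotone (P.rigidStage D BΦ) :=
  monotone_nat_of_le_succ fun j _ h =>
    ⟨rigidStage_sub_rigPos j h, 0, entails_of_mem (.inl h)⟩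

theorem mem_minRigid_of_pos {α : XAssertion NI NC NR NV} (hα : α.IsPos) :
    α ∈ P.minRigid D BΦ ↔ ∃ j, α ∈ P.rigidStage D BΦ j := by
  constructor
  · rintro (h | ⟨β, hβ, rfl⟩)
    · exact h.2
    · exact absurd hα hβ.1.1.not_neg
  · rintro ⟨j, hj⟩
    exact .inl ⟨rigidStage_sub_rigPos j hj, j, hj⟩

theorem mem_minRigid_of_neg {α : XAssertion NI NC NR NV} (hα : α.neg.IsPos) :
    α ∈ P.minRigid D BΦ ↔ α.neg ∈ P.rigPos (kbInds D) ∧ ∀ j, α.neg ∉ P.rigidStage D BΦ j := by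
  constructor
  · rintro (h | ⟨β, hβ, rfl⟩)
    · exact absurd hα h.1.1.not_neg
    · simpa using hβ
  · intro h
    exact .inr ⟨α.neg, h, α.neg_neg⟩

theorem minRigid_isRigidType : P.IsRigidType D (P.minRigid D BΦ) := by
  constructor
  · rintro α (h | ⟨β, hβ, rfl⟩)
    · exact .inl h.1
    · exact .inr (by simpa using hβ.1)
  · intro α hα
    rw [mem_minRigid_of_neg (by simpa using hα.1), mem_minRigid_of_pos hα.1]
    simpa using fun _ => hα

theorem minRigid_inds {α : XAssertion NI NC NR NV} (hα : α ∈ P.minRigid D BΦ) :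
    α.inds ⊆ kbInds D := by
  rcases hα with h | ⟨β, hβ, rfl⟩
  · exact h.1.2.1
  · have := hβ.1.2.1
    cases β <;> exact this

/-- A derivation from the limit and one of the ABoxes uses only one stage. -/
theorem exists_der_rigidStage {A : Set (XAssertion NI NC NR NV)} {e : XName NI NR NV}
    {B : Basic NC NR} (h : Der P.O (asserted (P.minRigid D BΦ ∪ A) e) B) :
    ∃ j, Der P.O (asserted (P.rigidStage D BΦ j ∪ A) e) B := by
  refine Der.of_iUnion (X := fun j => asserted (P.rigidStage D BΦ j ∪ A) e)
    (fun j j' hj => asserted_mono fun α hα _ => hα.imp_left fun h => rigidStage_mono hj h)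
    (h.mono fun B hB => ?_)
  obtain ⟨α, hα, hB⟩ := mem_asserted_singleton hB
  have hpos : α.IsPos := by
    rcases hB with rfl | ⟨R, b, rfl, rfl | rfl⟩ <;> trivial
  have : ∃ j, α ∈ P.rigidStage D BΦ j ∪ A := by
    rcases hα with hα | hα
    · obtain ⟨j, hj⟩ := (mem_minRigid_of_pos hpos).1 hα
      exact ⟨j, .inl hj⟩
    · exact ⟨0, .inr hα⟩
  obtain ⟨j, hj⟩ := this
  refine Set.mem_iUnion.2 ⟨j, asserted_mono (A := {α}) ?_ hB⟩
  rintro _ rfl _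
  exact hj

/-- A rigid concept assertion that is derivable from the limit and one of the ABoxes belongs to the
limit. -/
theorem conc_mem_rigidStage {p : Fin (D.n + 1)} {e : XName NI NR NV} {B : Basic NC NR}
    (hr : .conc B e ∈ P.rigPos (kbInds (NV := NV) D))
    (h : Der P.O (asserted (P.minRigid D BΦ ∪ D.ext p) e) B) (hO : P.O.IsHorn) :
    ∃ j, .conc B e ∈ P.rigidStage D BΦ j := by
  obtain ⟨j, hj⟩ := exists_der_rigidStage h
  exact ⟨j + 1, hr, p, hj.entails hO⟩

end Spec

/-! ## r-complete tuples and the minimized tuple -/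

namespace Spec.RComplete

variable {NI NC NR NV : Type} {P : Spec NI NC NR NV} {D : ABoxSeq NI NC NR}
  {ι : Fin (D.n + 1) → Fin P.k} {T : RTuple NI NC NR NV}

/-- The knowledge base of the tuple at a time point. -/
abbrev kbAt (P : Spec NI NC NR NV) {D : ABoxSeq NI NC NR} (ι : Fin (D.n + 1) → Fin P.k)
    (T : RTuple NI NC NR NV) (t : P.Time D) : Set (XAssertion NI NC NR NV) :=
  P.fullABox T (P.worldAt D ι t) ∪ P.aboxAt D t

/-- The knowledge base of the tuple at a time point, without the tree ABoxes. -/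
abbrev coreAt (P : Spec NI NC NR NV) {D : ABoxSeq NI NC NR} (ι : Fin (D.n + 1) → Fin P.k)
    (T : RTuple NI NC NR NV) (t : P.Time D) : Set (XAssertion NI NC NR NV) :=
  P.coreABox T (P.worldAt D ι t) ∪ P.aboxAt D t

theorem coreAt_sub_kbAt (t : P.Time D) : coreAt P ι T t ⊆ kbAt P ι T t :=
  Set.union_subset_union_left _ Set.subset_union_left

/-- The guess for the minimized tuple: the entailed assertions about the individuals of `Φ`. -/
def guess (P : Spec NI NC NR NV) {D : ABoxSeq NI NC NR} (ι : Fin (D.n + 1) → Fin P.k)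
    (T : RTuple NI NC NR NV) : Set (Assertion NI NC NR) :=
  {α ∈ P.guessSpace | ∃ t, Entails P.O (coreAt P ι T t) (α.map .ind)}

theorem coreConsistent (hT : P.RComplete D ι T) (t : P.Time D) :
    Consistent P.O (coreAt P ι T t) :=
  (hT.consistent t).mono (coreAt_sub_kbAt t)

theorem mem_rigPos (hT : P.RComplete D ι T) {α : XAssertion NI NC NR NV} (h : α ∈ T.rigid)
    (hα : α.IsPos) : α ∈ P.rigPos (kbInds (NV := NV) D) :=
  (hT.rigidType.1 α h).resolve_right fun h => hα.not_neg h.1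

theorem rigid_sub_kbAt (t : P.Time D) : T.rigid ⊆ kbAt P ι T t :=
  fun _ h => .inl (.inl (.inl (.inl h)))

/-- The rigid ABox type contains all rigid consequences. -/
theorem mem_rigid_of_entails (hT : P.RComplete D ι T) {α : XAssertion NI NC NR NV}
    (hα : α ∈ P.rigPos (kbInds (NV := NV) D)) {t : P.Time D}
    (h : Entails P.O (kbAt P ι T t) α) : α ∈ T.rigid := by
  by_contra hn
  obtain ⟨I, hI⟩ := hT.consistent t
  -- Otherwise the type contains `¬α`, and the knowledge base at `t`, which contains the type, would
  -- be inconsistent.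
  exact I.not_satA_of_neg hα.1 (hI.2 _ (rigid_sub_kbAt t ((hT.rigidType.2 α hα).2 hn))) (h I hI)

theorem minPos_sub (hT : P.RComplete D ι T) : P.minPos ⊆ T.pos := by
  rintro q ⟨-, j, hj⟩
  exact hT.posComplete (.inr j) hj

theorem minNeg_sub (hT : P.RComplete D ι T) : P.minNeg ⊆ T.neg := by
  rintro q ⟨hq, j, hj⟩
  exact hT.negComplete (.inr j) q hq hj

theorem worldAt_sub_minPos (hP : P.WellFormed) (t : P.Time D) :
    P.worldAt D ι t ⊆ P.minPos := by
  cases t with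
  | inl i => exact fun q hq => ⟨hP.worlds _ hq, _, hq⟩
  | inr j => exact fun q hq => ⟨hP.worlds _ hq, _, hq⟩

theorem guess_sub : guess P ι T ⊆ P.guessSpace := fun _ h => h.1

/-- The guess contains all rigid entailed assertions about individuals of `Φ`. -/
theorem conc_mem_rigidStage_zero (hT : P.RComplete D ι T) {B : Basic NC NR} {a : NI}
    (ha : a ∈ P.Φ.inds) (hr : .conc B (.ind a) ∈ P.rigPos (kbInds (NV := NV) D)) {t : P.Time D}
    (h : Entails P.O (kbAt P ι T t) (.conc B (.ind a))) :
    .conc B (.ind a) ∈ P.rigidStage D (guess P ι T) 0 := by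
  refine ⟨hr, .inl ⟨.conc B a, ⟨⟨B, ?_, a, ha, rfl⟩, .inl 0, ?_⟩, rfl⟩⟩
  · exact Basic.Over.mono Set.inter_subset_left Set.inter_subset_left hr.2.2
  -- The hypothesis concerns the full knowledge base, the guess only core ones. As a rigid
  -- consequence the assertion belongs to `T.rigid`, hence to the core at every time point, for
  -- instance `0`.
  · exact entails_of_mem (.inl (.inl (.inl (hT.mem_rigid_of_entails hr h))))

/-- `T.rigid` contains the rigid part of the starting set and is closed under rigid consequences at
every time point; the stages are the least such closure with respect to the ABoxes alone. -/
theorem rigidStage_sub (hT : P.RComplete D ι T) (j : ℕ) :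
    P.rigidStage D (guess P ι T) j ⊆ T.rigid := by
  induction j with
  | zero =>
    rintro α ⟨hα, ⟨β, ⟨-, t, ht⟩, rfl⟩ | h⟩
    · exact hT.mem_rigid_of_entails hα (ht.mono (coreAt_sub_kbAt t))
    · exact hT.mem_rigid_of_entails hα (t := .inl 0)
        (entails_of_mem (.inl (.inl (.inl (.inr (rigCons_mono hT.minPos_sub h))))))
  | succ j ih =>
    rintro α ⟨hα, p, h⟩
    exact hT.mem_rigid_of_entails hα (t := .inl p)
      (h.mono (Set.union_subset_union_left _ fun α hα => .inl (.inl (.inl (ih hα)))))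

theorem minRigid_pos_sub (hT : P.RComplete D ι T) {α : XAssertion NI NC NR NV}
    (h : α ∈ P.minRigid D (guess P ι T)) (hα : α.IsPos) : α ∈ T.rigid :=
  let ⟨j, hj⟩ := (mem_minRigid_of_pos hα).1 h
  hT.rigidStage_sub j hj

/-- Adding assertions of the knowledge base of `T` to the minimized rigid type preserves
consistency, if these assertions have no further rigid consequences for the individuals that do not
occur in `Φ`. -/
theorem minRigid_consistent (hT : P.RComplete D ι T) (hP : P.WellFormed)
    {t : P.Time D} {p : Fin (D.n + 1)}
    {Y : Set (XAssertion NI NC NR NV)} (hY : Y ⊆ kbAt P ι T t)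
    (hconc : ∀ a ∉ P.Φ.inds, ∀ B ∈ asserted Y (.ind a),
      Der P.O (asserted (P.minRigid D (guess P ι T) ∪ D.ext p) (.ind a)) B)
    (hrole : ∀ R a b, .role R (.ind a) (.ind b) ∈ Y → .role R (.ind a) (.ind b) ∈ D.ext (NV := NV) p ∨
      ∀ S, SubR P.O R S → .role S (.ind a) (.ind b) ∈ P.rigPos (kbInds (NV := NV) D) →
        .role S (.ind a) (.ind b) ∈ P.rigidStage D (guess P ι T) 0) :
    Consistent P.O (P.minRigid D (guess P ι T) ∪ Y) := by
  have hpos : ∀ α ∈ P.minRigid D (guess P ι T) ∪ Y, α.IsPos → α ∈ kbAt P ι T t := by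
    rintro α (h | h) hα
    · exact rigid_sub_kbAt t (hT.minRigid_pos_sub h hα)
    · exact hY h
  obtain ⟨h₀, h₁, h₂, h₃⟩ := (consistent_iff hP.horn).1 (hT.consistent t)
  refine (consistent_iff hP.horn).2 ⟨h₀, fun a => (h₁ a).mono (asserted_mono hpos), ?_, ?_⟩
  · rintro B e (h | h) hB
    · obtain ⟨hr, hn⟩ := (mem_minRigid_of_neg (by trivial)).1 h
      obtain ⟨a, -, rfl⟩ : e ∈ kbInds D := hr.2.1 rfl
      -- A derivable but excluded concept assertion is refuted by the guess at stage zero if it is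
      -- about an individual of `Φ`, and otherwise by a later stage, using the locality hypothesis
      -- `hconc`.
      by_cases ha : a ∈ P.Φ.inds
      · exact hn 0 (hT.conc_mem_rigidStage_zero ha hr ((hB.mono (asserted_mono hpos)).entails hP.horn))
      · obtain ⟨j, hj⟩ := conc_mem_rigidStage hr (hB.trans fun B' hB' => by
          rw [asserted_union] at hB'
          exact hB'.elim (fun h => .base (asserted_mono (fun α hα _ => .inl hα) h))
            (hconc a ha B')) hP.horn
        exact hn j hj
    · exact h₂ B e (hY h) (hB.mono (asserted_mono hpos))
  · rintro R e e' (h | h) hR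
    · obtain ⟨hr, hn⟩ := (mem_minRigid_of_neg (by trivial)).1 h
      -- A rigid role assertion obtained from a present assertion by role inclusions is reached by
      -- some stage.
      have hmem : ∀ S R e e', SubR P.O S R → .role R e e' ∈ P.rigPos (kbInds (NV := NV) D) →
          .role S e e' ∈ P.minRigid D (guess P ι T) ∪ Y →
          ∃ j, .role R e e' ∈ P.rigidStage D (guess P ι T) j := by
        rintro S R e e' hS hr (h | h)
        · obtain ⟨j, hj⟩ := (mem_minRigid_of_pos (α := .role S e e') trivial).1 h
          exact ⟨j + 1, hr, p, RoleDer.entails ⟨S, hS, .inl (.inl hj)⟩⟩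
        · obtain ⟨a, -, rfl⟩ : e ∈ kbInds D := hr.2.1 (.inl rfl)
          obtain ⟨b, -, rfl⟩ : e' ∈ kbInds D := hr.2.1 (.inr rfl)
          rcases hrole S a b h with h | h
          · exact ⟨1, hr, p, RoleDer.entails ⟨S, hS, .inl (.inr h)⟩⟩
          · exact ⟨0, h R hS hr⟩
      obtain ⟨S, hS, h | h⟩ := hR
      · obtain ⟨j, hj⟩ := hmem S R e e' hS hr h
        exact hn j hj
      · obtain ⟨j, hj⟩ := hmem S.flip R.flip e' e hS.flip
          ⟨trivial, fun x hx => hr.2.1 hx.symm, by simpa [Assertion.Over, Assertion.neg] using hr.2.2⟩ h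
        -- Stage `j` has the inverse assertion; one further stage turns it around. The time point is
        -- irrelevant.
        exact hn (j + 1) ⟨hr, 0, RoleDer.entails ⟨R, .refl R, .inr (.inl hj)⟩⟩
    · exact h₃ R e e' (hY h) (hR.mono hpos)

/-- This special case is needed first: it makes the flexible successors of individuals outside `Φ`
actual derivations, and only then can the full minimized knowledge base be treated. -/
theorem minRigid_ext_consistent (hT : P.RComplete D ι T) (hP : P.WellFormed)
    (p : Fin (D.n + 1)) : Consistent P.O (P.minRigid D (guess P ι T) ∪ D.ext (NV := NV) p) :=
  hT.minRigid_consistent hP (t := .inl p) (p := p) (fun _ h => .inr h)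
    (fun _ _ _ hB => .base (asserted_mono (fun _ h _ => .inr h) hB)) fun _ _ _ h => .inl h

/-- Monotonicity of entailment does not apply to `minRigid`, whose negative assertions may be
missing in `T`. By consistency the entailment is a derivation, and derivations use positive
assertions only. -/
theorem minFlex_sub (hT : P.RComplete D ι T) (hP : P.WellFormed) (hD : P.Φ.inds ⊆ D.inds) :
    (P.minTuple D (guess P ι T)).flex ⊆ T.flex := by
  rintro ⟨S, b⟩ ((⟨hS, x, hx, rfl, j, h⟩ | ⟨hS, a, ha, rfl, -, t, h⟩) | ⟨hS, a, ha, rfl, i, h⟩)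
  · exact (hT.flexComplete S hS _ (.inr ⟨x, hx, rfl⟩)).2 ⟨.inr j, h.mono fun _ h => .inl (.inr h)⟩
  · exact (hT.flexComplete S hS _ (.inl ⟨a, hD ha, rfl⟩)).2 ⟨t, h⟩
  · refine (hT.flexComplete S hS _ (.inl ⟨a, ha.1, rfl⟩)).2 ⟨.inl i, ?_⟩
    refine Der.entails hP.horn (((entails_conc_iff hP.horn).1 h
      (hT.minRigid_ext_consistent hP i)).mono (asserted_mono ?_))
    rintro α (h | h) hα
    · exact .inl (.inl (.inl (hT.minRigid_pos_sub h hα)))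
    · exact .inr h

theorem coreAt_min_pos_sub (hT : P.RComplete D ι T) (t : P.Time D) {α : XAssertion NI NC NR NV}
    (h : α ∈ coreAt P ι (P.minTuple D (guess P ι T)) t) (hα : α.IsPos) : α ∈ coreAt P ι T t := by
  rcases h with ((h | h) | h) | h
  · exact .inl (.inl (.inl (hT.minRigid_pos_sub h hα)))
  · exact .inl (.inl (.inr (rigCons_mono hT.minPos_sub h)))
  · exact .inl (.inr h)
  · exact .inr h

theorem kbAt_min_pos_sub (hT : P.RComplete D ι T) (hP : P.WellFormed) (hD : P.Φ.inds ⊆ D.inds)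
    (t : P.Time D) {α : XAssertion NI NC NR NV}
    (h : α ∈ kbAt P ι (P.minTuple D (guess P ι T)) t) (hα : α.IsPos) : α ∈ kbAt P ι T t := by
  rcases h with (h | h) | h
  · exact coreAt_sub_kbAt t (hT.coreAt_min_pos_sub t (.inl h) hα)
  · exact .inl (.inr (flexABox_mono (hT.minFlex_sub hP hD) h))
  · exact .inr h

/-! ### Locality and consistency of the minimized knowledge base -/

theorem mem_inds_of_mem_rigCons {Q : Set (CQ NI NC NR NV)} (hQ : Q ⊆ P.Φ.cqs)
    {α : XAssertion NI NC NR NV} (h : α ∈ P.rigCons Q) {a : NI} (ha : .ind a ∈ α.inds) :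
    a ∈ P.Φ.inds := by
  obtain ⟨q, hq, hr, -⟩ := h
  obtain ⟨t | x, ht, h⟩ := hr.2.1 ha
  · cases h
    exact ⟨q, hQ hq, ht⟩
  · cases h

theorem mem_inds_of_mem_cqsABox {Q : Set (CQ NI NC NR NV)} (hQ : Q ⊆ P.Φ.cqs)
    {α : XAssertion NI NC NR NV} (h : α ∈ cqsABox Q) {a : NI} (ha : .ind a ∈ α.inds) :
    a ∈ P.Φ.inds := by
  obtain ⟨q, hq, h⟩ := h
  obtain ⟨t | x, ht, h⟩ := CQ.abox_inds h ha
  · cases h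
    exact ⟨q, hQ hq, ht⟩
  · cases h

theorem worldAt_sub (hP : P.WellFormed) (t : P.Time D) : P.worldAt D ι t ⊆ P.Φ.cqs :=
  fun _ h => (worldAt_sub_minPos hP t h).1

/-- The ABox of a time point; an arbitrary one for the additional time points. -/
theorem exists_aboxAt_sub (t : P.Time D) : ∃ p, P.aboxAt D t ⊆ D.ext (NV := NV) p := by
  cases t with
  | inl p => exact ⟨p, subset_rfl⟩
  | inr j => exact ⟨0, Set.empty_subset _⟩

/-- Locality: away from the individuals of `Φ`, the minimized knowledge base derives only what
follows from the rigid type and the ABox. -/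
theorem der_of_asserted_min (hT : P.RComplete D ι T) (hP : P.WellFormed) {t : P.Time D}
    {p : Fin (D.n + 1)} (hp : P.aboxAt D t ⊆ D.ext (NV := NV) p) {a : NI} (ha : a ∉ P.Φ.inds)
    {B : Basic NC NR}
    (hB : B ∈ asserted (kbAt P ι (P.minTuple D (guess P ι T)) t) (.ind a)) :
    Der P.O (asserted (P.minRigid D (guess P ι T) ∪ D.ext p) (.ind a)) B := by
  rw [asserted_union, fullABox, asserted_union] at hB
  obtain (hB | hB) | hB := hB
  · obtain ⟨α, (hα | hα) | hα, hB⟩ := mem_asserted_singleton hB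
    · refine .base (asserted_mono (A := {α}) ?_ hB)
      rintro _ rfl _
      exact .inl hα
    · exact absurd (mem_inds_of_mem_rigCons (fun _ h => h.1) hα (mem_inds_of_mem_asserted hB)) ha
    · exact absurd (mem_inds_of_mem_cqsABox (worldAt_sub hP t) hα (mem_inds_of_mem_asserted hB)) ha
  · obtain ⟨⟨S, b⟩, hf, hB⟩ := mem_asserted_flexABox.1 hB
    obtain ⟨rfl, R, hR, hs, rfl⟩ := asserted_treeABox_root (b' := .inl a) hB
    obtain (⟨-, x, -, h, -⟩ | ⟨-, a', ha', h, -⟩) | ⟨-, a', ha', h, i, hi⟩ := hf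
    · cases h
    · cases h
      exact absurd ha' ha
    · cases h
      -- The tree ABox states `∃R` at its root with `R` rigid and `∃S ⊑ ∃R`. Since `∃S(a)` follows
      -- from the type and `A_i`, the rigid assertion `∃R(a)` is already in the type, whatever the
      -- current time point.
      obtain ⟨j, hj⟩ := conc_mem_rigidStage (P := P) (BΦ := guess P ι T) (p := i) (B := .ex R)
        (e := .ind a) ⟨trivial, by rintro _ rfl; exact ⟨a, ha'.1, rfl⟩, hR⟩
        ((entails_conc_iff hP.horn).1 (fun I hI => by
          obtain ⟨y, hy⟩ := hi I hI
          exact ⟨y, hs I hI.1 hy⟩) (hT.minRigid_ext_consistent hP i)) hP.horn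
      exact .base (.inl (.inl ((mem_minRigid_of_pos (α := .conc _ _) trivial).2 ⟨j, hj⟩)))
  · exact .base (asserted_mono (fun α hα _ => .inr (hp hα)) hB)

/-- Everything except the type is part of the knowledge base of `T`, so `minRigid_consistent`
applies. Rigid superroles of role assertions from CQs are rigid consequences of the same CQ, hence
in stage zero; tree ABoxes have no role assertion ending in a root. -/
theorem consistent_min (hT : P.RComplete D ι T) (hP : P.WellFormed) (hD : P.Φ.inds ⊆ D.inds)
    (t : P.Time D) : Consistent P.O (kbAt P ι (P.minTuple D (guess P ι T)) t) := by
  obtain ⟨p, hp⟩ := exists_aboxAt_sub (NV := NV) t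
  set F := (P.minTuple D (guess P ι T)).flex
  have hK : kbAt P ι (P.minTuple D (guess P ι T)) t = P.minRigid D (guess P ι T) ∪
      (P.rigCons P.minPos ∪ cqsABox (P.worldAt D ι t) ∪ P.flexABox F ∪ P.aboxAt D t) := by
    simp only [kbAt, fullABox, coreABox, Set.union_assoc]
    rfl
  have hsub : P.rigCons P.minPos ∪ cqsABox (P.worldAt D ι t) ∪ P.flexABox F ∪ P.aboxAt D t ⊆
      kbAt P ι (P.minTuple D (guess P ι T)) t := hK ▸ Set.subset_union_right
  rw [hK]
  refine hT.minRigid_consistent hP (t := t) (p := p) ?_ ?_ ?_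
  · rintro α hα
    have := hT.kbAt_min_pos_sub hP hD t (hsub hα)
    rcases hα with ((h | h) | h) | h
    · exact this (rigCons_isPos h)
    · exact this (cqsABox_isPos h)
    · exact this (flexABox_isPos h)
    · exact .inr h
  · exact fun a ha B hB =>
      hT.der_of_asserted_min hP hp ha (asserted_mono (fun _ h _ => hsub h) hB)
  · rintro R a b (((h | h) | h) | h)
    · refine .inr fun S hS hr => ⟨hr, .inr ?_⟩
      obtain ⟨q, hq, hr', he⟩ := h
      exact ⟨q, hq, ⟨trivial, hr'.2.1, hr.2.2⟩, fun I hI => hS.sound hI.1 (he I hI)⟩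
    · refine .inr fun S hS hr => ⟨hr, .inr ?_⟩
      obtain ⟨q, hq, h⟩ := h
      have hi := CQ.abox_inds h
      exact ⟨q, worldAt_sub_minPos hP t hq, ⟨trivial, hi, hr.2.2⟩,
        fun I hI => hS.sound hI.1 (hI.2 _ h)⟩
    · obtain ⟨f, -, h⟩ := h
      exact absurd h (treeABox_role_right_ne (b' := .inl b))
    · exact .inl (hp h)

/-- The consistent minimized knowledge base has a canonical model satisfying the CQ, which maps into
every model of the larger positive part in `T`. This covers both the negated CQs and the rigid
witnesses. -/
theorem entailsCQ_of_min (hT : P.RComplete D ι T) (hP : P.WellFormed) (hD : P.Φ.inds ⊆ D.inds)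
    (t : P.Time D) {q : CQ NI NC NR NV}
    (h : EntailsCQ P.O (kbAt P ι (P.minTuple D (guess P ι T)) t) q) :
    EntailsCQ P.O (kbAt P ι T t) q := fun _ hI =>
  Can.satCQ_imp hP.horn hI.1 (fun α hα hpos => hI.2 α (hT.kbAt_min_pos_sub hP hD t hα hpos))
    ((entailsCQ_iff hP.horn).1 h (hT.consistent_min hP hD t))

/-- Some world contains every CQ that is satisfied somewhere and contains a given variable. -/
theorem exists_world_of_var (hP : P.WellFormed) (j₀ : Fin P.k) (x : NV) :
    ∃ j, ∀ q ∈ P.minPos, x ∈ CQ.vars q → q ∈ P.world j := by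
  by_cases h : ∃ q ∈ P.minPos, x ∈ CQ.vars q
  · obtain ⟨q, ⟨hq, j, hj⟩, hx⟩ := h
    refine ⟨j, fun q' hq' hx' => ?_⟩
    by_cases hqq : q = q'
    · exact hqq ▸ hj
    · exact absurd hx' (Set.disjoint_left.1 (hP.disjointVars q hq q' hq'.1 hqq) hx)
  · exact ⟨j₀, fun q hq hx => absurd ⟨q, hq, hx⟩ h⟩

theorem var_of_aux_mem {q : CQ NI NC NR NV} {X : Set (XName NI NR NV)} {x : NV}
    (h : X ⊆ {e | ∃ t ∈ CQ.terms q, e = t.inst}) (hx : .aux x ∈ X) : x ∈ CQ.vars q := by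
  obtain ⟨a | y, ht, h⟩ := h hx
  · cases h
  · cases h
    exact ht

theorem flexComplete_min (hT : P.RComplete D ι T) (hP : P.WellFormed) (hD : P.Φ.inds ⊆ D.inds)
    {S : Role NR} (hS : S ∈ P.flexRoles) {b : NI ⊕ NV} (hb : b ∈ P.flexInds D) :
    (S, b) ∈ (P.minTuple D (guess P ι T)).flex ↔
      ∃ t, Entails P.O (coreAt P ι (P.minTuple D (guess P ι T)) t) (.conc (.ex S) (.root b)) := by
  constructor
  · rintro ((⟨-, x, hx, h, j, he⟩ | ⟨-, a, ha, h, -, t, he⟩) | ⟨-, a, ha, h, i, he⟩) <;>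
      obtain rfl : b = _ := h
    · exact ⟨.inr j, he.mono fun _ h => .inl (.inr h)⟩
    · refine ⟨t, Der.entails hP.horn (((entails_conc_iff hP.horn).1 he
        (hT.coreConsistent t)).trans fun B hB => .base ?_)⟩
      obtain ⟨α, hα, hB⟩ := mem_asserted_singleton hB
      have hent := entails_of_mem_asserted_singleton hB
        (entails_of_mem (O := P.O) (coreAt_sub_kbAt t hα))
      -- A rigid assertion of `T` may be absent from the minimized tuple, but the basic concept it
      -- states about `a` was guessed. Concept derivations at `a` need nothing more.
      have hrig : α ∈ P.rigPos (kbInds (NV := NV) D) ∨ α ∈ P.rigCons T.pos →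
          B ∈ asserted (coreAt P ι (P.minTuple D (guess P ι T)) t) (.ind a) := by
        intro h
        have hr : .conc B (.ind a) ∈ P.rigPos (kbInds (NV := NV) D) := by
          rcases h with h | ⟨_, _, h, _⟩ <;> exact conc_mem_rigPos h hB ⟨a, hD ha, rfl⟩
        exact .inl (.inl (.inl (.inl ((mem_minRigid_of_pos hr.1).2 ⟨0,
          hT.conc_mem_rigidStage_zero ha hr hent⟩))))
      rcases hα with ((h | h) | h) | h
      · refine hrig (.inl (hT.mem_rigPos h ?_))
        rcases hB with rfl | ⟨R, b, rfl, rfl | rfl⟩ <;> trivial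
      · exact hrig (.inr h)
      · refine asserted_mono (A := {α}) ?_ hB
        rintro _ rfl _
        exact .inl (.inr h)
      · refine asserted_mono (A := {α}) ?_ hB
        rintro _ rfl _
        exact .inr h
    · refine ⟨.inl i, he.mono ?_⟩
      rintro α (h | h)
      · exact .inl (.inl (.inl h))
      · exact .inr h
  · rintro ⟨t, he⟩
    have hder := (entails_conc_iff hP.horn).1 he
      ((hT.consistent_min hP hD t).mono (coreAt_sub_kbAt t))
    rcases hb with ⟨a, ha, rfl⟩ | ⟨x, hx, rfl⟩
    · by_cases haΦ : a ∈ P.Φ.inds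
      · refine .inl (.inr ⟨hS, a, haΦ, rfl, ⟨.ex S, hS.1, a, haΦ, rfl⟩, t, ?_⟩)
        exact Der.entails hP.horn (hder.mono (asserted_mono fun α hα h =>
          hT.coreAt_min_pos_sub t hα h))
      · obtain ⟨p, hp⟩ := exists_aboxAt_sub (NV := NV) t
        refine .inr ⟨hS, a, ⟨ha, haΦ⟩, rfl, p, Der.entails hP.horn (hder.trans fun B hB => ?_)⟩
        exact hT.der_of_asserted_min hP hp haΦ (asserted_mono (fun _ h _ => coreAt_sub_kbAt t h) hB)
    · obtain ⟨j, hj⟩ := exists_world_of_var hP (ι 0) x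
      refine .inl (.inl ⟨hS, x, hx, rfl, j, Der.entails hP.horn (hder.trans fun B hB => ?_)⟩)
      have hc : Consistent P.O (cqsABox (P.world j)) :=
        (hT.coreConsistent (.inr j)).mono fun _ h => .inl (.inr h)
      obtain ⟨α, hα, hB⟩ := mem_asserted_singleton hB
      have hi := mem_inds_of_mem_asserted hB
      refine (entails_conc_iff hP.horn).1 (entails_of_mem_asserted_singleton hB ?_) hc
      rcases hα with ((h | h) | h) | h
      · obtain ⟨_, _, h⟩ := minRigid_inds h hi
        cases h
      · obtain ⟨q, hq, hr, he⟩ := h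
        have hq' := hj q hq (var_of_aux_mem hr.2.1 hi)
        exact he.mono (A' := cqsABox (P.world j)) fun β hβ => ⟨q, hq', hβ⟩
      · obtain ⟨q, hq, h⟩ := h
        have hq' := hj q (worldAt_sub_minPos hP t hq) (var_of_aux_mem (CQ.abox_inds h) hi)
        exact entails_of_mem ⟨q, hq', h⟩
      · obtain ⟨p, hp⟩ := exists_aboxAt_sub (NV := NV) t
        obtain ⟨β, -, rfl⟩ := hp h
        cases β <;> simp [Assertion.map, Assertion.inds, XName.root] at hi

theorem minTuple (hT : P.RComplete D ι T) (hP : P.WellFormed) (hD : P.Φ.inds ⊆ D.inds) :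
    P.RComplete D ι (P.minTuple D (guess P ι T)) where
  rigidType := minRigid_isRigidType
  pos_sub _ h := h.1
  neg_sub _ h := h.1
  flex_sub := by
    rintro ⟨S, b⟩ ((⟨hS, x, hx, rfl, -⟩ | ⟨hS, a, ha, rfl, -⟩) | ⟨hS, a, ha, rfl, -⟩)
    · exact ⟨hS, .inr ⟨x, hx, rfl⟩⟩
    · exact ⟨hS, .inl ⟨a, hD ha, rfl⟩⟩
    · exact ⟨hS, .inl ⟨a, ha.1, rfl⟩⟩
  consistent := hT.consistent_min hP hD
  negCQs t q hq hn h := hT.negCQs t q hq hn (hT.entailsCQ_of_min hP hD t h)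
  posComplete := worldAt_sub_minPos hP
  negComplete := by
    rintro (i | j) q hq hn
    · exact ⟨hq, _, hn⟩
    · exact ⟨hq, _, hn⟩
  witnesses t q hq ψ hψ h :=
    hT.witnesses t q (hT.minNeg_sub hq) ψ hψ (hT.entailsCQ_of_min hP hD t h)
  flexComplete S hS b hb := hT.flexComplete_min hP hD hS hb

end Spec.RComplete
end TDL

namespace TDL

/-! ## Finiteness of the signature -/

section Finite

variable {NI NC NR NV : Type}

theorem Ontology.finite_concNames (O : Ontology NC NR) : O.concNames.Finite := by
  have h : (⋃ c ∈ O.cis, {B | B ∈ c.lhs ++ c.rhs}).Finite :=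
    O.cis.finite_toSet.biUnion fun c _ => List.finite_toSet _
  refine (h.preimage (f := Basic.atom) fun _ _ _ _ h => Basic.atom.inj h).subset ?_
  rintro A ⟨c, hc, h⟩
  exact Set.mem_biUnion hc (by simpa using h)

theorem finite_roles_over {S : Set NR} (h : S.Finite) : {R : Role NR | R.base ∈ S}.Finite := by
  refine ((h.image Role.name).union (h.image Role.inv)).subset ?_
  rintro (P | P) hP
  · exact .inl ⟨P, hP, rfl⟩
  · exact .inr ⟨P, hP, rfl⟩

theorem Ontology.finite_roleNames (O : Ontology NC NR) : O.roleNames.Finite := by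
  have h : (⋃ c ∈ O.cis, {B | B ∈ c.lhs ++ c.rhs}).Finite :=
    O.cis.finite_toSet.biUnion fun c _ => List.finite_toSet _
  have h' := (h.preimage (f := Basic.ex) fun _ _ _ _ h => Basic.ex.inj h).image Role.base
  have h₂ := (O.ris.finite_toSet.image fun r => r.sub.base).union
    (O.ris.finite_toSet.image fun r => r.sup.base)
  refine (h'.union h₂).subset ?_
  rintro P (⟨c, hc, R, rfl, h⟩ | ⟨r, hr, rfl | rfl⟩)
  · exact .inl ⟨R, Set.mem_biUnion hc (by simpa using h), rfl⟩
  · exact .inr (.inl ⟨r, hr, rfl⟩)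
  · exact .inr (.inr ⟨r, hr, rfl⟩)

theorem finite_basics_over {C : Set NC} {S : Set NR} (hC : C.Finite) (hS : S.Finite) :
    {B : Basic NC NR | B.Over C S}.Finite := by
  refine ((hC.image Basic.atom).union ((finite_roles_over hS).image Basic.ex)).subset ?_
  rintro (A | R) h
  · exact .inl ⟨A, h, rfl⟩
  · exact .inr ⟨R, h, rfl⟩

/-- The basic concepts over the names of the ontology. -/
abbrev Ontology.SigBasic (O : Ontology NC NR) : Type :=
  {B : Basic NC NR // B.Over O.concNames O.roleNames}

/-- The roles over the names of the ontology. -/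
abbrev Ontology.SigRole (O : Ontology NC NR) : Type := {R : Role NR // R.base ∈ O.roleNames}

instance (O : Ontology NC NR) : Finite O.SigBasic :=
  (finite_basics_over O.finite_concNames O.finite_roleNames).to_subtype

instance (O : Ontology NC NR) : Finite O.SigRole :=
  (finite_roles_over O.finite_roleNames).to_subtype

theorem TCQ.finite_cqs (Φ : TCQ NI NC NR NV) : Φ.cqs.Finite := by
  induction Φ <;> simp only [TCQ.cqs]
  all_goals first
    | exact Set.finite_singleton _
    | assumption
    | exact Set.Finite.union (by assumption) (by assumption)

theorem CQ.finite_terms (q : CQ NI NC NR NV) : (CQ.terms q).Finite := by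
  have : CQ.terms q = ⋃ α ∈ q, α.terms := by
    ext t
    simp [CQ.terms]
  rw [this]
  refine q.finite_toSet.biUnion fun α _ => ?_
  cases α
  · exact Set.finite_singleton _
  · exact (Set.finite_singleton _).insert _

theorem TCQ.finite_inds (Φ : TCQ NI NC NR NV) : Φ.inds.Finite := by
  have : Φ.inds = ⋃ q ∈ Φ.cqs, Term.ind ⁻¹' CQ.terms q := by
    ext a
    simp [TCQ.inds, CQ.inds]
  rw [this]
  exact Φ.finite_cqs.biUnion fun q _ =>
    (CQ.finite_terms q).preimage fun _ _ _ _ h => Term.ind.inj h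

end Finite

/-! ## Uniform first-order definability -/

section Definability

open FirstOrder Language

variable {NI NC NR NV : Type}

/-- The admissible sequences of ABoxes. -/
structure Inst (P : Spec NI NC NR NV) where
  D : ABoxSeq NI NC NR
  sig : D.InSig P.O
  sub : P.Φ.inds ⊆ D.inds

/-- The time points `-1, 0, ..., n`. -/
abbrev Inst.Time {P : Spec NI NC NR NV} (X : Inst P) : Type := WithBot (Fin (X.D.n + 1))

/-- A temporal database with an assignment of elements to the variables in `α`. -/
structure RVal (P : Spec NI NC NR NV) (α : Type) where
  X : Inst P
  v : α → TDBDom X.D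

variable {P : Spec NI NC NR NV} {α β ι κ 𝒱 : Type}

/-- Satisfaction in a temporal database. -/
def RVal.Sat (u : RVal P α) (φ : (tdbLang NC NR P.Φ.inds).Formula α) : Prop :=
  letI := tdb u.X.D u.X.sub
  φ.Realize u.v

/-- A property of assignments is defined by a formula that does not depend on the data. -/
def Defin (e : 𝒱 → RVal P α) (R : 𝒱 → Prop) : Prop :=
  ∃ φ : (tdbLang NC NR P.Φ.inds).Formula α, ∀ u, (e u).Sat φ ↔ R u

theorem Defin.congr {e : 𝒱 → RVal P α} {R R' : 𝒱 → Prop} (h : Defin e R) (h' : ∀ u, R u ↔ R' u) :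
    Defin e R' :=
  let ⟨φ, hφ⟩ := h
  ⟨φ, fun u => (hφ u).trans (h' u)⟩

/-- A property that depends only on the truth values of finitely many definable properties is
definable. -/
theorem Defin.determined [Finite κ] {e : 𝒱 → RVal P α} {F : κ → 𝒱 → Prop}
    (hF : ∀ k, Defin e (F k)) {R : 𝒱 → Prop}
    (h : ∀ u u', (∀ k, F k u ↔ F k u') → R u → R u') : Defin e R := by
  classical
  choose φ hφ using hF
  -- One conjunction for each truth pattern realized by some assignment satisfying `R`. There are
  -- finitely many patterns, and which ones are realized is a fixed fact ranging over all data at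
  -- once, so the disjunction is uniform.
  let ψ : {S : Set κ // ∃ u, R u ∧ ∀ k, F k u ↔ k ∈ S} → (tdbLang NC NR P.Φ.inds).Formula α :=
    fun S => Formula.iInf fun k => if k ∈ S.1 then φ k else (φ k).not
  refine ⟨Formula.iSup ψ, fun u => ?_⟩
  let _ := tdb (e u).X.D (e u).X.sub
  have hs : ∀ S, (ψ S).Realize (e u).v ↔ ∀ k, F k u ↔ k ∈ S.1 := by
    intro S
    rw [Formula.realize_iInf]
    refine forall_congr' fun k => ?_
    have hk := hφ k u
    simp only [RVal.Sat] at hk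
    by_cases hS : k ∈ S.1
    · simpa [hS] using hk
    · simpa [hS] using not_congr hk
  rw [RVal.Sat, Formula.realize_iSup]
  constructor
  · rintro ⟨S, hS⟩
    obtain ⟨u', hu', hS'⟩ := S.2
    exact h u' u (fun k => (hS' k).trans ((hs S).1 hS k).symm) hu'
  · intro hu
    exact ⟨⟨{k | F k u}, u, hu, fun k => Iff.rfl⟩, (hs _).2 fun k => Iff.rfl⟩

theorem Defin.const {e : 𝒱 → RVal P α} {R : 𝒱 → Prop} (h : ∀ u u', R u → R u') : Defin e R :=
  Defin.determined (κ := Empty) (F := fun k => k.elim) (fun k => k.elim) fun u u' _ => h u u'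

theorem Defin.not {e : 𝒱 → RVal P α} {R : 𝒱 → Prop} (h : Defin e R) : Defin e fun u => ¬ R u :=
  Defin.determined (κ := Unit) (F := fun _ => R) (fun _ => h)
    fun _ _ hk hn hR => hn ((hk ()).2 hR)

theorem Defin.exists_finite [Finite κ] {e : 𝒱 → RVal P α} {F : κ → 𝒱 → Prop}
    (hF : ∀ k, Defin e (F k)) : Defin e fun u => ∃ k, F k u :=
  Defin.determined hF fun _ _ hk ⟨k, h⟩ => ⟨k, (hk k).1 h⟩

theorem Defin.forall_finite [Finite κ] {e : 𝒱 → RVal P α} {F : κ → 𝒱 → Prop}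
    (hF : ∀ k, Defin e (F k)) : Defin e fun u => ∀ k, F k u :=
  Defin.determined hF fun _ _ hk h k => (hk k).1 (h k)

theorem Defin.or {e : 𝒱 → RVal P α} {R R' : 𝒱 → Prop} (h : Defin e R) (h' : Defin e R') :
    Defin e fun u => R u ∨ R' u :=
  Defin.determined (κ := Bool) (F := fun k => k.rec R R') (fun k => by cases k <;> assumption)
    fun _ _ hk hu => hu.imp (hk false).1 (hk true).1

theorem Defin.and {e : 𝒱 → RVal P α} {R R' : 𝒱 → Prop} (h : Defin e R) (h' : Defin e R') :
    Defin e fun u => R u ∧ R' u :=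
  Defin.determined (κ := Bool) (F := fun k => k.rec R R') (fun k => by cases k <;> assumption)
    fun _ _ hk hu => hu.imp (hk false).1 (hk true).1

theorem Defin.imp {e : 𝒱 → RVal P α} {R R' : 𝒱 → Prop} (h : Defin e R) (h' : Defin e R') :
    Defin e fun u => R u → R' u :=
  (h.not.or h').congr fun _ => imp_iff_not_or.symm

/-- Definability without restrictions on the sorts of the variables. -/
abbrev RawDefin (R : RVal P α → Prop) : Prop := Defin (fun u : RVal P α => u) R

theorem RawDefin.relabel {R : RVal P α → Prop} (h : RawDefin R) (g : α → β) :
    RawDefin fun u : RVal P β => R ⟨u.X, u.v ∘ g⟩ := by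
  obtain ⟨φ, hφ⟩ := h
  refine ⟨Formula.relabel g φ, fun u => Iff.trans ?_ (hφ ⟨u.X, u.v ∘ g⟩)⟩
  let _ := tdb u.X.D u.X.sub
  exact Formula.realize_relabel

theorem RawDefin.exs [Finite κ] {R : RVal P (α ⊕ κ) → Prop} (h : RawDefin R) :
    RawDefin fun u : RVal P α => ∃ w : κ → TDBDom u.X.D, R ⟨u.X, Sum.elim u.v w⟩ := by
  obtain ⟨φ, hφ⟩ := h
  refine ⟨φ.iExs κ, fun u => ?_⟩
  let _ := tdb u.X.D u.X.sub
  rw [RVal.Sat, Formula.realize_iExs]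
  exact exists_congr fun w => hφ ⟨u.X, Sum.elim u.v w⟩

theorem RawDefin.conc (B : Basic NC NR) (x t : α) :
    RawDefin fun u : RVal P α => (u.v t).Holds fun A =>
      ∃ a : u.X.D.inds, u.v x = .inl a ∧ Assertion.conc B a.1 ∈ A :=
  ⟨Relations.formula (L := tdbLang NC NR P.Φ.inds) (TDBRel.conc B) ![.var x, .var t],
    fun _ => Iff.rfl⟩

theorem RawDefin.nconc (B : Basic NC NR) (x t : α) :
    RawDefin fun u : RVal P α => (u.v t).Holds fun A =>
      ∃ a : u.X.D.inds, u.v x = .inl a ∧ Assertion.nconc B a.1 ∈ A :=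
  ⟨Relations.formula (L := tdbLang NC NR P.Φ.inds) (TDBRel.nconc B) ![.var x, .var t],
    fun _ => Iff.rfl⟩

theorem RawDefin.role (R : Role NR) (x y t : α) :
    RawDefin fun u : RVal P α => (u.v t).Holds fun A =>
      ∃ a b : u.X.D.inds, u.v x = .inl a ∧ u.v y = .inl b ∧ Assertion.role R a.1 b.1 ∈ A :=
  ⟨Relations.formula (L := tdbLang NC NR P.Φ.inds) (TDBRel.role R) ![.var x, .var y, .var t],
    fun _ => Iff.rfl⟩

theorem RawDefin.nrole (R : Role NR) (x y t : α) :
    RawDefin fun u : RVal P α => (u.v t).Holds fun A =>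
      ∃ a b : u.X.D.inds, u.v x = .inl a ∧ u.v y = .inl b ∧ Assertion.nrole R a.1 b.1 ∈ A :=
  ⟨Relations.formula (L := tdbLang NC NR P.Φ.inds) (TDBRel.nrole R) ![.var x, .var y, .var t],
    fun _ => Iff.rfl⟩

theorem RawDefin.eq (x y : α) : RawDefin fun u : RVal P α => u.v x = u.v y := by
  refine ⟨Term.equal (.var x) (.var y), fun u => ?_⟩
  let _ := tdb u.X.D u.X.sub
  exact Formula.realize_equal

theorem RawDefin.eq_const (x : α) (c : P.Φ.inds) :
    RawDefin fun u : RVal P α => u.v x = .inl ⟨c, u.X.sub c.2⟩ := by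
  refine ⟨Term.equal (.var x)
    (.func (L := tdbLang NC NR P.Φ.inds) (l := 0) c Fin.elim0), fun u => ?_⟩
  let _ := tdb u.X.D u.X.sub
  exact Formula.realize_equal

/-- The individuals are the elements that occur in assertions. -/
theorem RawDefin.isInd (x : α) : RawDefin fun u : RVal P α => ∃ a, u.v x = .inl a := by
  -- Of the auxiliary variables, `false` is the time point and `true` the other individual of a role
  -- assertion. Finitely many relation symbols suffice because the ABoxes are over the signature of
  -- the ontology.
  have hx := ((Defin.exists_finite fun B : P.O.SigBasic =>
        RawDefin.conc (P := P) (α := α ⊕ Bool) B.1 (.inl x) (.inr false)).or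
      (Defin.exists_finite fun B : P.O.SigBasic =>
        RawDefin.nconc (P := P) (α := α ⊕ Bool) B.1 (.inl x) (.inr false))).or
    (((Defin.exists_finite fun R : P.O.SigRole =>
        RawDefin.role (P := P) (α := α ⊕ Bool) R.1 (.inl x) (.inr true) (.inr false)).or
      (Defin.exists_finite fun R : P.O.SigRole =>
        RawDefin.nrole (P := P) (α := α ⊕ Bool) R.1 (.inl x) (.inr true) (.inr false))).or
    ((Defin.exists_finite fun R : P.O.SigRole =>
        RawDefin.role (P := P) (α := α ⊕ Bool) R.1 (.inr true) (.inl x) (.inr false)).or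
      (Defin.exists_finite fun R : P.O.SigRole =>
        RawDefin.nrole (P := P) (α := α ⊕ Bool) R.1 (.inr true) (.inl x) (.inr false))))
  refine (RawDefin.exs hx).congr fun u => ⟨?_, ?_⟩
  · rintro ⟨w, (⟨B, p, -, a, h, -⟩ | ⟨B, p, -, a, h, -⟩) |
      (⟨R, p, -, a, b, h, -, -⟩ | ⟨R, p, -, a, b, h, -, -⟩) |
      (⟨R, p, -, a, b, -, h, -⟩ | ⟨R, p, -, a, b, -, h, -⟩)⟩ <;> exact ⟨_, h⟩
  · rintro ⟨⟨a, i, γ, hγ, ha⟩, hx⟩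
    have hs := u.X.sig i γ hγ
    have ho : ∀ b ∈ γ.inds, b ∈ u.X.D.inds := fun b hb => ⟨i, γ, hγ, hb⟩
    let w : TDBDom u.X.D → Bool → TDBDom u.X.D := fun b k => k.rec (.inr i) b
    rcases γ with ⟨B, b⟩ | ⟨B, b⟩ | ⟨R, b, c⟩ | ⟨R, b, c⟩
    · obtain rfl : a = b := ha
      exact ⟨w (u.v x), .inl (.inl ⟨⟨B, hs⟩, i, rfl, _, hx, hγ⟩)⟩
    · obtain rfl : a = b := ha
      exact ⟨w (u.v x), .inl (.inr ⟨⟨B, hs⟩, i, rfl, _, hx, hγ⟩)⟩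
    · obtain rfl | rfl : a = b ∨ a = c := ha
      · exact ⟨w (.inl ⟨c, ho c (.inr rfl)⟩),
          .inr (.inl (.inl ⟨⟨R, hs⟩, i, rfl, _, _, hx, rfl, hγ⟩))⟩
      · exact ⟨w (.inl ⟨b, ho b (.inl rfl)⟩),
          .inr (.inr (.inl ⟨⟨R, hs⟩, i, rfl, _, _, rfl, hx, hγ⟩))⟩
    · obtain rfl | rfl : a = b ∨ a = c := ha
      · exact ⟨w (.inl ⟨c, ho c (.inr rfl)⟩),
          .inr (.inl (.inr ⟨⟨R, hs⟩, i, rfl, _, _, hx, rfl, hγ⟩))⟩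
      · exact ⟨w (.inl ⟨b, ho b (.inl rfl)⟩),
          .inr (.inr (.inr ⟨⟨R, hs⟩, i, rfl, _, _, rfl, hx, hγ⟩))⟩

/-- A temporal database with a time point and individuals for the variables in `ι`. -/
structure Val (P : Spec NI NC NR NV) (ι : Type) where
  X : Inst P
  t : X.Time
  b : ι → X.D.inds

/-- The assignment with one additional variable for the time point. -/
def Val.raw (v : Val P ι) : RVal P (ι ⊕ Unit) :=
  ⟨v.X, Sum.elim (fun i => .inl (v.b i)) fun _ => .inr v.t⟩

/-- Uniform first-order definability of properties of individuals and a time point. -/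
abbrev FO (R : Val P ι → Prop) : Prop := Defin Val.raw R

theorem FO.of_raw {R : RVal P (ι ⊕ Unit) → Prop} (h : RawDefin R) :
    FO fun v : Val P ι => R v.raw :=
  let ⟨φ, hφ⟩ := h
  ⟨φ, fun v => hφ v.raw⟩

theorem FO.relabel {R : Val P ι → Prop} (h : FO R) (f : ι → κ) :
    FO fun v : Val P κ => R ⟨v.X, v.t, v.b ∘ f⟩ := by
  obtain ⟨φ, hφ⟩ := h
  refine (FO.of_raw (RawDefin.relabel (R := fun u => u.Sat φ) ⟨φ, fun u => Iff.rfl⟩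
    (Sum.map f id))).congr fun v => Iff.trans ?_ (hφ ⟨v.X, v.t, v.b ∘ f⟩)
  refine iff_of_eq (congrArg (fun w => RVal.Sat ⟨v.X, w⟩ φ) (funext ?_))
  rintro (i | i) <;> rfl

/-- The language has no sorts; the quantifier is relativized to the elements that are not
individuals. -/
theorem FO.exists_time {R : Val P ι → Prop} (h : FO R) :
    FO fun v : Val P ι => ∃ t, R ⟨v.X, t, v.b⟩ := by
  obtain ⟨φ, hφ⟩ := h
  have h₁ := (RawDefin.isInd (P := P) (α := (ι ⊕ Unit) ⊕ Unit) (.inr ())).not.and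
    (RawDefin.relabel (R := fun u => u.Sat φ) ⟨φ, fun u => Iff.rfl⟩
      (Sum.elim (fun i => .inl (.inl i)) fun _ => .inr ()))
  refine (FO.of_raw (RawDefin.exs h₁)).congr fun v => ?_
  have key : ∀ t : v.X.Time, RVal.Sat ⟨v.X, (Sum.elim v.raw.v fun _ : Unit => .inr t) ∘
      Sum.elim (fun i => .inl (.inl i)) fun _ => .inr ()⟩ φ ↔ R ⟨v.X, t, v.b⟩ := by
    intro t
    refine Iff.trans (iff_of_eq (congrArg (fun w => RVal.Sat ⟨v.X, w⟩ φ) (funext ?_)))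
      (hφ ⟨v.X, t, v.b⟩)
    rintro (i | i) <;> rfl
  constructor
  · rintro ⟨w, hn, hw⟩
    cases hx : w () with
    | inl a => exact absurd ⟨a, hx⟩ hn
    | inr t =>
      obtain rfl : w = fun _ => .inr t := funext fun _ => hx
      exact ⟨t, (key t).1 hw⟩
  · rintro ⟨t, ht⟩
    exact ⟨fun _ => .inr t, fun ⟨_, h⟩ => Sum.inr_ne_inl h, (key t).2 ht⟩

theorem FO.exists_inds [Finite κ] {R : Val P (ι ⊕ κ) → Prop} (h : FO R) :
    FO fun v : Val P ι => ∃ c : κ → v.X.D.inds, R ⟨v.X, v.t, Sum.elim v.b c⟩ := by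
  obtain ⟨φ, hφ⟩ := h
  let g : (ι ⊕ κ) ⊕ Unit → (ι ⊕ Unit) ⊕ κ :=
    Sum.elim (Sum.elim (fun i => .inl (.inl i)) .inr) fun _ => .inl (.inr ())
  have h₁ := (Defin.forall_finite fun k : κ =>
    RawDefin.isInd (P := P) (α := (ι ⊕ Unit) ⊕ κ) (.inr k)).and
    (RawDefin.relabel (R := fun u => u.Sat φ) ⟨φ, fun u => Iff.rfl⟩ g)
  refine (FO.of_raw (RawDefin.exs h₁)).congr fun v => ?_
  have key : ∀ c : κ → v.X.D.inds, RVal.Sat ⟨v.X, (Sum.elim v.raw.v fun k => .inl (c k)) ∘ g⟩ φ ↔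
      R ⟨v.X, v.t, Sum.elim v.b c⟩ := by
    intro c
    refine Iff.trans (iff_of_eq (congrArg (fun w => RVal.Sat ⟨v.X, w⟩ φ) (funext ?_)))
      (hφ ⟨v.X, v.t, Sum.elim v.b c⟩)
    rintro ((i | i) | i) <;> rfl
  constructor
  · rintro ⟨w, hi, hw⟩
    choose c hc using hi
    rw [show w = fun k => .inl (c k) from funext hc] at hw
    exact ⟨c, (key c).1 hw⟩
  · rintro ⟨c, hc⟩
    exact ⟨fun k => .inl (c k), fun k => ⟨c k, rfl⟩, (key c).2 hc⟩

theorem FO.forall_inds [Finite κ] {R : Val P (ι ⊕ κ) → Prop} (h : FO R) :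
    FO fun v : Val P ι => ∀ c : κ → v.X.D.inds, R ⟨v.X, v.t, Sum.elim v.b c⟩ :=
  (FO.exists_inds h.not).not.congr fun _ => by simp

theorem FO.eq (i j : ι) : FO fun v : Val P ι => v.b i = v.b j :=
  (FO.of_raw (RawDefin.eq (.inl i) (.inl j))).congr fun v => by simp [Val.raw]

theorem FO.eq_const (i : ι) (c : P.Φ.inds) : FO fun v : Val P ι => (v.b i : NI) = c :=
  (FO.of_raw (RawDefin.eq_const (.inl i) c)).congr fun v => by simp [Val.raw, Subtype.ext_iff]

/-! ### Definability of the ABox at a time point -/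

theorem ABoxSeq.conc_mem_extBot {D : ABoxSeq NI NC NR} {B : Basic NC NR} {a : NI}
    {t : WithBot (Fin (D.n + 1))} :
    (.conc B (.ind a) : XAssertion NI NC NR NV) ∈ D.extBot t ↔
      ∃ p : Fin (D.n + 1), t = p ∧ .conc B a ∈ D.abox p := by
  refine exists_congr fun p => and_congr_right fun _ => ⟨?_, fun h => ⟨_, h, rfl⟩⟩
  rintro ⟨β, hβ, h⟩
  cases β <;> cases h
  exact hβ

theorem ABoxSeq.nconc_mem_extBot {D : ABoxSeq NI NC NR} {B : Basic NC NR} {a : NI}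
    {t : WithBot (Fin (D.n + 1))} :
    (.nconc B (.ind a) : XAssertion NI NC NR NV) ∈ D.extBot t ↔
      ∃ p : Fin (D.n + 1), t = p ∧ .nconc B a ∈ D.abox p := by
  refine exists_congr fun p => and_congr_right fun _ => ⟨?_, fun h => ⟨_, h, rfl⟩⟩
  rintro ⟨β, hβ, h⟩
  cases β <;> cases h
  exact hβ

theorem ABoxSeq.role_mem_extBot {D : ABoxSeq NI NC NR} {R : Role NR} {a b : NI}
    {t : WithBot (Fin (D.n + 1))} :
    (.role R (.ind a) (.ind b) : XAssertion NI NC NR NV) ∈ D.extBot t ↔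
      ∃ p : Fin (D.n + 1), t = p ∧ .role R a b ∈ D.abox p := by
  refine exists_congr fun p => and_congr_right fun _ => ⟨?_, fun h => ⟨_, h, rfl⟩⟩
  rintro ⟨β, hβ, h⟩
  cases β <;> cases h
  exact hβ

theorem ABoxSeq.nrole_mem_extBot {D : ABoxSeq NI NC NR} {R : Role NR} {a b : NI}
    {t : WithBot (Fin (D.n + 1))} :
    (.nrole R (.ind a) (.ind b) : XAssertion NI NC NR NV) ∈ D.extBot t ↔
      ∃ p : Fin (D.n + 1), t = p ∧ .nrole R a b ∈ D.abox p := by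
  refine exists_congr fun p => and_congr_right fun _ => ⟨?_, fun h => ⟨_, h, rfl⟩⟩
  rintro ⟨β, hβ, h⟩
  cases β <;> cases h
  exact hβ

theorem FO.conc_ext (B : Basic NC NR) (i : ι) : FO fun v : Val P ι =>
    (.conc B (.ind (v.b i)) : XAssertion NI NC NR NV) ∈ v.X.D.extBot v.t :=
  (FO.of_raw (RawDefin.conc B (.inl i) (.inr ()))).congr fun v => by
    rw [ABoxSeq.conc_mem_extBot]
    simp [Val.raw, TDBDom.Holds, Subtype.ext_iff]

theorem FO.nconc_ext (B : Basic NC NR) (i : ι) : FO fun v : Val P ι =>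
    (.nconc B (.ind (v.b i)) : XAssertion NI NC NR NV) ∈ v.X.D.extBot v.t :=
  (FO.of_raw (RawDefin.nconc B (.inl i) (.inr ()))).congr fun v => by
    rw [ABoxSeq.nconc_mem_extBot]
    simp [Val.raw, TDBDom.Holds, Subtype.ext_iff]

theorem FO.role_ext (R : Role NR) (i j : ι) : FO fun v : Val P ι =>
    (.role R (.ind (v.b i)) (.ind (v.b j)) : XAssertion NI NC NR NV) ∈ v.X.D.extBot v.t :=
  (FO.of_raw (RawDefin.role R (.inl i) (.inl j) (.inr ()))).congr fun v => by
    rw [ABoxSeq.role_mem_extBot]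
    simp [Val.raw, TDBDom.Holds, Subtype.ext_iff]

theorem FO.nrole_ext (R : Role NR) (i j : ι) : FO fun v : Val P ι =>
    (.nrole R (.ind (v.b i)) (.ind (v.b j)) : XAssertion NI NC NR NV) ∈ v.X.D.extBot v.t :=
  (FO.of_raw (RawDefin.nrole R (.inl i) (.inl j) (.inr ()))).congr fun v => by
    rw [ABoxSeq.nrole_mem_extBot]
    simp [Val.raw, TDBDom.Holds, Subtype.ext_iff]

end Definability

end TDL

namespace TDL

/-! ## Families of knowledge bases and first-order rewritability -/

section Families

variable {NI NC NR NV : Type} {P : Spec NI NC NR NV} {ι κ : Type}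

/-- A relation between assignments that holds if finitely many definable properties agree. -/
def FinDet (E : Val P ι → Val P ι → Prop) : Prop :=
  ∃ (κ : Type) (_ : Finite κ) (F : κ → Val P ι → Prop), (∀ k, FO (F k)) ∧
    ∀ v v', (∀ k, F k v ↔ F k v') → E v v'

/-- This reduces writing formulas to proving invariance; all later definability proofs for canonical
models have this shape. -/
theorem FinDet.fo {E : Val P ι → Val P ι → Prop} (hE : FinDet E) {R : Val P ι → Prop}
    (h : ∀ v v', E v v' → R v → R v') : FO R :=
  let ⟨_, _, _, hF, hE⟩ := hE
  Defin.determined hF fun v v' hk => h v v' (hE v v' hk)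

theorem FinDet.of_fo {R : Val P ι → Prop} (h : FO R) : FinDet fun v v' : Val P ι => R v ↔ R v' :=
  ⟨Unit, inferInstance, fun _ => R, fun _ => h, fun _ _ hk => hk ()⟩

theorem FinDet.forall_finite [Finite κ] {E : κ → Val P ι → Val P ι → Prop}
    (h : ∀ k, FinDet (E k)) : FinDet fun v v' => ∀ k, E k v v' := by
  choose κ' hκ' F hF hE using h
  exact ⟨Σ k, κ' k, inferInstance, fun k => F k.1 k.2, fun k => hF k.1 k.2,
    fun v v' hk k => hE k v v' fun l => hk ⟨k, l⟩⟩

theorem FinDet.and {E E' : Val P ι → Val P ι → Prop} (h : FinDet E) (h' : FinDet E') :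
    FinDet fun v v' => E v v' ∧ E' v v' := by
  obtain ⟨κ, _, F, hF, hE⟩ := FinDet.forall_finite (κ := Bool)
    (E := fun k => k.rec E E') (fun k => by cases k <;> assumption)
  exact ⟨κ, inferInstance, F, hF, fun v v' hk => ⟨hE v v' hk false, hE v v' hk true⟩⟩

theorem FinDet.forall_of_support {S : Set κ} (hS : S.Finite) {R : κ → Val P ι → Prop}
    (h : ∀ k, FO (R k)) (hR : ∀ k v, R k v → k ∈ S) :
    FinDet fun v v' : Val P ι => ∀ k, R k v ↔ R k v' := by
  have := hS.to_subtype
  obtain ⟨κ, _, F, hF, hE⟩ := FinDet.forall_finite fun k : S => FinDet.of_fo (h k)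
  refine ⟨κ, inferInstance, F, hF, fun v v' hk k => ?_⟩
  exact ⟨fun h => (hE v v' hk ⟨k, hR k v h⟩).1 h, fun h => (hE v v' hk ⟨k, hR k v' h⟩).2 h⟩

/-- A family of ABoxes: definable assertions about the individuals of the data, fixed assertions
about individuals of `Φ` and names `a_x`, and tree ABoxes. -/
structure Fam (P : Spec NI NC NR NV) where
  ground : ∀ X : Inst P, X.Time → Set (XAssertion NI NC NR NV)
  fixed : Set (XAssertion NI NC NR NV)
  flex : Inst P → Set (Role NR × (NI ⊕ NV))
  ground_inds : ∀ {X t α}, α ∈ ground X t → α.inds ⊆ Spec.kbInds X.D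
  ground_over : ∀ {X t α}, α ∈ ground X t → α.Over P.O.concNames P.O.roleNames
  fixed_pos : ∀ {α}, α ∈ fixed → α.IsPos
  fixed_names : ∀ {α}, α ∈ fixed → ∀ e ∈ α.inds, (∃ a ∈ P.Φ.inds, e = .ind a) ∨ ∃ x, e = .aux x
  flex_ind : ∀ {X S a}, (S, .inl a) ∈ flex X → S ∈ P.flexRoles ∧ a ∈ X.D.inds
  flex_aux : ∀ {X S x}, (S, .inr x) ∈ flex X → ∀ X', (S, .inr x) ∈ flex X'
  fo_conc : ∀ B, FO fun v : Val P Unit => .conc B (.ind (v.b ())) ∈ ground v.X v.t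
  fo_nconc : ∀ B, FO fun v : Val P Unit => .nconc B (.ind (v.b ())) ∈ ground v.X v.t
  fo_role : ∀ R, FO fun v : Val P Bool =>
    .role R (.ind (v.b false)) (.ind (v.b true)) ∈ ground v.X v.t
  fo_nrole : ∀ R, FO fun v : Val P Bool =>
    .nrole R (.ind (v.b false)) (.ind (v.b true)) ∈ ground v.X v.t
  fo_flex : ∀ S, FO fun v : Val P Unit => (S, .inl (v.b () : NI)) ∈ flex v.X

namespace Fam

variable (K : Fam P)

/-- The ABoxes of the family. -/
def kb (X : Inst P) (t : X.Time) : Set (XAssertion NI NC NR NV) :=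
  K.ground X t ∪ K.fixed ∪ P.flexABox (K.flex X)

theorem fo_role' (R : Role NR) (i j : ι) : FO fun v : Val P ι =>
    .role R (.ind (v.b i)) (.ind (v.b j)) ∈ K.ground v.X v.t :=
  FO.relabel (K.fo_role R) fun k => cond k j i

theorem fo_nrole' (R : Role NR) (i j : ι) : FO fun v : Val P ι =>
    .nrole R (.ind (v.b i)) (.ind (v.b j)) ∈ K.ground v.X v.t :=
  FO.relabel (K.fo_nrole R) fun k => cond k j i

theorem fo_asserted (B : Basic NC NR) (i : ι) : FO fun v : Val P ι =>
    B ∈ asserted (K.ground v.X v.t) (.ind (v.b i)) := by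
  have h := FO.relabel (K.fo_conc B) fun _ => i
  cases B with
  | atom A =>
    refine h.congr fun v => ⟨.inl, ?_⟩
    rintro (h | ⟨_, _, h, _⟩)
    · exact h
    · cases h
  | ex R =>
    refine (h.or (FO.exists_inds (κ := Unit) ((K.fo_role' R (.inl i) (.inr ())).or
      (K.fo_role' R.flip (.inr ()) (.inl i))))).congr fun v => or_congr_right ?_
    constructor
    · rintro ⟨c, h⟩
      exact ⟨R, _, rfl, h⟩
    · rintro ⟨_, e, h', h⟩
      cases h'
      obtain ⟨a, ha, rfl⟩ : e ∈ Spec.kbInds v.X.D :=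
        h.elim (fun h => K.ground_inds h (.inr rfl)) fun h => K.ground_inds h (.inl rfl)
      exact ⟨fun _ => ⟨a, ha⟩, h⟩

/-- The two assignments have the same local properties. -/
structure Agree (v v' : Val P ι) : Prop where
  asserted : ∀ i B, B ∈ asserted (K.ground v.X v.t) (.ind (v.b i)) ↔
    B ∈ TDL.asserted (K.ground v'.X v'.t) (.ind (v'.b i))
  nconc : ∀ i B, .nconc B (.ind (v.b i)) ∈ K.ground v.X v.t ↔
    .nconc B (.ind (v'.b i)) ∈ K.ground v'.X v'.t
  flex : ∀ i S, (S, .inl (v.b i : NI)) ∈ K.flex v.X ↔ (S, .inl (v'.b i : NI)) ∈ K.flex v'.X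
  const : ∀ i (c : P.Φ.inds), (v.b i : NI) = c ↔ (v'.b i : NI) = c
  role : ∀ i j R, .role R (.ind (v.b i)) (.ind (v.b j)) ∈ K.ground v.X v.t ↔
    .role R (.ind (v'.b i)) (.ind (v'.b j)) ∈ K.ground v'.X v'.t
  nrole : ∀ i j R, .nrole R (.ind (v.b i)) (.ind (v.b j)) ∈ K.ground v.X v.t ↔
    .nrole R (.ind (v'.b i)) (.ind (v'.b j)) ∈ K.ground v'.X v'.t
  eq : ∀ i j, v.b i = v.b j ↔ v'.b i = v'.b j

variable {K}

theorem Agree.symm {v v' : Val P ι} (h : K.Agree v v') : K.Agree v' v :=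
  ⟨fun i B => (h.asserted i B).symm, fun i B => (h.nconc i B).symm, fun i S => (h.flex i S).symm,
    fun i c => (h.const i c).symm, fun i j R => (h.role i j R).symm,
    fun i j R => (h.nrole i j R).symm, fun i j => (h.eq i j).symm⟩

variable (K) in
-- `Agree` quantifies over all concepts and roles, but the compared facts can hold only for the
-- finitely many over the ontology; the individuals of `Φ` are finitely many as well.
theorem finDet_agree [Finite ι] : FinDet (K.Agree (ι := ι)) := by
  have hB := finite_basics_over P.O.finite_concNames P.O.finite_roleNames
  have hR := finite_roles_over P.O.finite_roleNames
  have := P.Φ.finite_inds.to_subtype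
  have h₁ := FinDet.forall_finite fun i : ι => FinDet.forall_of_support hB
    (fun B => K.fo_asserted B i) fun B v h => by
      obtain ⟨α, hα, hB⟩ := mem_asserted_singleton h
      have hα := K.ground_over hα
      rcases hB with rfl | ⟨R, b, rfl, rfl | rfl⟩
      · exact hα
      · exact hα
      · simpa [Assertion.Over, Basic.Over] using hα
  have h₂ := FinDet.forall_finite fun i : ι => FinDet.forall_of_support hB
    (fun B => FO.relabel (K.fo_nconc B) fun _ => i) fun B v h => K.ground_over h
  have h₃ := FinDet.forall_finite fun i : ι => FinDet.forall_of_support hR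
    (fun S => FO.relabel (K.fo_flex S) fun _ => i) fun S v h => (K.flex_ind h).1.1
  have h₄ := FinDet.forall_finite fun i : ι => FinDet.forall_finite fun c : P.Φ.inds =>
    FinDet.of_fo (FO.eq_const (P := P) i c)
  have h₅ := FinDet.forall_finite fun i : ι => FinDet.forall_finite fun j : ι =>
    FinDet.forall_of_support hR (fun R => K.fo_role' R i j) fun R v h => K.ground_over h
  have h₆ := FinDet.forall_finite fun i : ι => FinDet.forall_finite fun j : ι =>
    FinDet.forall_of_support hR (fun R => K.fo_nrole' R i j) fun R v h => K.ground_over h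
  have h₇ := FinDet.forall_finite fun i : ι => FinDet.forall_finite fun j : ι =>
    FinDet.of_fo (FO.eq (P := P) i j)
  obtain ⟨κ, hκ, F, hF, hE⟩ := h₁.and (h₂.and (h₃.and (h₄.and (h₅.and (h₆.and h₇)))))
  refine ⟨κ, hκ, F, hF, fun v v' hk => ?_⟩
  obtain ⟨h₁, h₂, h₃, h₄, h₅, h₆, h₇⟩ := hE v v' hk
  exact ⟨h₁, h₂, h₃, h₄, h₅, h₆, h₇⟩

/-- The paths of a tree ABox depend on `S` only, so its copies at different roots are isomorphic. -/
theorem asserted_treeABox_rebase {S : Role NR} {b : NI ⊕ NV} {e : XName NI NR NV}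
    {B : Basic NC NR} (h : B ∈ asserted (P.treeABox S b) e) (b' : NI ⊕ NV) :
    B ∈ asserted (P.treeABox S b') (e.rebase b') := by
  rcases h with h | ⟨R, e', rfl, h | h⟩
  · exact .inl (Spec.treeABox_rebase h b')
  · exact .inr ⟨R, _, rfl, .inl (Spec.treeABox_rebase h b')⟩
  · exact .inr ⟨R, _, rfl, .inr (Spec.treeABox_rebase h b')⟩

theorem base_of_mem_asserted_treeABox {S : Role NR} {b : NI ⊕ NV} {e : XName NI NR NV}
    {B : Basic NC NR} (h : B ∈ asserted (P.treeABox S b) e) : e.base = b := by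
  rcases h with h | ⟨R, e', rfl, h | h⟩
  · exact Spec.base_of_mem_treeABox_conc h
  · exact (Spec.base_of_mem_treeABox_role h).1
  · exact (Spec.base_of_mem_treeABox_role h).2

/-- The elements that take the same place as given elements in the canonical model for another
assignment. -/
inductive Corr (v v' : Val P ι) : Option (XName NI NR NV) → Option (XName NI NR NV) → Prop
  | ind (i : ι) (e) : e.base = .inl (v.b i) → Corr v v' (some e) (some (e.rebase (.inl (v'.b i))))
  | aux (e x) : e.base = .inr x → Corr v v' (some e) (some e)
  | none : Corr v v' none none
  | other (e a) : e.base = .inl a → a ∉ v.X.D.inds → Corr v v' (some e) Option.none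

theorem mem_kb_asserted {X : Inst P} {t : X.Time} {e : XName NI NR NV} {B : Basic NC NR}
    (h : B ∈ asserted (K.kb X t) e) :
    (∃ a ∈ X.D.inds, e = .ind a ∧ B ∈ asserted (K.ground X t) e) ∨
    (((∃ a ∈ P.Φ.inds, e = .ind a) ∨ ∃ x, e = .aux x) ∧ B ∈ asserted K.fixed e) ∨
    ∃ S, (S, e.base) ∈ K.flex X ∧ B ∈ asserted (P.treeABox S e.base) e := by
  rw [kb, asserted_union, asserted_union] at h
  rcases h with (h | h) | h
  · obtain ⟨α, hα, hB⟩ := mem_asserted_singleton h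
    obtain ⟨a, ha, rfl⟩ := K.ground_inds hα (mem_inds_of_mem_asserted hB)
    exact .inl ⟨a, ha, rfl, h⟩
  · obtain ⟨α, hα, hB⟩ := mem_asserted_singleton h
    exact .inr (.inl ⟨K.fixed_names hα e (mem_inds_of_mem_asserted hB), h⟩)
  · obtain ⟨⟨S, b⟩, hf, h⟩ := mem_asserted_flexABox.1 h
    obtain rfl := base_of_mem_asserted_treeABox h
    exact .inr (.inr ⟨S, hf, h⟩)

theorem asserted_ground_sub (X : Inst P) (t : X.Time) (e : XName NI NR NV) :
    asserted (K.ground X t) e ⊆ asserted (K.kb X t) e :=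
  asserted_mono fun _ h _ => .inl (.inl h)

theorem asserted_fixed_sub (X : Inst P) (t : X.Time) (e : XName NI NR NV) :
    asserted K.fixed e ⊆ asserted (K.kb X t) e :=
  asserted_mono fun _ h _ => .inl (.inr h)

theorem asserted_tree_sub {X : Inst P} (t : X.Time) (e : XName NI NR NV) {S : Role NR} {b : NI ⊕ NV}
    (h : (S, b) ∈ K.flex X) : asserted (P.treeABox S b) e ⊆ asserted (K.kb X t) e :=
  asserted_mono fun _ h' _ => .inr ⟨_, h, h'⟩

/-- Nothing is stated about names over individuals outside the data, so these may correspond to the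
root `none`. For the others, each source of assertions (data, fixed part, trees) is preserved by
`Agree`. -/
theorem Corr.asserted {v v' : Val P ι} (hA : K.Agree v v') {o o' : Option (XName NI NR NV)}
    (h : Corr v v' o o') :
    o.elim ∅ (asserted (K.kb v.X v.t)) ⊆ o'.elim ∅ (TDL.asserted (K.kb v'.X v'.t)) := by
  intro B hB
  cases h with
  | ind i e he =>
    rcases mem_kb_asserted hB with ⟨a, ha, rfl, h⟩ | ⟨⟨a, ha, rfl⟩ | ⟨x, rfl⟩, h⟩ | ⟨S, hS, h⟩
    · obtain rfl := Sum.inl.inj he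
      exact asserted_ground_sub _ _ _ ((hA.asserted i B).1 h)
    · obtain rfl : a = _ := Sum.inl.inj he
      have := (hA.const i ⟨_, ha⟩).1 rfl
      simp only at this
      simp only [XName.rebase, this]
      exact asserted_fixed_sub _ _ _ h
    · cases he
    · rw [he] at hS h
      exact asserted_tree_sub _ _ ((hA.flex i S).1 hS) (asserted_treeABox_rebase h _)
  | aux e x he =>
    rcases mem_kb_asserted hB with ⟨a, ha, rfl, h⟩ | ⟨-, h⟩ | ⟨S, hS, h⟩
    · cases he
    · exact asserted_fixed_sub _ _ _ h
    · rw [he] at hS h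
      exact asserted_tree_sub _ _ (K.flex_aux hS _) h
  | none => exact hB
  | other e a he ha =>
    refine absurd ?_ ha
    rcases mem_kb_asserted hB with ⟨a', ha', rfl, h⟩ | ⟨⟨a', ha', rfl⟩ | ⟨x, rfl⟩, h⟩ | ⟨S, hS, h⟩
    · exact Sum.inl.inj he ▸ ha'
    · exact Sum.inl.inj he ▸ v.X.sub ha'
    · cases he
    · rw [he] at hS
      exact (K.flex_ind hS).2

theorem Corr.eq_self {v v' : Val P ι} (hA : K.Agree v v') {e : XName NI NR NV}
    {o : Option (XName NI NR NV)} (h : Corr v v' (some e) o)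
    (he : (∃ a ∈ P.Φ.inds, e = .ind a) ∨ ∃ x, e = .aux x) : o = some e := by
  cases h with
  | ind i e h =>
    rcases he with ⟨a, ha, rfl⟩ | ⟨x, rfl⟩
    · have := (hA.const i ⟨a, ha⟩).1 (Sum.inl.inj h).symm
      simp only at this
      simp [XName.rebase, XName.root, this]
    · cases h
  | aux => rfl
  | other e a h hn =>
    rcases he with ⟨a, ha, rfl⟩ | ⟨x, rfl⟩
    · obtain rfl := Sum.inl.inj h
      exact absurd (v.X.sub ha) hn
    · cases h

/-- Needed for tree edges of the canonical model: both ends have the same root, so their images must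
too, even if the tuple lists an individual twice. -/
theorem Corr.unique {v v' : Val P ι} (hA : K.Agree v v') {o o₁ o₂ : Option (XName NI NR NV)}
    (h₁ : Corr v v' o o₁) (h₂ : Corr v v' o o₂) : o₁ = o₂ := by
  cases h₁ with
  | ind i e he =>
    cases h₂ with
    | ind j _ he' =>
      have := (hA.eq i j).1 (Subtype.ext (Sum.inl.inj (he.symm.trans he')))
      rw [this]
    | aux _ x he' => cases he.symm.trans he'
    | other _ a he' ha =>
      exact absurd (Sum.inl.inj (he.symm.trans he') ▸ (v.b i).2) ha
  | aux e x he =>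
    cases h₂ with
    | ind j _ he' => cases he.symm.trans he'
    | aux _ x he' => rfl
    | other _ a he' ha => cases he.symm.trans he'
  | none => cases h₂; rfl
  | other e a he ha =>
    cases h₂ with
    | ind j _ he' => exact absurd (Sum.inl.inj (he'.symm.trans he) ▸ (v.b j).2) ha
    | aux _ x he' => cases he.symm.trans he'
    | other _ a he' ha => rfl

/-- Fixed assertions are about names that `Corr` does not move; both ends of a tree assertion lie
over one root and are rebased together. -/
theorem Corr.role_mem {v v' : Val P ι} (hA : K.Agree v v') {e₁ e₂ : XName NI NR NV}
    {o₁ o₂ : Option (XName NI NR NV)} (h₁ : Corr v v' (some e₁) o₁) (h₂ : Corr v v' (some e₂) o₂)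
    {R : Role NR} (hR : .role R e₁ e₂ ∈ K.kb v.X v.t) :
    ∃ e₁' e₂', o₁ = some e₁' ∧ o₂ = some e₂' ∧ .role R e₁' e₂' ∈ K.kb v'.X v'.t := by
  have hind : ∀ {e : XName NI NR NV} {o a}, Corr v v' (some e) o → a ∈ v.X.D.inds →
      e.base = .inl a → ∃ i, a = v.b i ∧ o = some (e.rebase (.inl (v'.b i : NI))) := by
    intro e o a h ha he
    cases h with
    | ind i e h => exact ⟨i, Sum.inl.inj (he.symm.trans h), rfl⟩
    | aux _ x h => cases he.symm.trans h
    | other _ a' h hn => exact absurd (Sum.inl.inj (he.symm.trans h) ▸ ha) hn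
  have haux : ∀ {e : XName NI NR NV} {o x}, Corr v v' (some e) o → e.base = .inr x →
      o = some e := by
    intro e o x h he
    cases h with
    | ind i e h => cases he.symm.trans h
    | aux _ x h => rfl
    | other _ a' h hn => cases he.symm.trans h
  rcases hR with (hR | hR) | ⟨⟨S, b⟩, hf, hR⟩
  · obtain ⟨a₁, ha₁, rfl⟩ := K.ground_inds hR (.inl rfl)
    obtain ⟨a₂, ha₂, rfl⟩ := K.ground_inds hR (.inr rfl)
    obtain ⟨i, rfl, rfl⟩ := hind h₁ ha₁ rfl
    obtain ⟨j, rfl, rfl⟩ := hind h₂ ha₂ rfl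
    exact ⟨_, _, rfl, rfl, .inl (.inl ((hA.role i j R).1 hR))⟩
  · exact ⟨e₁, e₂, h₁.eq_self hA (K.fixed_names hR _ (.inl rfl)),
      h₂.eq_self hA (K.fixed_names hR _ (.inr rfl)), .inl (.inr hR)⟩
  · obtain ⟨hb₁, hb₂⟩ := Spec.base_of_mem_treeABox_role hR
    cases b with
    | inl b =>
      obtain ⟨i, hi, rfl⟩ := hind h₁ (K.flex_ind hf).2 hb₁
      obtain ⟨j, hj, rfl⟩ := hind h₂ (K.flex_ind hf).2 hb₂
      rw [← (hA.eq i j).1 (Subtype.ext (hi.symm.trans hj))]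
      exact ⟨_, _, rfl, rfl, .inr ⟨(S, .inl (v'.b i)), (hA.flex i S).1 (hi ▸ hf),
        Spec.treeABox_rebase hR _⟩⟩
    | inr x =>
      exact ⟨_, _, haux h₁ hb₁, haux h₂ hb₂, .inr ⟨_, K.flex_aux hf _, hR⟩⟩

theorem Corr.roleDer {v v' : Val P ι} (hA : K.Agree v v') {e₁ e₂ : XName NI NR NV}
    {o₁ o₂ : Option (XName NI NR NV)} (h₁ : Corr v v' (some e₁) o₁) (h₂ : Corr v v' (some e₂) o₂)
    {R : Role NR} (hR : RoleDer P.O (K.kb v.X v.t) R e₁ e₂) :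
    ∃ e₁' e₂', o₁ = some e₁' ∧ o₂ = some e₂' ∧ RoleDer P.O (K.kb v'.X v'.t) R e₁' e₂' := by
  obtain ⟨S, hS, hR | hR⟩ := hR
  · obtain ⟨e₁', e₂', rfl, rfl, h⟩ := h₁.role_mem hA h₂ hR
    exact ⟨_, _, rfl, rfl, S, hS, .inl h⟩
  · obtain ⟨e₂', e₁', rfl, rfl, h⟩ := h₂.role_mem hA h₁ hR
    exact ⟨_, _, rfl, rfl, S, hS, .inr h⟩

theorem Corr.self (v v' : Val P ι) (i : ι) :
    Corr v v' (some (.ind (v.b i))) (some (.ind (v'.b i))) :=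
  Corr.ind i (.ind (v.b i : NI)) rfl

/-- The conditions for consistency that concern a single individual. -/
def LocallyConsistent (K : Fam P) (v : Val P Unit) : Prop :=
  (∀ e : XName NI NR NV, e.base = .inl (v.b () : NI) →
    TypeSat (XName NI NR NV) P.O (asserted (K.kb v.X v.t) e)) ∧
  ∀ B, .nconc B (.ind (v.b ())) ∈ K.ground v.X v.t →
    ¬ Der P.O (asserted (K.kb v.X v.t) (.ind (v.b ()))) B

theorem nconc_mem_kb {X : Inst P} {t : X.Time} {B : Basic NC NR} {e : XName NI NR NV} :
    .nconc B e ∈ K.kb X t ↔ .nconc B e ∈ K.ground X t :=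
  ⟨fun h => h.elim (fun h => h.elim id fun h => (K.fixed_pos h).elim)
    fun h => (Spec.flexABox_isPos h).elim, fun h => .inl (.inl h)⟩

theorem nrole_mem_kb {X : Inst P} {t : X.Time} {R : Role NR} {e e' : XName NI NR NV} :
    .nrole R e e' ∈ K.kb X t ↔ .nrole R e e' ∈ K.ground X t :=
  ⟨fun h => h.elim (fun h => h.elim id fun h => (K.fixed_pos h).elim)
    fun h => (Spec.flexABox_isPos h).elim, fun h => .inl (.inl h)⟩

variable (K) in
-- The conditions of `consistent_iff` are sorted by the root of the name. Data individuals and pairs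
-- are handled by quantification and `Agree`; names over some `a_x` carry the same concepts for all
-- data.
theorem fo_consistent (hP : P.WellFormed) :
    FO fun v : Val P ι => Consistent P.O (K.kb v.X v.t) := by
  have h₁ : FO fun v : Val P (ι ⊕ Unit) => K.LocallyConsistent ⟨v.X, v.t, fun _ => v.b (.inr ())⟩ := by
    refine FO.relabel (R := K.LocallyConsistent) (K.finDet_agree.fo ?_) fun _ => Sum.inr ()
    rintro v v' hA ⟨ht, hn⟩
    refine ⟨fun e he => ?_, fun B hB hd => ?_⟩
    · exact (ht (e.rebase (.inl (v.b ()))) (by simp)).mono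
        ((Corr.ind () e he).asserted hA.symm)
    · exact hn B ((hA.nconc () B).2 hB) (hd.mono ((Corr.self v' v ()).asserted hA.symm))
  have h₂ : FO fun v : Val P (ι ⊕ Bool) => ∀ R,
      .nrole R (.ind (v.b (.inr false))) (.ind (v.b (.inr true))) ∈ K.ground v.X v.t →
      ¬ RoleDer P.O (K.kb v.X v.t) R (.ind (v.b (.inr false))) (.ind (v.b (.inr true))) := by
    refine FO.relabel (R := fun v : Val P Bool => ∀ R,
      .nrole R (.ind (v.b false)) (.ind (v.b true)) ∈ K.ground v.X v.t →
      ¬ RoleDer P.O (K.kb v.X v.t) R (.ind (v.b false)) (.ind (v.b true)))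
      (K.finDet_agree.fo ?_) Sum.inr
    intro v v' hA h R hR hd
    obtain ⟨_, _, h₁, h₂, hd⟩ := (Corr.self v' v false).roleDer hA.symm (Corr.self v' v true) hd
    cases h₁
    cases h₂
    exact h R ((hA.nrole _ _ R).2 hR) hd
  have h₃ : FO fun v : Val P ι => TypeSat (XName NI NR NV) P.O ∅ ∧
      ∀ (e : XName NI NR NV) (x : NV), e.base = .inr x →
        TypeSat (XName NI NR NV) P.O (asserted (K.kb v.X v.t) e) := by
    refine Defin.const ?_
    rintro v v' ⟨h₀, h⟩
    refine ⟨h₀, fun e x he => (h e x he).mono fun B hB => ?_⟩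
    rcases mem_kb_asserted hB with ⟨a, ha, rfl, h⟩ | ⟨-, h⟩ | ⟨S, hS, h⟩
    · cases he
    · exact asserted_fixed_sub _ _ _ h
    · rw [he] at hS h
      exact asserted_tree_sub _ _ (K.flex_aux hS _) h
  refine (h₃.and ((FO.forall_inds h₁).and (FO.forall_inds h₂))).congr fun v => ?_
  rw [consistent_iff hP.horn]
  constructor
  · rintro ⟨⟨h₀, ha⟩, hl, hr⟩
    refine ⟨h₀, fun e => ?_, fun B e h => ?_, fun R e e' h => ?_⟩
    · cases hb : e.base with
      | inr x => exact ha e x hb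
      | inl a =>
        by_cases hi : a ∈ v.X.D.inds
        · exact (hl fun _ => ⟨a, hi⟩).1 e hb
        -- Nothing is stated about names over individuals outside the data, so satisfiability of the
        -- empty type is enough.
        · refine h₀.mono fun B hB => ?_
          rcases mem_kb_asserted hB with ⟨a, ha, rfl, h⟩ | ⟨⟨a, ha, rfl⟩ | ⟨x, rfl⟩, h⟩ | ⟨S, hS, h⟩
          · obtain rfl := Sum.inl.inj hb
            exact absurd ha hi
          · obtain rfl := Sum.inl.inj hb
            exact absurd (v.X.sub ha) hi
          · cases hb
          · rw [hb] at hS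
            exact absurd (K.flex_ind hS).2 hi
    · have h := nconc_mem_kb.1 h
      obtain ⟨a, ha, rfl⟩ := K.ground_inds h rfl
      exact (hl fun _ => ⟨a, ha⟩).2 B h
    · have h := nrole_mem_kb.1 h
      obtain ⟨a, ha, rfl⟩ := K.ground_inds h (.inl rfl)
      obtain ⟨b, hb, rfl⟩ := K.ground_inds h (.inr rfl)
      exact hr (fun k => cond k ⟨b, hb⟩ ⟨a, ha⟩) R h
  · rintro ⟨h₀, ht, hc, hr⟩
    exact ⟨⟨h₀, fun e _ _ => ht e⟩, fun c => ⟨fun e _ => ht e, fun B h => hc B _ (nconc_mem_kb.2 h)⟩,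
      fun c R h => hr R _ _ (nrole_mem_kb.2 h)⟩

variable (K) in
theorem fo_entails_conc (hP : P.WellFormed) (B : Basic NC NR) (i : ι) :
    FO fun v : Val P ι => Entails P.O (K.kb v.X v.t) (.conc B (.ind (v.b i))) := by
  have h : FO fun v : Val P Unit => Der P.O (asserted (K.kb v.X v.t) (.ind (v.b ()))) B :=
    K.finDet_agree.fo fun v v' hA hd => hd.mono ((Corr.self v v' ()).asserted hA)
  exact ((K.fo_consistent hP).imp (FO.relabel h fun _ => i)).congr fun v =>
    (entails_conc_iff hP.horn).symm

variable (K) in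
theorem fo_entails_role (hP : P.WellFormed) (R : Role NR) (i j : ι) :
    FO fun v : Val P ι => Entails P.O (K.kb v.X v.t) (.role R (.ind (v.b i)) (.ind (v.b j))) := by
  have h : FO fun v : Val P Bool =>
      RoleDer P.O (K.kb v.X v.t) R (.ind (v.b false)) (.ind (v.b true)) := by
    refine K.finDet_agree.fo fun v v' hA hd => ?_
    obtain ⟨_, _, h₁, h₂, hd⟩ := (Corr.self v v' false).roleDer hA (Corr.self v v' true) hd
    cases h₁
    cases h₂
    exact hd
  exact ((K.fo_consistent hP).imp (FO.relabel h fun k => cond k j i)).congr fun v =>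
    (entails_role_iff hP.horn).symm

/-! ### Transporting matches of conjunctive queries -/

theorem Corr.seed {v v' : Val P ι} (hA : K.Agree v v') {o o' : Option (XName NI NR NV)}
    (h : Corr v v' o o') (w : List (Role NR)) :
    seed (K.kb v.X v.t) o w ⊆ TDL.seed (K.kb v'.X v'.t) o' w := by
  cases w with
  | nil => exact h.asserted hA
  | cons => exact subset_rfl

theorem Corr.isNode {v v' : Val P ι} (hA : K.Agree v v') {o o' : Option (XName NI NR NV)}
    (h : Corr v v' o o') {w : List (Role NR)} (hw : IsNode P.O (K.kb v.X v.t) o w) :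
    IsNode P.O (K.kb v'.X v'.t) o' w := by
  induction w with
  | nil => trivial
  | cons R w ih => exact ⟨ih hw.1, hw.2.mono (h.seed hA w)⟩

/-- There is a match of `q` in the canonical model that uses only the individuals `v.b i`, in
addition to the elements that do not depend on the data. -/
def Match (K : Fam P) (q : CQ NI NC NR NV) (v : Val P ι) : Prop :=
  ∃ f : Term NI NV → (Can P.O (K.kb v.X v.t)).Dom,
    (∀ a ∈ CQ.inds q, (f (.ind a)).1 = (some (.ind a), [])) ∧
    (∀ t, ∀ a ∈ v.X.D.inds, (f t).1.1.map XName.base = some (.inl a) → ∃ i, a = v.b i) ∧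
    (∀ B t, .conc B t ∈ q → Der P.O (seed (K.kb v.X v.t) (f t).1.1 (f t).1.2) B) ∧
    ∀ R s t, .role R s t ∈ q → CanRole P.O (K.kb v.X v.t) R (f s).1 (f t).1

/-- Each element of the match keeps its path and has its root replaced by the corresponding one. The
covering condition ensures that roots over data individuals have a counterpart; unnamed individuals
outside the data go to `none`. -/
theorem Match.transport {q : CQ NI NC NR NV} (hq : CQ.inds q ⊆ P.Φ.inds) {v v' : Val P ι}
    (hA : K.Agree v v') (h : K.Match q v) : K.Match q v' := by
  obtain ⟨f, hind, hcov, hconc, hrole⟩ := h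
  have hex : ∀ t, ∃ o, Corr v v' (f t).1.1 o ∧
      ∀ a ∈ v'.X.D.inds, o.map XName.base = some (.inl a) → ∃ i, a = v'.b i := by
    intro t
    have hcov := hcov t
    revert hcov
    cases (f t).1.1 with
    | none => exact fun _ => ⟨none, .none, by simp⟩
    | some e =>
      intro hcov
      cases he : e.base with
      | inr x => exact ⟨some e, .aux e x he, by simp [he]⟩
      | inl a =>
        by_cases ha : a ∈ v.X.D.inds
        · obtain ⟨i, rfl⟩ := hcov a ha (by simp [he])
          refine ⟨_, .ind i e he, fun a _ h => ⟨i, ?_⟩⟩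
          simpa using h.symm
        · exact ⟨none, .other e a he ha, by simp⟩
  choose o ho hcov' using hex
  refine ⟨fun t => ⟨(o t, (f t).1.2), (ho t).isNode hA (f t).2⟩, fun a ha => ?_, hcov',
    fun B t h => (hconc B t h).mono ((ho t).seed hA _), fun R s t h => ?_⟩
  · have h := ho (.ind a)
    rw [hind a ha] at h
    simp only [hind a ha, h.eq_self hA (.inl ⟨a, hq ha, rfl⟩)]
  · have hs := ho s
    have ht := ho t
    rcases hrole R s t h with ⟨a, b, h₁, h₂, hd⟩ | ⟨S, h₁, hS⟩ | ⟨S, h₁, hS⟩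
    · rw [h₁] at hs
      rw [h₂] at ht
      obtain ⟨_, _, h₃, h₄, hd⟩ := hs.roleDer hA ht hd
      exact .inl ⟨_, _, by simp [h₁, h₃], by simp [h₂, h₄], hd⟩
    · rw [h₁] at ht
      exact .inr (.inl ⟨S, by simp [h₁, ht.unique hA hs], hS⟩)
    · rw [h₁] at hs
      exact .inr (.inr ⟨S, by simp [h₁, hs.unique hA ht], hS⟩)

theorem satCQ_iff_match (q : CQ NI NC NR NV) (v : Val P ι) :
    XInterp.SatCQ (Can P.O (K.kb v.X v.t)) q ↔ ∃ (U : Set {t // t ∈ CQ.terms q})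
      (c : U → v.X.D.inds), K.Match q (⟨v.X, v.t, Sum.elim v.b c⟩ : Val P (ι ⊕ U)) := by
  classical
  constructor
  · rintro ⟨π, hπ⟩
    let g := XInterp.termVal (Can P.O (K.kb v.X v.t)) π
    let f : Term NI NV → (Can P.O (K.kb v.X v.t)).Dom :=
      -- Terms outside `q` are sent to the root `none`, so that only the finitely many terms of `q`
      -- need covering individuals.
      fun t => if t ∈ CQ.terms q then g t else ⟨(none, []), trivial⟩
    have hf : ∀ t ∈ CQ.terms q, f t = g t := fun t ht => if_pos ht
    let U : Set {t // t ∈ CQ.terms q} :=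
      {t | ∃ a : v.X.D.inds, (f t.1).1.1.map XName.base = some (.inl a.1)}
    choose c hc using fun u : U => u.2
    refine ⟨U, c, f, fun a ha => congrArg Subtype.val (hf _ ha), fun t a ha h => ?_,
      fun B t h => ?_, fun R s t h => ?_⟩
    · by_cases ht : t ∈ CQ.terms q
      · refine ⟨.inr ⟨⟨t, ht⟩, ⟨a, ha⟩, h⟩, ?_⟩
        exact Sum.inl.inj (Option.some.inj (h.symm.trans (hc ⟨⟨t, ht⟩, ⟨a, ha⟩, h⟩)))
      · simp [f, ht] at h
    · rw [hf t ⟨_, h, rfl⟩]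
      exact Can.mem_basicExt.1 (hπ _ h)
    · rw [hf s ⟨_, h, .inl rfl⟩, hf t ⟨_, h, .inr rfl⟩]
      exact Can.mem_roleExt.1 (hπ _ h)
  · rintro ⟨U, c, f, hind, -, hconc, hrole⟩
    have hf : ∀ t ∈ CQ.terms q,
        XInterp.termVal (Can P.O (K.kb v.X v.t)) (fun x => f (.var x)) t = f t := by
      rintro (a | x) ht
      · exact Subtype.ext (hind a ht).symm
      · rfl
    refine ⟨fun x => f (.var x), ?_⟩
    rintro (⟨B, t⟩ | ⟨R, s, t⟩) h
    · refine Can.mem_basicExt.2 ?_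
      rw [hf t ⟨_, h, rfl⟩]
      exact hconc B t h
    · refine Can.mem_roleExt.2 ?_
      rw [hf s ⟨_, h, .inl rfl⟩, hf t ⟨_, h, .inr rfl⟩]
      exact hrole R s t h

variable (K) in
-- The set `U` of terms matched above data individuals ranges over finitely many possibilities. Once
-- their individuals are quantified, existence of a match is invariant under `Agree`, although the
-- trees it uses may be infinite.
theorem fo_entailsCQ [Finite ι] (hP : P.WellFormed) {q : CQ NI NC NR NV}
    (hq : CQ.inds q ⊆ P.Φ.inds) :
    FO fun v : Val P ι => EntailsCQ P.O (K.kb v.X v.t) q := by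
  have := (CQ.finite_terms q).to_subtype
  have h : FO fun v : Val P ι => XInterp.SatCQ (Can P.O (K.kb v.X v.t)) q :=
    (Defin.exists_finite fun U : Set {t // t ∈ CQ.terms q} => FO.exists_inds (κ := U)
      (R := K.Match q) (K.finDet_agree.fo fun _ _ hA => Match.transport (K := K) hq hA)).congr fun v =>
        (satCQ_iff_match q v).symm
  exact ((K.fo_consistent hP).imp h).congr fun v => (entailsCQ_iff hP.horn).symm

end Fam

end Families

end TDL

namespace TDL

/-! ## First-order definability of the minimized tuple -/

section Minimized

variable {NI NC NR NV : Type} {P : Spec NI NC NR NV} {ι : Type}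

theorem ABoxSeq.extBot_coe (D : ABoxSeq NI NC NR) (p : Fin (D.n + 1)) :
    D.extBot (NV := NV) p = D.ext p := by
  ext α
  constructor
  · rintro ⟨q, h, hα⟩
    rwa [WithBot.coe_inj.1 h]
  · exact fun h => ⟨p, rfl, h⟩

theorem ABoxSeq.extBot_sub (D : ABoxSeq NI NC NR) (t : WithBot (Fin (D.n + 1))) :
    ∃ p, D.extBot (NV := NV) t ⊆ D.ext p := by
  cases t with
  | bot => exact ⟨0, fun α ⟨_, h, _⟩ => absurd h WithBot.bot_ne_coe⟩
  | coe p => exact ⟨p, (D.extBot_coe p).subset⟩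

/-- The additional time point `-1` does not contribute consequences. -/
theorem exists_entails_ext_iff {O : Ontology NC NR} {D : ABoxSeq NI NC NR}
    {A : Set (XAssertion NI NC NR NV)} {α : XAssertion NI NC NR NV} :
    (∃ p, Entails O (A ∪ D.ext p) α) ↔ ∃ t, Entails O (A ∪ D.extBot t) α := by
  constructor
  · rintro ⟨p, h⟩
    exact ⟨p, by rwa [D.extBot_coe]⟩
  · rintro ⟨t, h⟩
    obtain ⟨p, hp⟩ := D.extBot_sub (NV := NV) t
    exact ⟨p, h.mono (Set.union_subset_union_right _ hp)⟩

theorem Inst.extBot_inds {X : Inst P} {t : X.Time} {α : XAssertion NI NC NR NV}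
    (h : α ∈ X.D.extBot t) : α.inds ⊆ Spec.kbInds X.D := by
  obtain ⟨p, -, β, hβ, rfl⟩ := h
  rcases β with ⟨B, a⟩ | ⟨B, a⟩ | ⟨R, a, b⟩ | ⟨R, a, b⟩
  · rintro _ rfl
    exact ⟨a, ⟨p, _, hβ, rfl⟩, rfl⟩
  · rintro _ rfl
    exact ⟨a, ⟨p, _, hβ, rfl⟩, rfl⟩
  · rintro _ (rfl | rfl)
    · exact ⟨a, ⟨p, _, hβ, .inl rfl⟩, rfl⟩
    · exact ⟨b, ⟨p, _, hβ, .inr rfl⟩, rfl⟩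
  · rintro _ (rfl | rfl)
    · exact ⟨a, ⟨p, _, hβ, .inl rfl⟩, rfl⟩
    · exact ⟨b, ⟨p, _, hβ, .inr rfl⟩, rfl⟩

theorem Inst.extBot_over {X : Inst P} {t : X.Time} {α : XAssertion NI NC NR NV}
    (h : α ∈ X.D.extBot t) : α.Over P.O.concNames P.O.roleNames := by
  obtain ⟨p, -, β, hβ, rfl⟩ := h
  have := X.sig p β hβ
  cases β <;> exact this

/-- Sets of assertions about the individuals of the data that are uniformly definable. -/
structure GroundDef (L : Inst P → Set (XAssertion NI NC NR NV)) : Prop where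
  inds : ∀ {X α}, α ∈ L X → α.inds ⊆ Spec.kbInds X.D
  inSig : ∀ {X α}, α ∈ L X → α.Over P.O.concNames P.O.roleNames
  fo_conc : ∀ B, FO fun v : Val P Unit => .conc B (.ind (v.b ())) ∈ L v.X
  fo_nconc : ∀ B, FO fun v : Val P Unit => .nconc B (.ind (v.b ())) ∈ L v.X
  fo_role : ∀ R, FO fun v : Val P Bool => .role R (.ind (v.b false)) (.ind (v.b true)) ∈ L v.X
  fo_nrole : ∀ R, FO fun v : Val P Bool => .nrole R (.ind (v.b false)) (.ind (v.b true)) ∈ L v.X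

/-- The family that consists of a definable set, the ABox of the time point, and fixed and tree
assertions. -/
def GroundDef.fam {L : Inst P → Set (XAssertion NI NC NR NV)} (h : GroundDef L)
    (C : Set (XAssertion NI NC NR NV)) (F : Inst P → Set (Role NR × (NI ⊕ NV)))
    (hC : ∀ {α}, α ∈ C → α.IsPos)
    (hC' : ∀ {α}, α ∈ C → ∀ e ∈ α.inds, (∃ a ∈ P.Φ.inds, e = .ind a) ∨ ∃ x, e = .aux x)
    (hF : ∀ {X S a}, (S, .inl a) ∈ F X → S ∈ P.flexRoles ∧ a ∈ X.D.inds)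
    (hF' : ∀ {X S x}, (S, .inr x) ∈ F X → ∀ X', (S, .inr x) ∈ F X')
    (hfo : ∀ S, FO fun v : Val P Unit => (S, .inl (v.b () : NI)) ∈ F v.X) : Fam P where
  ground X t := L X ∪ X.D.extBot t
  fixed := C
  flex := F
  ground_inds hα := hα.elim h.inds Inst.extBot_inds
  ground_over hα := hα.elim h.inSig Inst.extBot_over
  fixed_pos := hC
  fixed_names := hC'
  flex_ind := hF
  flex_aux := hF'
  fo_conc B := (h.fo_conc B).or (FO.conc_ext B ())
  fo_nconc B := (h.fo_nconc B).or (FO.nconc_ext B ())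
  fo_role R := (h.fo_role R).or (FO.role_ext R false true)
  fo_nrole R := (h.fo_nrole R).or (FO.nrole_ext R false true)
  fo_flex := hfo

/-- The family without fixed and tree assertions. -/
def GroundDef.simpleFam {L : Inst P → Set (XAssertion NI NC NR NV)} (h : GroundDef L) : Fam P :=
  h.fam ∅ (fun _ => ∅) (fun h => h.elim) (fun h => h.elim) (fun h => h.elim) (fun h => h.elim)
    fun _ => Defin.const fun _ _ h => h.elim

theorem GroundDef.simpleFam_kb {L : Inst P → Set (XAssertion NI NC NR NV)} (h : GroundDef L)
    (X : Inst P) (t : X.Time) : h.simpleFam.kb X t = L X ∪ X.D.extBot t := by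
  have : P.flexABox ∅ = ∅ := by simp [Spec.flexABox]
  simp [Fam.kb, simpleFam, fam, this]

theorem GroundDef.fo_exists_entails_conc {L : Inst P → Set (XAssertion NI NC NR NV)}
    (h : GroundDef L) (hP : P.WellFormed) (B : Basic NC NR) (i : ι) :
    FO fun v : Val P ι => ∃ p, Entails P.O (L v.X ∪ v.X.D.ext p) (.conc B (.ind (v.b i))) :=
  (FO.exists_time (h.simpleFam.fo_entails_conc hP B i)).congr fun v => by
    simp only [h.simpleFam_kb]
    exact exists_entails_ext_iff.symm

theorem GroundDef.fo_exists_entails_role {L : Inst P → Set (XAssertion NI NC NR NV)}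
    (h : GroundDef L) (hP : P.WellFormed) (R : Role NR) (i j : ι) :
    FO fun v : Val P ι =>
      ∃ p, Entails P.O (L v.X ∪ v.X.D.ext p) (.role R (.ind (v.b i)) (.ind (v.b j))) :=
  (FO.exists_time (h.simpleFam.fo_entails_role hP R i j)).congr fun v => by
    simp only [h.simpleFam_kb]
    exact exists_entails_ext_iff.symm

theorem finDet_const [Finite ι] : FinDet fun v v' : Val P ι =>
    ∀ i (c : P.Φ.inds), (v.b i : NI) = c ↔ (v'.b i : NI) = c := by
  have := P.Φ.finite_inds.to_subtype
  exact FinDet.forall_finite fun i => FinDet.forall_finite fun c => FinDet.of_fo (FO.eq_const i c)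

theorem Spec.conc_mem_rigPos_iff {X : Inst P} {B : Basic NC NR} (a : X.D.inds) :
    (.conc B (.ind a) : XAssertion NI NC NR NV) ∈ P.rigPos (kbInds X.D) ↔
      B.Over (P.O.concNames ∩ P.rigC) (P.O.roleNames ∩ P.rigR) :=
  ⟨fun h => h.2.2, fun h => ⟨trivial, by rintro _ rfl; exact ⟨a, a.2, rfl⟩, h⟩⟩

theorem Spec.role_mem_rigPos_iff {X : Inst P} {R : Role NR} (a b : X.D.inds) :
    (.role R (.ind a) (.ind b) : XAssertion NI NC NR NV) ∈ P.rigPos (kbInds X.D) ↔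
      R.base ∈ P.O.roleNames ∩ P.rigR :=
  ⟨fun h => h.2.2, fun h => ⟨trivial, by
    rintro _ (rfl | rfl)
    · exact ⟨a, a.2, rfl⟩
    · exact ⟨b, b.2, rfl⟩, h⟩⟩

theorem Assertion.Over.mono {N : Type} {C C' : Set NC} {R R' : Set NR} (hC : C ⊆ C') (hR : R ⊆ R')
    {α : Assertion N NC NR} (h : α.Over C R) : α.Over C' R' := by
  cases α
  · exact Basic.Over.mono hC hR h
  · exact Basic.Over.mono hC hR h
  · exact hR h
  · exact hR h

theorem Spec.over_of_mem_rigPos {N : Type} {X : Set N} {α : Assertion N NC NR}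
    (h : α ∈ P.rigPos X) : α.Over P.O.concNames P.O.roleNames :=
  Assertion.Over.mono Set.inter_subset_left Set.inter_subset_left h.2.2

/-- Every stage of the construction of the rigid ABox type is definable. -/
theorem groundDef_rigidStage (hP : P.WellFormed) {BΦ : Set (Assertion NI NC NR)}
    (hB : BΦ ⊆ P.guessSpace) (j : ℕ) :
    GroundDef fun X : Inst P => P.rigidStage X.D BΦ j := by
  have hneg : ∀ {X : Inst P} {α : XAssertion NI NC NR NV}, ¬ α.IsPos →
      α ∉ P.rigidStage X.D BΦ j := fun hα h => hα (Spec.rigidStage_sub_rigPos j h).1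
  suffices h : (∀ B, FO fun v : Val P Unit =>
        .conc B (.ind (v.b ())) ∈ P.rigidStage (NV := NV) v.X.D BΦ j) ∧
      ∀ R, FO fun v : Val P Bool =>
        .role R (.ind (v.b false)) (.ind (v.b true)) ∈ P.rigidStage (NV := NV) v.X.D BΦ j from
    { inds := fun h => (Spec.rigidStage_sub_rigPos j h).2.1
      inSig := fun h => Spec.over_of_mem_rigPos (Spec.rigidStage_sub_rigPos j h)
      fo_conc := h.1
      fo_nconc := fun B => Defin.const fun _ _ h => absurd h (hneg id)
      fo_role := h.2
      fo_nrole := fun R => Defin.const fun _ _ h => absurd h (hneg id) }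
  clear hneg
  induction j with
  | zero =>
    -- Stage zero speaks only about individuals of `Φ`, so equality with the constants decides
    -- membership.
    have hC : ∀ α ∈ Assertion.map XName.ind '' BΦ ∪ P.rigCons P.minPos, ∀ a : NI,
        .ind a ∈ α.inds → a ∈ P.Φ.inds := by
      rintro α (⟨β, hβ, rfl⟩ | h) a ha
      · obtain ⟨B, -, b, hb, rfl⟩ := hB hβ
        obtain rfl := XName.ind.inj ha
        exact hb
      · exact Spec.RComplete.mem_inds_of_mem_rigCons (fun _ h => h.1) h ha
    constructor
    · intro B
      refine finDet_const.fo ?_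
      rintro v v' hE ⟨hr, h⟩
      refine ⟨(Spec.conc_mem_rigPos_iff _).2 ((Spec.conc_mem_rigPos_iff _).1 hr), ?_⟩
      have := (hE () ⟨_, hC _ h _ rfl⟩).1 rfl
      simp only at this
      rwa [this]
    · intro R
      refine finDet_const.fo ?_
      rintro v v' hE ⟨hr, h⟩
      refine ⟨(Spec.role_mem_rigPos_iff _ _).2 ((Spec.role_mem_rigPos_iff _ _).1 hr), ?_⟩
      have h₁ := (hE false ⟨_, hC _ h _ (.inl rfl)⟩).1 rfl
      have h₂ := (hE true ⟨_, hC _ h _ (.inr rfl)⟩).1 rfl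
      simp only at h₁ h₂
      rwa [h₁, h₂]
  | succ j ih =>
    have hG : GroundDef fun X : Inst P => P.rigidStage X.D BΦ j :=
      { inds := fun h => (Spec.rigidStage_sub_rigPos j h).2.1
        inSig := fun h => Spec.over_of_mem_rigPos (Spec.rigidStage_sub_rigPos j h)
        fo_conc := ih.1
        fo_nconc := fun B => Defin.const fun _ _ h => (Spec.rigidStage_sub_rigPos j h).1.elim
        fo_role := ih.2
        fo_nrole := fun R => Defin.const fun _ _ h => (Spec.rigidStage_sub_rigPos j h).1.elim }
    constructor
    · intro B
      refine Defin.and (Defin.const fun v v' h => ?_) (hG.fo_exists_entails_conc hP B ())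
      exact (Spec.conc_mem_rigPos_iff _).2 ((Spec.conc_mem_rigPos_iff _).1 h)
    · intro R
      refine Defin.and (Defin.const fun v v' h => ?_) (hG.fo_exists_entails_role hP R false true)
      exact (Spec.role_mem_rigPos_iff _ _).2 ((Spec.role_mem_rigPos_iff _ _).1 h)

/-- An increasing sequence of subsets of a finite set that does not grow again after it has stopped
growing stops after as many steps as the set has elements. -/
theorem chain_stable {β : Type} {S : Set β} (hS : S.Finite) {u : ℕ → Set β} (hu : Monotone u)
    (huS : ∀ i, u i ⊆ S)
    (h : ∀ i < S.ncard, u (i + 1) ⊆ u i → u (i + 2) ⊆ u (i + 1)) :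
    u (S.ncard + 1) ⊆ u S.ncard := by
  have hstrict : ∀ i, ¬ u (i + 1) ⊆ u i → (u i).ncard < (u (i + 1)).ncard := fun i hi =>
    Set.ncard_lt_ncard ⟨hu i.le_succ, hi⟩ (hS.subset (huS _))
  have key : ∀ i ≤ S.ncard, u (i + 1) ⊆ u i ∨ i + 1 ≤ (u (i + 1)).ncard := by
    intro i
    induction i with
    | zero =>
      intro _
      exact or_iff_not_imp_left.2 fun hn => Nat.succ_le_of_lt (Nat.zero_lt_of_lt (hstrict 0 hn))
    | succ i ih =>
      intro hi
      rcases ih (Nat.le_of_succ_le hi) with hs | hc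
      · exact .inl (h i hi hs)
      · exact or_iff_not_imp_left.2 fun hn => Nat.succ_le_of_lt (hc.trans_lt (hstrict _ hn))
  exact (key _ le_rfl).resolve_right fun hc =>
    absurd (hc.trans (Set.ncard_le_ncard (huS _) hS)) (by simp)

theorem Entails.sub_role {O : Ontology NC NR} {A : Set (XAssertion NI NC NR NV)} {R S : Role NR}
    {a b : XName NI NR NV} (h : Entails O A (.role S a b)) (hS : SubR O S R) :
    Entails O A (.role R a b) :=
  fun I hI => hS.sound hI.1 (h I hI)

theorem Entails.role_flip {O : Ontology NC NR} {A : Set (XAssertion NI NC NR NV)} {S : Role NR}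
    {a b : XName NI NR NV} (h : Entails O A (.role S.flip b a)) : Entails O A (.role S a b) :=
  fun I hI => (I.mem_roleExt_flip _ _ _).1 (h I hI)

/-- The construction of the rigid ABox type stops at a stage that does not depend on the data. -/
theorem Spec.exists_rigidStage_bound (hP : P.WellFormed) (BΦ : Set (Assertion NI NC NR)) :
    ∃ N, ∀ (D : ABoxSeq NI NC NR) (j : ℕ),
      P.rigidStage (NV := NV) D BΦ j ⊆ P.rigidStage D BΦ N := by
  have hfin : P.rigBasics.Finite :=
    (finite_basics_over P.O.finite_concNames P.O.finite_roleNames).subset fun _ h =>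
      Basic.Over.mono Set.inter_subset_left Set.inter_subset_left h
  set M := P.rigBasics.ncard with hM
  -- Stage one completes the roles, `M` more steps complete the concepts at every individual. The
  -- last step covers inconsistency at stage `M + 1`, which makes stage `M + 2` contain every rigid
  -- assertion.
  refine ⟨M + 2, fun D j => ?_⟩
  set A : ℕ → Set (XAssertion NI NC NR NV) := P.rigidStage D BΦ with hA
  have hmono : Monotone A := rigidStage_mono
  by_cases hc : ∀ p, Consistent P.O (A (M + 1) ∪ D.ext p)
  swap
  · obtain ⟨p, hp⟩ := not_forall.1 hc
    exact fun α hα => ⟨rigidStage_sub_rigPos j hα, p, fun I hI => absurd ⟨I, hI⟩ hp⟩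
  have hcons : ∀ i ≤ M + 1, ∀ p, Consistent P.O (A i ∪ D.ext p) := fun i hi p =>
    (hc p).mono (Set.union_subset_union_left _ (hmono hi))
  -- In the consistent case a role assertion stems from one stated assertion by role inclusions, so
  -- composing inclusions reaches it in a single step.
  have hrole : ∀ i ≤ M + 1, ∀ R e e', .role R e e' ∈ A (i + 1) → .role R e e' ∈ A 1 := by
    intro i
    induction i with
    | zero => exact fun _ _ _ _ h => h
    | succ i ih =>
      rintro hi R e e' ⟨hr, p, h⟩
      refine ⟨hr, ?_⟩
      obtain ⟨S, hS, (h | h) | (h | h)⟩ := (entails_role_iff hP.horn).1 h (hcons _ hi p)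
      · obtain ⟨-, p', h⟩ := ih (Nat.le_of_succ_le hi) _ _ _ h
        exact ⟨p', h.sub_role hS⟩
      · exact ⟨p, (entails_of_mem (.inr h)).sub_role hS⟩
      · obtain ⟨-, p', h⟩ := ih (Nat.le_of_succ_le hi) _ _ _ h
        exact ⟨p', h.role_flip.sub_role hS⟩
      · exact ⟨p, (Entails.role_flip (entails_of_mem (.inr h))).sub_role hS⟩
  have hconc : ∀ e, {B | .conc B e ∈ A (M + 2)} ⊆ {B | .conc B e ∈ A (M + 1)} := by
    intro e
    -- With the roles complete, the next concepts at `e` depend only on the present concepts at `e`,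
    -- so growth at `e` cannot pause and resume. The chain starts at stage one for this reason.
    refine chain_stable hfin (u := fun i => {B | .conc B e ∈ A (i + 1)})
      (fun i i' h B hB => hmono (Nat.succ_le_succ h) hB)
      (fun i B hB => (rigidStage_sub_rigPos (P := P) (D := D) (BΦ := BΦ) (i + 1)
        (show Assertion.conc B e ∈ A (i + 1) from hB)).2.2) ?_
    rintro i hi hs B ⟨hr, p, h⟩
    refine ⟨hr, p, Der.entails hP.horn
      (((entails_conc_iff hP.horn).1 h (hcons (i + 2) (by omega) p)).mono ?_)⟩
    rw [asserted_union, asserted_union]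
    refine Set.union_subset_union_left _ ?_
    have hr : ∀ R e e', .role R e e' ∈ A (i + 2) → .role R e e' ∈ A (i + 1) := fun R e e' h =>
      hmono (by omega) (hrole (i + 1) (by omega) R e e' h)
    rintro B (hB | ⟨R, b, rfl, hR | hR⟩)
    · exact .inl (hs hB)
    · exact .inr ⟨R, b, rfl, .inl (hr _ _ _ hR)⟩
    · exact .inr ⟨R, b, rfl, .inr (hr _ _ _ hR)⟩
  have hstab : A (M + 2) ⊆ A (M + 1) := by
    rintro (⟨B, e⟩ | ⟨B, e⟩ | ⟨R, e, e'⟩ | ⟨R, e, e'⟩) h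
    · exact hconc e h
    · exact (rigidStage_sub_rigPos _ h).1.elim
    · exact hmono (by omega) (hrole (M + 1) le_rfl R e e' h)
    · exact (rigidStage_sub_rigPos _ h).1.elim
  have hstab' : ∀ i, A (M + 1 + i + 1) ⊆ A (M + 1 + i) := by
    intro i
    induction i with
    | zero => exact hstab
    | succ i ih =>
      rintro α ⟨hr, p, h⟩
      exact ⟨hr, p, h.mono (Set.union_subset_union_left _ ih)⟩
  have hall : ∀ i, A (M + 1 + i) ⊆ A (M + 1) := by
    intro i
    induction i with
    | zero => exact subset_rfl
    | succ i ih => exact (hstab' i).trans ih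
  exact (hmono (show j ≤ M + 1 + j by omega)).trans ((hall j).trans (hmono (by omega)))

/-- By the uniform bound the limit is a fixed stage; negative assertions are then defined by
negation, with no infinite conjunction over stages. -/
theorem groundDef_minRigid (hP : P.WellFormed) {BΦ : Set (Assertion NI NC NR)}
    (hB : BΦ ⊆ P.guessSpace) : GroundDef fun X : Inst P => P.minRigid (NV := NV) X.D BΦ := by
  obtain ⟨N, hN⟩ := Spec.exists_rigidStage_bound (NV := NV) hP BΦ
  have hG := groundDef_rigidStage hP hB N
  have hpos : ∀ {X : Inst P} {α : XAssertion NI NC NR NV}, α.IsPos →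
      (α ∈ P.rigidStage X.D BΦ N ↔ α ∈ P.minRigid X.D BΦ) := fun hα =>
    ⟨fun h => (Spec.mem_minRigid_of_pos hα).2 ⟨N, h⟩, fun h =>
      let ⟨j, hj⟩ := (Spec.mem_minRigid_of_pos hα).1 h
      hN _ j hj⟩
  have hneg : ∀ {X : Inst P} {α : XAssertion NI NC NR NV}, α.neg.IsPos →
      (α.neg ∈ P.rigPos (Spec.kbInds X.D) ∧ α.neg ∉ P.rigidStage X.D BΦ N ↔
        α ∈ P.minRigid X.D BΦ) := fun hα => by
    rw [Spec.mem_minRigid_of_neg hα]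
    exact and_congr_right fun _ => ⟨fun h j hj => h (hN _ j hj), fun h => h N⟩
  refine ⟨fun h => Spec.minRigid_inds h, ?_, fun B => ?_, fun B => ?_, fun R => ?_, fun R => ?_⟩
  · rintro X α (h | ⟨β, h, rfl⟩)
    · exact Spec.over_of_mem_rigPos h.1
    · have := Spec.over_of_mem_rigPos h.1
      cases β <;> exact this
  · exact (hG.fo_conc B).congr fun v => hpos trivial
  · refine (Defin.and (Defin.const fun v v' h => ?_) (hG.fo_conc B).not).congr fun v =>
      hneg (α := .nconc B (.ind (v.b ()))) trivial
    exact (Spec.conc_mem_rigPos_iff _).2 ((Spec.conc_mem_rigPos_iff _).1 h)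
  · exact (hG.fo_role R).congr fun v => hpos trivial
  · refine (Defin.and (Defin.const fun v v' h => ?_) (hG.fo_role R).not).congr fun v =>
      hneg (α := .nrole R (.ind (v.b false)) (.ind (v.b true))) trivial
    exact (Spec.role_mem_rigPos_iff _ _).2 ((Spec.role_mem_rigPos_iff _ _).1 h)

theorem fo_minFlex (hP : P.WellFormed) {BΦ : Set (Assertion NI NC NR)}
    (hB : BΦ ⊆ P.guessSpace) (S : Role NR) :
    FO fun v : Val P Unit =>
      (S, (.inl (v.b () : NI) : NI ⊕ NV)) ∈ (P.minTuple v.X.D BΦ).flex := by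
  have := P.Φ.finite_inds.to_subtype
  have h₁ : FO fun v : Val P Unit => ∃ c : P.Φ.inds, (v.b () : NI) = c ∧
      (S ∈ P.flexRoles ∧ .conc (.ex S) c.1 ∈ BΦ) :=
    Defin.exists_finite fun c => (FO.eq_const () c).and (Defin.const fun _ _ h => h)
  have h₂ : FO fun v : Val P Unit => ¬ ∃ c : P.Φ.inds, (v.b () : NI) = c :=
    (Defin.exists_finite fun c => FO.eq_const () c).not
  have h₃ : FO fun _ : Val P Unit => S ∈ P.flexRoles := Defin.const fun _ _ h => h
  refine (h₁.or (h₃.and (h₂.and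
    ((groundDef_minRigid hP hB).fo_exists_entails_conc hP (.ex S) ())))).congr fun v => ?_
  constructor
  · rintro (⟨c, hc, hS, h⟩ | ⟨hS, hn, h⟩)
    · exact .inl (.inr ⟨hS, _, hc ▸ c.2, rfl, hc ▸ h⟩)
    · exact .inr ⟨hS, _, ⟨(v.b ()).2, fun h => hn ⟨⟨_, h⟩, rfl⟩⟩, rfl, h⟩
  · rintro ((⟨hS, x, -, h, -⟩ | ⟨hS, a, ha, h, hb⟩) | ⟨hS, a, ha, h, hb⟩)
    · cases h
    · exact .inl ⟨⟨a, ha⟩, Sum.inl.inj h, hS, hb⟩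
    · obtain rfl : (v.b () : NI) = a := Sum.inl.inj h
      exact .inr ⟨hS, fun ⟨c, hc⟩ => ha.2 (hc ▸ c.2), hb⟩

/-- The knowledge bases of the minimized tuple form a definable family. -/
theorem exists_fam_fullABox (hP : P.WellFormed) {BΦ : Set (Assertion NI NC NR)}
    (hB : BΦ ⊆ P.guessSpace) (j : Fin P.k) :
    ∃ K : Fam P, ∀ X t,
      K.kb X t = P.fullABox (P.minTuple X.D BΦ) (P.world j) ∪ X.D.extBot t := by
  have hnames : ∀ (q : CQ NI NC NR NV), q ∈ P.Φ.cqs →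
      ∀ e ∈ {e : XName NI NR NV | ∃ t ∈ CQ.terms q, e = t.inst},
        (∃ a ∈ P.Φ.inds, e = .ind a) ∨ ∃ x, e = .aux x := by
    rintro q hq _ ⟨a | x, ht, rfl⟩
    · exact .inl ⟨a, ⟨q, hq, ht⟩, rfl⟩
    · exact .inr ⟨x, rfl⟩
  refine ⟨(groundDef_minRigid hP hB).fam (P.rigCons P.minPos ∪ cqsABox (P.world j))
    (fun X => (P.minTuple X.D BΦ).flex) (fun h => h.elim Spec.rigCons_isPos cqsABox_isPos) ?_ ?_ ?_
    (fo_minFlex hP hB), fun X t => ?_⟩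
  · rintro α (⟨q, hq, hr, -⟩ | ⟨q, hq, h⟩) e he
    · exact hnames q hq.1 e (hr.2.1 he)
    · exact hnames q (hP.worlds j hq) e (CQ.abox_inds h he)
  · rintro X S a ((⟨hS, x, -, h, -⟩ | ⟨hS, b, hb, h, -⟩) | ⟨hS, b, hb, h, -⟩)
    · cases h
    · obtain rfl : a = b := Sum.inl.inj h
      exact ⟨hS, X.sub hb⟩
    · obtain rfl : a = b := Sum.inl.inj h
      exact ⟨hS, hb.1⟩
  · rintro X S x ((h | ⟨hS, b, hb, h, -⟩) | ⟨hS, b, hb, h, -⟩) X'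
    · exact .inl (.inl h)
    · cases h
    · cases h
  · change (P.minRigid X.D BΦ ∪ X.D.extBot t) ∪ (P.rigCons P.minPos ∪ cqsABox (P.world j)) ∪
      P.flexABox (P.minTuple X.D BΦ).flex = ((P.minRigid X.D BΦ ∪ P.rigCons P.minPos ∪
        cqsABox (P.world j)) ∪ P.flexABox (P.minTuple X.D BΦ).flex) ∪ X.D.extBot t
    ac_rfl

/-- Definable properties of a time point are defined by formulas with one free variable. -/
theorem FO.exists_formula {R : Val P Empty → Prop} (h : FO R) :
    ∃ φ : (tdbLang NC NR P.Φ.inds).Formula Unit, ∀ (X : Inst P) (t : X.Time),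
      R ⟨X, t, Empty.elim⟩ ↔ TDBSat X.D X.sub φ t := by
  obtain ⟨φ, hφ⟩ := h
  obtain ⟨ψ, hψ⟩ := RawDefin.relabel (R := fun u => u.Sat φ) ⟨φ, fun u => Iff.rfl⟩
    (Sum.elim Empty.elim id : Empty ⊕ Unit → Unit)
  refine ⟨ψ, fun X t => (hφ ⟨X, t, Empty.elim⟩).symm.trans
    (Iff.trans ?_ (hψ ⟨X, fun _ => .inr t⟩).symm)⟩
  refine iff_of_eq (congrArg (fun w => RVal.Sat ⟨X, w⟩ φ) (funext ?_))
  rintro (i | i)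
  · exact i.elim
  · rfl

end Minimized

end TDL

theorem mainTheorem12 {NI NC NR NV : Type} (P : TDL.Spec NI NC NR NV) (hP : P.WellFormed) :
    (∀ D : TDL.ABoxSeq NI NC NR, D.InSig P.O → P.Φ.inds ⊆ D.inds →
      ∀ ι : Fin (D.n + 1) → Fin P.k,
        (∃ T : TDL.RTuple NI NC NR NV, P.RComplete D ι T) ↔
          ∃ BΦ ⊆ P.guessSpace, P.RComplete D ι (P.minTuple D BΦ)) ∧
    (∀ BΦ ⊆ P.guessSpace, ∀ j : Fin P.k,
      (∃ unsat : (TDL.tdbLang NC NR P.Φ.inds).Formula Unit,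
        ∀ D : TDL.ABoxSeq NI NC NR, D.InSig P.O → ∀ h : P.Φ.inds ⊆ D.inds,
          ∀ i : WithBot (Fin (D.n + 1)),
            ¬ TDL.Consistent P.O
                (P.fullABox (P.minTuple D BΦ) (P.world j) ∪ D.extBot i) ↔
              TDL.TDBSat D h unsat i) ∧
      (∀ q : TDL.CQ NI NC NR NV, TDL.CQ.inds q ⊆ P.Φ.inds →
        ∃ rew : (TDL.tdbLang NC NR P.Φ.inds).Formula Unit,
          ∀ D : TDL.ABoxSeq NI NC NR, D.InSig P.O → ∀ h : P.Φ.inds ⊆ D.inds,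
            ∀ i : WithBot (Fin (D.n + 1)),
              TDL.EntailsCQ P.O
                  (P.fullABox (P.minTuple D BΦ) (P.world j) ∪ D.extBot i) q ↔
                TDL.TDBSat D h rew i)) := by
  refine ⟨fun D _ hD ι => ⟨?_, ?_⟩, fun BΦ hB j => ?_⟩
  · rintro ⟨T, hT⟩
    exact ⟨_, TDL.Spec.RComplete.guess_sub, hT.minTuple hP hD⟩
  · rintro ⟨BΦ, -, h⟩
    exact ⟨_, h⟩
  · obtain ⟨K, hK⟩ := TDL.exists_fam_fullABox hP hB j
    constructor
    · obtain ⟨φ, hφ⟩ := TDL.FO.exists_formula (K.fo_consistent (ι := Empty) hP).not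
      refine ⟨φ, fun D hs h i => ?_⟩
      rw [← hφ ⟨D, hs, h⟩ i, hK]
    · intro q hq
      obtain ⟨φ, hφ⟩ := TDL.FO.exists_formula (K.fo_entailsCQ (ι := Empty) hP hq)
      refine ⟨φ, fun D hs h i => ?_⟩
      rw [← hφ ⟨D, hs, h⟩ i, hK]
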